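/- An \emph{oriented graded poset} is a finite graded poset $P$ (minimal elements have dimension $0$, covers raise the dimension by one) with a sign $o(y\to x)\in\{+,-\}$ for each pair such that $y$ covers $x$. For $U\subseteq P$ closed (downward closed), $n\in\mathbb N$ and $\alpha\in\{+,-\}$, let $\Delta_n^\alpha U=\{x\in U\mid \dim x=n,\ o(y\to x)=\alpha \text{ for all } y\in U \text{ covering } x\}$, let $\partial_n^\alpha U=\mathrm{cl}(\Delta_n^\alpha U)\cup\{x\in U\mid \dim y\le n\text{ for all }y\in U\text{ with } y\ge x\}$, where $\mathrm{cl}$ is the downward closure, and let $\partial_nU=\partial_n^+U\cup\partial_n^-U$, $\partial_{-1}U=\emptyset$, $\partial_n^\alpha x=\partial_n^\alpha\,\mathrm{cl}\{x\}$. \emph{Molecules} of $P$ are the closed subsets obtained from the sets $\mathrm{cl}\{x\}$ by forming unions $U_1\cup U_2$ of molecules properly contained in $U_1\cup U_2$ with $U_1\cap U_2=\partial_n^+U_1=\partial_n^-U_2$ for some $n$. $P$ is a \emph{regular directed complex} if for all $x\in P$, with $n=\dim x$: $\partial_k^+x\cap\partial_k^-x=\partial_{k-1}x$ for all $k<n$;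 if $n>0$, $\partial_{n-1}^\alpha x$ is a molecule; if $n>1$, $\partial_{n-2}^\alpha(\partial_{n-1}^\beta x)=\partial_{n-2}^\alpha x$ (for all $\alpha,\beta$). A \emph{map} $f\colon P\to Q$ is a function with $\partial_n^\alpha f(x)=f(\partial_n^\alpha x)$ for all $x,n,\alpha$. A \emph{regular atom} is a regular directed complex with a greatest element; its dimension is that of this element, and $\partial U=\partial_{\dim U-1}U$. Let $\mathbf{Atom}$ be a skeleton of the category of regular atoms and maps. A \emph{diagrammatic set} is a presheaf on $\mathbf{Atom}$. An \emph{$n$-cell} of $X$ of shape $U$ is an element $x\in X(U)$, equivalently a morphism $x\colon U\to X$, with $\dim U=n$; we write $U(x)=U$. The \emph{$n$-skeleton} $\sigma_{\le n}X\subseteq X$ consists of the cells that factor as $W\to V\to X$ with $\dim V\le n$; $\sigma_{\le -1}X=\emptyset$. For a closed subset $K$ of a regular atom, $K$ also denotes the presheaf of maps with image in $K$. A \emph{diagrammatic complex} $(X,\mathcal X)$ is a diagrammatic set $X$ with a set $\mathcal X_n$ of (generating) $n$-cells for each $n\in\mathbb N$ such that, for each $n$, the square formed by the inclusion $\coprod_{x\in\mathcal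 X_n}\partial U(x)\hookrightarrow\coprod_{x\in\mathcal X_n}U(x)$, the morphism $(x)_{x\in\mathcal X_n}\colon\coprod_{x\in\mathcal X_n}U(x)\to\sigma_{\le n}X$, its restriction $\coprod_{x\in\mathcal X_n}\partial U(x)\to\sigma_{\le n-1}X$ and the inclusion $\sigma_{\le n-1}X\hookrightarrow\sigma_{\le n}X$ is a pushout of diagrammatic sets. The \emph{Gray product} $P\boxtimes Q$ of oriented graded posets is the product poset with $o((x,y)\to(x',y))=o(x\to x')$ and $o((x,y)\to(x,y'))=(-)^{\dim x}o(y\to y')$. The \emph{Gray product} $X\boxtimes Y$ of diagrammatic sets is its extension by Day convolution, $(X\boxtimes Y)(W)=\int^{U,V}\mathrm{Hom}(W,U\boxtimes V)\times X(U)\times Y(V)$; for cells $x\colon U\to X$, $y\colon V\to Y$, the cell $x\boxtimes y\colon U\boxtimes V\to X\boxtimes Y$ is the class of $(\mathrm{id},x,y)$, where $U\boxtimes V$ is identified with the unique object of $\mathbf{Atom}$ isomorphic to it. \textbf{Proposition.} Let $(X,\mathcal X)$ and $(Y,\mathcal Y)$ be diagrammatic complexes. Then each pair of a cell $x$ of $X$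 and a cell $y$ of $Y$ has a well-defined product cell $x\boxtimes y$ of $X\boxtimes Y$, distinct pairs of generating cells have distinct products, and $X\boxtimes Y$ is a diagrammatic complex with $$(\mathcal X\boxtimes\mathcal Y)_n=\sum_{k=0}^n\{x\boxtimes y\mid x\in\mathcal X_k,\ y\in\mathcal Y_{n-k}\}$$ as its set of generating $n$-cells, for each $n\in\mathbb N$. -/

import Mathlib

open CategoryTheory Opposite

universe u

/-! ### Oriented graded posets -/

/-- An oriented graded poset: a poset graded over `ℕ`, minimal elements having dimension `0` and
covers raising the dimension by one, with a sign `orient h` for each edge `y → x` of the Hasse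
diagram (`h : x ⋖ y`, that is, `y` covers `x`). Finiteness is the separate class `Finite P`. -/
class OrientedGradedPoset (P : Type*) [PartialOrder P] extends GradeMinOrder ℕ P where
  orient : ∀ ⦃x y : P⦄, x ⋖ y → ℤˣ

namespace OGP

section Basic

variable {P : Type*} [PartialOrder P] [OrientedGradedPoset P]

/-- The dimension of an element. -/
def dim (x : P) : ℕ := grade ℕ x

/-- The orientation of the edge `y → x`, where `y` covers `x`. -/
def orient {x y : P} (h : x ⋖ y) : ℤˣ := OrientedGradedPoset.orient h

/-- `Δ_n^α U`: the `n`-dimensional elements of `U` whose covers in `U` all have orientation `α`.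
The sign `+` is `1 : ℤˣ` and the sign `-` is `-1 : ℤˣ`. -/
def sbord (n : ℕ) (α : ℤˣ) (U : Set P) : Set P :=
  {x | x ∈ U ∧ dim x = n ∧ ∀ y ∈ U, ∀ h : x ⋖ y, orient h = α}

/-- `∂_n^α U`: the input (`α = -1`) or output (`α = 1`) `n`-boundary of a closed subset `U`. -/
def bord (n : ℕ) (α : ℤˣ) (U : Set P) : Set P :=
  {x | ∃ y ∈ sbord n α U, x ≤ y} ∪ {x | x ∈ U ∧ ∀ y ∈ U, x ≤ y → dim y ≤ n}

/-- `∂_{n-1} U = ∂_{n-1}^+ U ∪ ∂_{n-1}^- U`, which is empty for `n = 0`. -/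
def bordPred (n : ℕ) (U : Set P) : Set P :=
  {x | ∃ k, k + 1 = n ∧ (x ∈ bord k 1 U ∨ x ∈ bord k (-1) U)}

/-- The molecules of `P`: closed subsets generated by the closures of single elements under
pasting. -/
inductive IsMolecule : Set P → Prop
  | atom (x : P) : IsMolecule (Set.Iic x)
  | paste (U₁ U₂ : Set P) (n : ℕ) (h₁ : IsMolecule U₁) (h₂ : IsMolecule U₂)
      (ne₁ : U₁ ⊂ U₁ ∪ U₂) (ne₂ : U₂ ⊂ U₁ ∪ U₂)
      (hout : U₁ ∩ U₂ = bord n 1 U₁) (hin : U₁ ∩ U₂ = bord n (-1) U₂) :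
      IsMolecule (U₁ ∪ U₂)

/-- A subset `U` of dimension `n` has spherical boundary: `∂_k^+ U ∩ ∂_k^- U = ∂_{k-1} U` for all
`k < n`. -/
def HasSphericalBoundary (n : ℕ) (U : Set P) : Prop :=
  ∀ k < n, bord k 1 U ∩ bord k (-1) U = bordPred k U

variable (P) in
/-- Regular directed complexes. Note that `Set.Iic x` is the closure of `{x}`, of dimension
`dim x`. -/
structure IsRegularDirectedComplex : Prop where
  spherical : ∀ x : P, HasSphericalBoundary (dim x) (Set.Iic x)
  molecule : ∀ (x : P) (α : ℤˣ) (n : ℕ), dim x = n + 1 → IsMolecule (bord n α (Set.Iic x))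
  globular : ∀ (x : P) (α β : ℤˣ) (n : ℕ), dim x = n + 2 →
    bord n α (bord (n + 1) β (Set.Iic x)) = bord n α (Set.Iic x)

end Basic

/-- Maps of oriented graded posets: functions that commute with all boundaries of elements. -/
@[ext]
structure Map (P Q : Type*) [PartialOrder P] [OrientedGradedPoset P]
    [PartialOrder Q] [OrientedGradedPoset Q] where
  toFun : P → Q
  bord_map : ∀ (x : P) (n : ℕ) (α : ℤˣ),
    bord n α (Set.Iic (toFun x)) = toFun '' bord n α (Set.Iic x)

namespace Map

variable {P Q R : Type*} [PartialOrder P] [OrientedGradedPoset P] [PartialOrder Q]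
  [OrientedGradedPoset Q] [PartialOrder R] [OrientedGradedPoset R]

instance : CoeFun (Map P Q) (fun _ => P → Q) := ⟨Map.toFun⟩

variable (P) in
/-- The identity map. -/
def id : Map P P where
  toFun := fun x => x
  bord_map := by simp

/-- Composition of maps, `g` after `f`. -/
def comp (g : Map Q R) (f : Map P Q) : Map P R where
  toFun := fun x => g (f x)
  bord_map := fun x n α => by
    rw [g.bord_map, f.bord_map, Set.image_image]

/-- A map is an isomorphism if it has an inverse map. -/
def IsIsomorphism (f : Map P Q) : Prop :=
  ∃ g : Map Q P, g.comp f = Map.id P ∧ f.comp g = Map.id Q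

end Map

/-! ### Gray products of oriented graded posets -/

open Classical in
/-- The Gray product of two oriented graded posets: the product poset, with
`dim (x, y) = dim x + dim y` and the orientation `o((x, y) → (x', y)) = o(x → x')`,
`o((x, y) → (x, y')) = (-1) ^ dim x * o(y → y')`. The last value, `1`, is never used, since a
cover in the product is a cover in exactly one of the factors. -/
noncomputable instance grayProduct (P Q : Type*) [PartialOrder P] [OrientedGradedPoset P]
    [PartialOrder Q] [OrientedGradedPoset Q] : OrientedGradedPoset (P × Q) where
  grade := fun p => dim p.1 + dim p.2
  grade_strictMono := by
    intro p q h
    rcases Prod.lt_iff.1 h with ⟨h₁, h₂⟩ | ⟨h₁, h₂⟩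
    · exact add_lt_add_of_lt_of_le (grade_strictMono h₁) (grade_strictMono.monotone h₂)
    · exact add_lt_add_of_le_of_lt (grade_strictMono.monotone h₁) (grade_strictMono h₂)
  covBy_grade := by
    rintro ⟨a₁, b₁⟩ ⟨a₂, b₂⟩ h
    rcases Prod.mk_covBy_mk_iff.1 h with ⟨c, rfl⟩ | ⟨c, rfl⟩
    · have h' : dim a₁ + 1 = dim a₂ := Nat.covBy_iff_add_one_eq.1 (c.grade ℕ)
      refine Nat.covBy_iff_add_one_eq.2 ?_
      change dim a₁ + dim b₁ + 1 = dim a₂ + dim b₁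
      omega
    · have h' : dim b₁ + 1 = dim b₂ := Nat.covBy_iff_add_one_eq.1 (c.grade ℕ)
      refine Nat.covBy_iff_add_one_eq.2 ?_
      change dim a₁ + dim b₁ + 1 = dim a₁ + dim b₂
      omega
  isMin_grade := by
    rintro ⟨a, b⟩ h
    have h' := Prod.isMin_iff.1 h
    have h₁ := isMin_iff_eq_bot.1 (h'.1.grade ℕ)
    have h₂ := isMin_iff_eq_bot.1 (h'.2.grade ℕ)
    refine isMin_iff_eq_bot.2 ?_
    simp only [dim] at *
    simp [h₁, h₂]
  orient := fun p q _ =>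
    if h₁ : p.1 ⋖ q.1 then orient h₁
    else if h₂ : p.2 ⋖ q.2 then (-1) ^ dim p.1 * orient h₂
    else 1

end OGP

open OGP

/-! ### Regular atoms and diagrammatic sets -/

/-- A set with `m` elements, without any preferred order. -/
def Vertices (m : ℕ) : Type := Fin m

instance (m : ℕ) : Finite (Vertices m) := inferInstanceAs (Finite (Fin m))

/-- Regular atoms: finite oriented graded posets that are regular directed complexes and have a
greatest element. Up to isomorphism the underlying set is `{0, …, m - 1}`; this makes the type of
regular atoms small. -/
structure RegularAtom where
  card : ℕ
  [order : PartialOrder (Vertices card)]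
  [ogp : OrientedGradedPoset (Vertices card)]
  regular : IsRegularDirectedComplex (Vertices card)
  top : Vertices card
  le_top : ∀ x, x ≤ top

namespace RegularAtom

/-- The underlying set of a regular atom. -/
abbrev Pts (U : RegularAtom) : Type := Vertices U.card

instance (U : RegularAtom) : PartialOrder U.Pts := U.order

instance (U : RegularAtom) : OrientedGradedPoset U.Pts := U.ogp

/-- The category of regular atoms and maps. -/
instance : Category RegularAtom where
  Hom U V := Map U.Pts V.Pts
  id U := Map.id U.Pts
  comp f g := g.comp f

end RegularAtom

/-- A skeleton of the category of regular atoms. -/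
abbrev Atom : Type := Skeleton RegularAtom

namespace Atom

/-- The regular atom representing an object of the skeleton. -/
noncomputable abbrev rep (U : Atom) : RegularAtom := (fromSkeleton RegularAtom).obj U

/-- The underlying set of an atom. -/
abbrev Pts (U : Atom) : Type := U.rep.Pts

/-- The dimension of an atom. -/
noncomputable def dim (U : Atom) : ℕ := OGP.dim U.rep.top

/-- The map of oriented graded posets underlying a morphism of atoms. -/
noncomputable def toMap {U V : Atom} (f : U ⟶ V) : Map U.Pts V.Pts :=
  (fromSkeleton RegularAtom).map f

lemma toMap_comp {U V W : Atom} (f : U ⟶ V) (g : V ⟶ W) :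
    toMap (f ≫ g) = (toMap g).comp (toMap f) := rfl

lemma toMap_id (U : Atom) : toMap (𝟙 U) = Map.id U.Pts := rfl

/-- The boundary `∂U` of an atom (empty if `U` is `0`-dimensional). -/
def boundary (U : Atom) : Set U.Pts := bordPred U.dim Set.univ

end Atom

/-- Diagrammatic sets: presheaves on the skeleton of the category of regular atoms. -/
abbrev DiagrammaticSet := Atomᵒᵖ ⥤ Type u

/-- Cells of a diagrammatic set, together with their shapes. -/
def Cell (X : DiagrammaticSet.{u}) : Type u := Σ U : Atom, X.obj (op U)

/-- `skeletonBelow X n` is the `(n-1)`-skeleton of `X`: the cells that factor through a cell of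
dimension `< n`. In particular `skeletonBelow X 0` is empty. -/
def skeletonBelow (X : DiagrammaticSet.{u}) (n : ℕ) : Subfunctor X where
  obj W := {x | ∃ (V : Atom) (f : W.unop ⟶ V) (y : X.obj (op V)), V.dim < n ∧ x = X.map f.op y}
  map := by
    rintro W W' g x ⟨V, f, y, hV, rfl⟩
    refine ⟨V, g.unop ≫ f, y, hV, ?_⟩
    simp

lemma skeletonBelow_le_succ (X : DiagrammaticSet.{u}) (n : ℕ) :
    skeletonBelow X n ≤ skeletonBelow X (n + 1) := by
  rintro W x ⟨V, f, y, hV, h⟩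
  exact ⟨V, f, y, by omega, h⟩

/-! ### Diagrammatic complexes -/

section Complex

variable {X : DiagrammaticSet.{u}} (S : Set (Cell X))

/-- `∐_{x ∈ S} U(x)`, the coproduct of the shapes of a set of cells. -/
noncomputable def coprodShapes : DiagrammaticSet.{u} where
  obj W := Σ x : S, (W.unop ⟶ x.1.1)
  map g := TypeCat.ofHom fun p => ⟨p.1, g.unop ≫ p.2⟩
  map_id W := ConcreteCategory.hom_ext _ _ fun p => by
    change (⟨p.1, 𝟙 _ ≫ p.2⟩ : Σ x : S, (W.unop ⟶ x.1.1)) = p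
    rw [Category.id_comp]
  map_comp {W W' W''} g h := ConcreteCategory.hom_ext _ _ fun p => by
    change (⟨p.1, (h.unop ≫ g.unop) ≫ p.2⟩ : Σ x : S, (W''.unop ⟶ x.1.1)) =
      ⟨p.1, h.unop ≫ g.unop ≫ p.2⟩
    rw [Category.assoc]

/-- `∐_{x ∈ S} ∂U(x)`, as a subpresheaf of `∐_{x ∈ S} U(x)`: the maps with image in the
boundary. -/
noncomputable def coprodBoundaries : Subfunctor (coprodShapes S) where
  obj W := {p : Σ x : S, (W.unop ⟶ x.1.1) |
    ∀ w, Atom.toMap p.2 w ∈ Atom.boundary p.1.1.1}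
  map := by
    intro W W' g p hp w
    exact hp (Atom.toMap g.unop w)

/-- The morphism `(x)_{x ∈ S} : ∐_{x ∈ S} U(x) ⟶ skel_n X` classifying a set `S` of `n`-cells. -/
noncomputable def classify (n : ℕ) (hS : ∀ x ∈ S, Atom.dim x.1 = n) :
    coprodShapes S ⟶ (skeletonBelow X (n + 1)).toFunctor where
  app W := TypeCat.ofHom fun p =>
    ⟨X.map p.2.op p.1.1.2, p.1.1.1, p.2, p.1.1.2, by rw [hS _ p.1.2]; omega, rfl⟩
  naturality W W' g := ConcreteCategory.hom_ext _ _ fun p => by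
    apply Subtype.ext
    change X.map (g.unop ≫ p.2).op p.1.1.2 = X.map g (X.map p.2.op p.1.1.2)
    rw [op_comp, Functor.map_comp]
    rfl

end Complex

/-- `(X, gen)` is a diagrammatic complex: `gen n` is a set of `n`-cells for each `n`, and the
square
```
  ∐_{x ∈ gen n} ∂U(x)  ⟶  ∐_{x ∈ gen n} U(x)
          |                       | (x)_{x ∈ gen n}
          v                       v
    skel_{n-1} X      ⟶      skel_n X
```
is a pushout of diagrammatic sets. The bottom morphism is a monomorphism, so the left one is
uniquely determined by the commutativity of the square. -/
structure IsDiagrammaticComplex (X : DiagrammaticSet.{u}) (gen : ℕ → Set (Cell X)) : Prop where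
  dim_eq : ∀ n, ∀ x ∈ gen n, Atom.dim x.1 = n
  pushout : ∀ n, ∃ att : (coprodBoundaries (gen n)).toFunctor ⟶ (skeletonBelow X n).toFunctor,
    IsPushout (coprodBoundaries (gen n)).ι att (classify (gen n) n (dim_eq n))
      (Subfunctor.homOfLe (skeletonBelow_le_succ X n))

/-! ### Gray products of diagrammatic sets -/

section Gray

variable (X Y : DiagrammaticSet.{u})

/-- Triples `(h, x, y)` of a map `h : W ⟶ U ⊠ V` and cells `x ∈ X(U)`, `y ∈ Y(V)`. -/
def GrayTriple (W : Atom) : Type u :=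
  Σ (U V : Atom), Map W.Pts (U.Pts × V.Pts) × X.obj (op U) × Y.obj (op V)

variable {X Y} in
/-- The coend relation: `(h, a^* x, b^* y) ∼ ((a ⊠ b) ∘ h, x, y)`. -/
inductive GrayRel (W : Atom) : GrayTriple X Y W → GrayTriple X Y W → Prop
  | mk {U V U' V' : Atom} (a : U ⟶ U') (b : V ⟶ V')
      (h : Map W.Pts (U.Pts × V.Pts)) (h' : Map W.Pts (U'.Pts × V'.Pts))
      (x : X.obj (op U')) (y : Y.obj (op V'))
      (hh : ∀ w, h' w = (Atom.toMap a (h w).1, Atom.toMap b (h w).2)) :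
      GrayRel W ⟨U, V, h, X.map a.op x, Y.map b.op y⟩ ⟨U', V', h', x, y⟩

variable {X Y} in
/-- Restriction of triples along a map of atoms. -/
noncomputable def GrayTriple.restrict {W W' : Atom} (g : W' ⟶ W) (t : GrayTriple X Y W) : GrayTriple X Y W' :=
  ⟨t.1, t.2.1, t.2.2.1.comp (Atom.toMap g), t.2.2.2⟩

variable {X Y} in
lemma GrayRel.restrict {W W' : Atom} (g : W' ⟶ W) {s t : GrayTriple X Y W}
    (h : GrayRel W s t) : GrayRel W' (s.restrict g) (t.restrict g) := by
  obtain ⟨a, b, h, h', x, y, hh⟩ := h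
  exact GrayRel.mk a b _ _ x y fun w => hh (Atom.toMap g w)

/-- The Gray product of diagrammatic sets, that is, the Day convolution
`(X ⊠ Y)(W) = ∫^{U, V} Hom(W, U ⊠ V) × X(U) × Y(V)`
extending the Gray product of atoms along the Yoneda embedding. -/
noncomputable def gray : DiagrammaticSet.{u} where
  obj W := Quot (GrayRel (X := X) (Y := Y) W.unop)
  map g := TypeCat.ofHom
    (Quot.map (GrayTriple.restrict g.unop) fun _ _ h => h.restrict g.unop)
  map_id W := by
    ext t
    induction t using Quot.ind
    rfl
  map_comp g h := by
    ext t
    induction t using Quot.ind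
    rfl

variable {X Y}

/-- `z` is the cell `x ⊠ y` of `X ⊠ Y`: its shape is (the representative in the skeleton of)
`U(x) ⊠ U(y)`, and it is the class of `(e, x, y)` for an isomorphism `e` with `U(x) ⊠ U(y)`. -/
def IsGrayCell (x : Cell X) (y : Cell Y) (z : Cell (gray X Y)) : Prop :=
  ∃ e : Map z.1.Pts (x.1.Pts × y.1.Pts), e.IsIsomorphism ∧
    z.2 = Quot.mk _ (⟨x.1, y.1, e, x.2, y.2⟩ : GrayTriple X Y z.1)

/-- The cells `x ⊠ y` with `x` a generating `k`-cell of `X` and `y` a generating `(n-k)`-cell of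
`Y`, for `0 ≤ k ≤ n`. -/
def grayGen (genX : ℕ → Set (Cell X)) (genY : ℕ → Set (Cell Y)) (n : ℕ) :
    Set (Cell (gray X Y)) :=
  {z | ∃ k l, k + l = n ∧ ∃ x ∈ genX k, ∃ y ∈ genY l, IsGrayCell x y z}

end Gray

/-! A diagrammatic complex is recognised by normal forms: every cell is the pullback of exactly one
generating cell along exactly one map that preserves the greatest element (`HasNormalForms`). For
generators of the right dimension this is equivalent to the pushout condition, because the boundary
of an atom is everything except its greatest element, and a map factors through the closure of the
image of the greatest element.

Normal forms pass to Gray products. A cell of `X ⊠ Y` is represented by a map `h : W → U ⊠ V` and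
two cells. Replacing `U` and `V` by the closures of the coordinates of the image of the greatest
element makes `h` preserve greatest elements, and the normal forms of the two restricted cells then
replace these by generators. For uniqueness, the projections of `U ⊠ V` are maps, so cells of `X ⊠
Y` project to cells of `X` and `Y`, whose normal forms determine both coordinates of `h`
(`grayMk_injective`). The cell `x ⊠ y` is well defined because `U ⊠ V` is a regular atom
(`IsRegularDirectedComplex.prod`) and regular atoms have no nontrivial automorphisms
(`IsAutOn.eq_self`).

The hard point is that Gray products of regular directed complexes are regular directed complexes.
The `r`-boundary of `U × V` is the union of the products of an `i`-boundary of `U` with an `(r -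
i)`-boundary of `V`. It is treated as a case of staircases, in which the signs may vary from step to
step: the boundary of a staircase is a staircase (`bord_stairs`), so by induction on `r` a staircase
can be cut in two and reassembled with `IsSubmolecule.glue`, which pastes molecules that meet in
only part of their boundaries. The steps themselves must be molecules, that is, products of
molecules must be molecules. This goes by induction on the total dimension, cutting the first factor
into atoms (`isMolecule_prod_of_forall_atom`), then the second after exchanging the factors through
the odd dual. -/

namespace OGP

/-! ### Boundaries of closed sets, pasting, molecules. -/

section Boundary

variable {P : Type*} [PartialOrder P] [OrientedGradedPoset P] {U : Set P} {n : ℕ} {α : ℤˣ}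

lemma dim_strictMono : StrictMono (dim : P → ℕ) := grade_strictMono

lemma dim_mono : Monotone (dim : P → ℕ) := dim_strictMono.monotone

lemma dim_covBy {x y : P} (h : x ⋖ y) : dim y = dim x + 1 :=
  (Nat.covBy_iff_add_one_eq.1 (h.grade ℕ)).symm

lemma eq_of_le_of_dim_le {x y : P} (h : x ≤ y) (hd : dim y ≤ dim x) : x = y := by
  by_contra hne
  have := dim_strictMono (lt_of_le_of_ne h hne)
  omega

lemma covBy_of_lt_of_dim {x y : P} (h : x < y) (hd : dim y ≤ dim x + 1) : x ⋖ y := by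
  refine ⟨h, fun z h₁ h₂ => ?_⟩
  have := dim_strictMono h₁
  have := dim_strictMono h₂
  omega

lemma exists_le_covBy {x y : P} (h : x < y) : ∃ z, x ≤ z ∧ z ⋖ y := by
  -- The poset need not be finite: an element of greatest dimension in `[x, y)` is obtained by
  -- minimising `dim y - dim z`.
  obtain ⟨z, ⟨hz₁, hz₂⟩, hz⟩ : ∃ z ∈ Set.Ico x y, ∀ w ∈ Set.Ico x y,
      dim y - dim z ≤ dim y - dim w := by
    have hne : ((fun z => dim y - dim z) '' Set.Ico x y).Nonempty := ⟨_, x, ⟨le_rfl, h⟩, rfl⟩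
    obtain ⟨z, hz, hz'⟩ := Nat.sInf_mem hne
    exact ⟨z, hz, fun w hw => hz'.trans_le (Nat.sInf_le ⟨w, hw, rfl⟩)⟩
  refine ⟨z, hz₁, hz₂, fun w h₁ h₂ => ?_⟩
  have := hz w ⟨hz₁.trans h₁.le, h₂⟩
  have := dim_strictMono h₁
  have := dim_strictMono h₂
  omega

/-- All elements of `U` have dimension at most `n`. -/
def DimLE (n : ℕ) (U : Set P) : Prop := ∀ x ∈ U, dim x ≤ n

lemma DimLE.mono {m : ℕ} (h : DimLE n U) (hm : n ≤ m) : DimLE m U := fun x hx => (h x hx).trans hm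

lemma dimLE_Iic (x : P) : DimLE (dim x) (Set.Iic x) := fun _ h => dim_mono h

lemma sbord_subset_bord : sbord n α U ⊆ bord n α U := fun x hx => Or.inl ⟨x, hx, le_rfl⟩

lemma bord_subset (hU : IsLowerSet U) : bord n α U ⊆ U := by
  rintro x (⟨y, hy, hxy⟩ | hx)
  · exact hU hxy hy.1
  · exact hx.1

lemma dim_le_of_mem_bord {x : P} (h : x ∈ bord n α U) : dim x ≤ n := by
  rcases h with ⟨y, hy, hxy⟩ | hx
  · exact hy.2.1 ▸ dim_mono hxy
  · exact hx.2 x hx.1 le_rfl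

lemma dimLE_bord : DimLE n (bord n α U) := fun _ => dim_le_of_mem_bord

lemma bord_eq_self (hU : IsLowerSet U) (h : DimLE n U) : bord n α U = U :=
  (bord_subset hU).antisymm fun _ hx => Or.inr ⟨hx, fun y hy _ => h y hy⟩

/-- In dimension `n` both clauses of `bord` lead to `sbord`: lying under an element of `sbord`
forces equality with it, and the second clause leaves no cover in `U` to test. -/
lemma mem_sbord_of_mem_bord {x : P} (h : x ∈ bord n α U) (hd : n ≤ dim x) : x ∈ sbord n α U := by
  rcases h with ⟨y, hy, hxy⟩ | hx
  · rwa [eq_of_le_of_dim_le hxy (hy.2.1.trans_le hd)]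
  · refine ⟨hx.1, le_antisymm (hx.2 x hx.1 le_rfl) hd, fun y hy h => ?_⟩
    have := hx.2 y hy h.le
    have := dim_covBy h
    omega

lemma exists_le_sbord_of_mem_bord {x y : P} (h : x ∈ bord n α U) (hy : y ∈ U) (hxy : x ≤ y)
    (hd : n < dim y) : ∃ z ∈ sbord n α U, x ≤ z := by
  rcases h with h | hx
  · exact h
  · exact absurd (hx.2 y hy hxy) (by omega)

lemma mem_sbord_of_maximal {x : P} (h : Maximal (· ∈ U) x) : x ∈ sbord (dim x) α U :=
  ⟨h.1, rfl, fun _ hy hxy => absurd (h.2 hy hxy.le) hxy.lt.not_ge⟩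

/-- A closed set whose boundaries are closed and satisfy the globular identities. -/
structure IsGlobular (U : Set P) : Prop where
  lower : IsLowerSet U
  bounded : ∃ d, DimLE d U
  lower_bord : ∀ n α, IsLowerSet (bord n α U)
  bord_bord : ∀ {k m : ℕ} (α β : ℤˣ), k < m → bord k α (bord m β U) = bord k α U

namespace IsGlobular

lemma bord_subset_bord (h : IsGlobular U) {k m : ℕ} (α β : ℤˣ) (hkm : k < m) :
    bord k α U ⊆ bord m β U := by
  rw [← h.bord_bord α β hkm]
  exact bord_subset (h.lower_bord _ _)

lemma bord_mono (h : IsGlobular U) {k m : ℕ} {α β : ℤˣ} (hkm : k ≤ m) (hs : k = m → α = β) :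
    bord k α U ⊆ bord m β U := by
  rcases hkm.lt_or_eq with hlt | rfl
  · exact h.bord_subset_bord _ _ hlt
  · rw [hs rfl]

lemma bord_bord_of_le (h : IsGlobular U) {k m : ℕ} (α β : ℤˣ) (hmk : m ≤ k) :
    bord k α (bord m β U) = bord m β U :=
  bord_eq_self (h.lower_bord _ _) (dimLE_bord.mono hmk)

protected lemma bord (h : IsGlobular U) (n : ℕ) (α : ℤˣ) : IsGlobular (bord n α U) where
  lower := h.lower_bord _ _
  bounded := ⟨n, dimLE_bord⟩
  lower_bord k β := by
    rcases lt_or_ge k n with hk | hk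
    · rw [h.bord_bord _ _ hk]; exact h.lower_bord _ _
    · rw [h.bord_bord_of_le _ _ hk]; exact h.lower_bord _ _
  bord_bord {k m} β γ hkm := by
    rcases lt_or_ge m n with hm | hm
    · rw [h.bord_bord _ _ hm, h.bord_bord _ _ hkm, h.bord_bord _ _ (hkm.trans hm)]
    · rw [h.bord_bord_of_le _ _ hm]

lemma exists_max_dim (h : IsGlobular U) {x : P} (hx : x ∈ U) :
    ∃ y, x ≤ y ∧ Maximal (· ∈ U) y ∧ ∀ z ∈ U, x ≤ z → dim z ≤ dim y := by
  obtain ⟨d, hd⟩ := h.bounded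
  have hne : ((fun z => d - dim z) '' (U ∩ Set.Ici x)).Nonempty := ⟨_, x, ⟨hx, le_rfl⟩, rfl⟩
  obtain ⟨y, ⟨hy, hxy⟩, hmin⟩ := Nat.sInf_mem hne
  have hle : ∀ z ∈ U, x ≤ z → dim z ≤ dim y := fun z hz hxz => by
    have h₁ : d - dim y ≤ d - dim z := hmin.trans_le (Nat.sInf_le ⟨z, ⟨hz, hxz⟩, rfl⟩)
    have := hd z hz
    have := hd y hy
    omega
  exact ⟨y, hxy, ⟨hy, fun z hz hyz => (eq_of_le_of_dim_le hyz (hle z hz (hxy.trans hyz))).ge⟩, hle⟩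

end IsGlobular

/-- Two globular sets that meet in the `n`-boundary of sign `γ` of the first, and of sign `-γ` of
the second. -/
structure IsPasting (n : ℕ) (γ : ℤˣ) (U₁ U₂ : Set P) : Prop where
  left : IsGlobular U₁
  right : IsGlobular U₂
  inter_left : U₁ ∩ U₂ = bord n γ U₁
  inter_right : U₁ ∩ U₂ = bord n (-γ) U₂

namespace IsPasting

variable {U₁ U₂ : Set P} {γ : ℤˣ} {k : ℕ}

/-- Keeping the sign `γ` as a parameter allows the two sets to be exchanged, which halves the
arguments below. -/
lemma symm (h : IsPasting n γ U₁ U₂) : IsPasting n (-γ) U₂ U₁ where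
  left := h.right
  right := h.left
  inter_left := by rw [Set.inter_comm, h.inter_right]
  inter_right := by rw [Set.inter_comm, h.inter_left, neg_neg]

lemma lower (h : IsPasting n γ U₁ U₂) : IsLowerSet (U₁ ∪ U₂) := h.left.lower.union h.right.lower

lemma inter_subset_bord_left (h : IsPasting n γ U₁ U₂) (hk : n < k) (α : ℤˣ) :
    U₁ ∩ U₂ ⊆ bord k α U₁ :=
  h.inter_left ▸ h.left.bord_subset_bord _ _ hk

/-- The overlap has dimension at most `n < k`, so `sbord k` is computed on each side separately. An
element admitted by the second clause in `U₁` may lie under a large element of `U₂`; it is then in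
the overlap, hence in `bord k α U₂`, hence under an element of `sbord k α U₂`. -/
lemma bord_left_subset_of_gt (h : IsPasting n γ U₁ U₂) (hk : n < k) (α : ℤˣ) :
    bord k α U₁ ⊆ bord k α (U₁ ∪ U₂) := by
  have key : sbord k α U₁ ⊆ sbord k α (U₁ ∪ U₂) := by
    rintro w ⟨hw, hd, hc⟩
    refine ⟨Or.inl hw, hd, ?_⟩
    rintro y (hy | hy) hwy
    · exact hc y hy hwy
    · have : w ∈ bord n γ U₁ := h.inter_left ▸ ⟨hw, h.right.lower hwy.le hy⟩
      have := dim_le_of_mem_bord this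
      omega
  have key' : sbord k α U₂ ⊆ sbord k α (U₁ ∪ U₂) := by
    rintro w ⟨hw, hd, hc⟩
    refine ⟨Or.inr hw, hd, ?_⟩
    rintro y (hy | hy) hwy
    · have : w ∈ bord n γ U₁ := h.inter_left ▸ ⟨h.left.lower hwy.le hy, hw⟩
      have := dim_le_of_mem_bord this
      omega
    · exact hc y hy hwy
  rintro w (⟨y, hy, hwy⟩ | ⟨hw, hd⟩)
  · exact Or.inl ⟨y, key hy, hwy⟩
  · by_cases hall : ∀ y ∈ U₂, w ≤ y → dim y ≤ k
    · refine Or.inr ⟨Or.inl hw, ?_⟩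
      rintro y (hy | hy) hwy
      · exact hd y hy hwy
      · exact hall y hy hwy
    · push Not at hall
      obtain ⟨y, hy, hwy, hky⟩ := hall
      have hwM : w ∈ U₁ ∩ U₂ := ⟨hw, h.right.lower hwy hy⟩
      have hw₂ : w ∈ bord k α U₂ := by
        have := h.symm.inter_subset_bord_left hk α
        rw [Set.inter_comm] at this
        exact this hwM
      obtain ⟨z, hz, hwz⟩ := exists_le_sbord_of_mem_bord hw₂ hy hwy hky
      exact Or.inl ⟨z, key' hz, hwz⟩

lemma bord_union_of_gt (h : IsPasting n γ U₁ U₂) (hk : n < k) (α : ℤˣ) :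
    bord k α (U₁ ∪ U₂) = bord k α U₁ ∪ bord k α U₂ := by
  refine Set.Subset.antisymm ?_ (Set.union_subset (h.bord_left_subset_of_gt hk α) ?_)
  · have aux : ∀ {V₁ V₂ : Set P} {w : P}, w ∈ sbord k α (V₁ ∪ V₂) → w ∈ V₁ → w ∈ sbord k α V₁ :=
      fun hw hw₁ => ⟨hw₁, hw.2.1, fun y hy => hw.2.2 y (Or.inl hy)⟩
    rintro w (⟨y, hy, hwy⟩ | ⟨hw | hw, hd⟩)
    · rcases hy.1 with hy₁ | hy₁
      · exact Or.inl (Or.inl ⟨y, aux hy hy₁, hwy⟩)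
      · rw [Set.union_comm] at hy
        exact Or.inr (Or.inl ⟨y, aux hy hy₁, hwy⟩)
    · exact Or.inl (Or.inr ⟨hw, fun y hy => hd y (Or.inl hy)⟩)
    · exact Or.inr (Or.inr ⟨hw, fun y hy => hd y (Or.inr hy)⟩)
  · rw [Set.union_comm U₁]
    exact h.symm.bord_left_subset_of_gt hk α

/-- An `n`-dimensional element of the overlap gains only covers of sign `-γ` from `U₂`, which does
not disturb `sbord n (-γ)`. Conversely, whatever `U₂` contributes to this boundary already lies in
the overlap. -/
lemma bord_union_left (h : IsPasting n γ U₁ U₂) : bord n (-γ) (U₁ ∪ U₂) = bord n (-γ) U₁ := by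
  have hM : ∀ {w}, w ∈ bord n (-γ) U₂ → w ∈ U₁ := fun hw => by
    rw [← h.inter_right] at hw
    exact hw.1
  apply Set.Subset.antisymm
  · rintro w (⟨y, hy, hwy⟩ | ⟨hw, hd⟩)
    · refine Or.inl ⟨y, ⟨?_, hy.2.1, fun z hz => hy.2.2 z (Or.inl hz)⟩, hwy⟩
      rcases hy.1 with hy₁ | hy₁
      · exact hy₁
      · exact hM (sbord_subset_bord ⟨hy₁, hy.2.1, fun z hz => hy.2.2 z (Or.inr hz)⟩)
    · refine Or.inr ⟨?_, fun y hy => hd y (Or.inl hy)⟩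
      rcases hw with hw | hw
      · exact hw
      · exact hM (Or.inr ⟨hw, fun y hy => hd y (Or.inr hy)⟩)
  · have key : ∀ {w}, w ∈ U₁ → w ∈ U₂ → w ∈ bord n (-γ) U₂ := fun h₁ h₂ =>
      h.inter_right ▸ ⟨h₁, h₂⟩
    rintro w (⟨y, hy, hwy⟩ | ⟨hw, hd⟩)
    · refine Or.inl ⟨y, ⟨Or.inl hy.1, hy.2.1, ?_⟩, hwy⟩
      rintro z (hz | hz) hyz
      · exact hy.2.2 z hz hyz
      · have := mem_sbord_of_mem_bord (key hy.1 (h.right.lower hyz.le hz)) hy.2.1.ge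
        exact this.2.2 z hz hyz
    · by_cases hall : ∀ y ∈ U₂, w ≤ y → dim y ≤ n
      · refine Or.inr ⟨Or.inl hw, ?_⟩
        rintro y (hy | hy) hwy
        · exact hd y hy hwy
        · exact hall y hy hwy
      · push Not at hall
        obtain ⟨y, hy, hwy, hky⟩ := hall
        -- Nothing in `U₁` above `w` has dimension greater than `n`, so the `n`-dimensional `z`
        -- above `w` has no cover in `U₁`.
        obtain ⟨z, hz, hwz⟩ :=
          exists_le_sbord_of_mem_bord (key hw (h.right.lower hwy hy)) hy hwy hky
        refine Or.inl ⟨z, ⟨Or.inr hz.1, hz.2.1, ?_⟩, hwz⟩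
        rintro t (ht | ht) hzt
        · have := hd t ht (hwz.trans hzt.le)
          have := dim_covBy hzt
          have := hz.2.1
          omega
        · exact hz.2.2 t ht hzt

lemma bord_union_right (h : IsPasting n γ U₁ U₂) : bord n γ (U₁ ∪ U₂) = bord n γ U₂ := by
  rw [Set.union_comm]
  simpa using h.symm.bord_union_left

lemma bord_eq_of_lt (h : IsPasting n γ U₁ U₂) (hk : k < n) (α : ℤˣ) :
    bord k α U₁ = bord k α U₂ := by
  rw [← h.left.bord_bord α γ hk, ← h.inter_left, h.inter_right, h.right.bord_bord _ _ hk]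

/-- Both sets have the same `k`-boundary, namely that of the overlap. So a `k`-dimensional element
satisfies the sign condition in one exactly when it does in the other. -/
lemma bord_union_of_lt (h : IsPasting n γ U₁ U₂) (hk : k < n) (α : ℤˣ) :
    bord k α (U₁ ∪ U₂) = bord k α U₁ := by
  have heq := h.bord_eq_of_lt hk α
  have hs : ∀ {w}, w ∈ sbord k α U₁ ↔ w ∈ sbord k α U₂ := fun {w} =>
    ⟨fun hw => mem_sbord_of_mem_bord (heq ▸ sbord_subset_bord hw) hw.2.1.ge,
      fun hw => mem_sbord_of_mem_bord (heq ▸ sbord_subset_bord hw) hw.2.1.ge⟩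
  have hs' : ∀ {w}, w ∈ sbord k α U₁ → w ∈ sbord k α (U₁ ∪ U₂) := by
    intro w hw
    refine ⟨Or.inl hw.1, hw.2.1, ?_⟩
    rintro y (hy | hy) hwy
    · exact hw.2.2 y hy hwy
    · exact (hs.1 hw).2.2 y hy hwy
  apply Set.Subset.antisymm
  · rintro w (⟨y, hy, hwy⟩ | ⟨hw | hw, hd⟩)
    · refine Or.inl ⟨y, ?_, hwy⟩
      rcases hy.1 with hy₁ | hy₁
      · exact ⟨hy₁, hy.2.1, fun z hz => hy.2.2 z (Or.inl hz)⟩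
      · exact hs.2 ⟨hy₁, hy.2.1, fun z hz => hy.2.2 z (Or.inr hz)⟩
    · exact Or.inr ⟨hw, fun y hy => hd y (Or.inl hy)⟩
    · rw [heq]
      exact Or.inr ⟨hw, fun y hy => hd y (Or.inr hy)⟩
  · intro w hw
    have hw' := hw
    rw [heq] at hw'
    rcases hw with ⟨y, hy, hwy⟩ | ⟨hw, hd⟩
    · exact Or.inl ⟨y, hs' hy, hwy⟩
    rcases hw' with ⟨y, hy, hwy⟩ | ⟨hw', hd'⟩
    · exact Or.inl ⟨y, hs' (hs.2 hy), hwy⟩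
    · refine Or.inr ⟨Or.inl hw, ?_⟩
      rintro y (hy | hy) hwy
      · exact hd y hy hwy
      · exact hd' y hy hwy

/-- Above the pasting dimension both boundaries contain the whole overlap, so they are pasted along
the same set. -/
lemma bord (h : IsPasting n γ U₁ U₂) (hk : n < k) (α : ℤˣ) :
    IsPasting n γ (bord k α U₁) (bord k α U₂) := by
  have hM : OGP.bord k α U₁ ∩ OGP.bord k α U₂ = U₁ ∩ U₂ := by
    apply Set.Subset.antisymm
    · exact Set.inter_subset_inter (bord_subset h.left.lower) (bord_subset h.right.lower)
    · have := h.symm.inter_subset_bord_left hk α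
      rw [Set.inter_comm] at this
      exact Set.subset_inter (h.inter_subset_bord_left hk α) this
  refine ⟨h.left.bord _ _, h.right.bord _ _, ?_, ?_⟩
  · rw [hM, h.left.bord_bord _ _ hk, h.inter_left]
  · rw [hM, h.right.bord_bord _ _ hk, h.inter_right]

lemma bord_union_cases (h : IsPasting n γ U₁ U₂) (k : ℕ) (α : ℤˣ) :
    (n < k ∧ OGP.bord k α (U₁ ∪ U₂) = OGP.bord k α U₁ ∪ OGP.bord k α U₂) ∨
    (k ≤ n ∧ OGP.bord k α (U₁ ∪ U₂) = OGP.bord k α U₁) ∨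
    (k ≤ n ∧ OGP.bord k α (U₁ ∪ U₂) = OGP.bord k α U₂) := by
  rcases lt_trichotomy k n with hk | rfl | hk
  · exact Or.inr (Or.inl ⟨hk.le, h.bord_union_of_lt hk α⟩)
  · by_cases hα : α = γ
    · subst hα
      exact Or.inr (Or.inr ⟨le_rfl, h.bord_union_right⟩)
    · obtain rfl : α = -γ := by
        rcases Int.units_eq_one_or α with rfl | rfl <;> rcases Int.units_eq_one_or γ with rfl | rfl
          <;> simp_all
      exact Or.inr (Or.inl ⟨le_rfl, h.bord_union_left⟩)
  · exact Or.inl ⟨hk, h.bord_union_of_gt hk α⟩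

lemma isGlobular_union (h : IsPasting n γ U₁ U₂) : IsGlobular (U₁ ∪ U₂) where
  lower := h.lower
  bounded := by
    obtain ⟨d₁, h₁⟩ := h.left.bounded
    obtain ⟨d₂, h₂⟩ := h.right.bounded
    exact ⟨max d₁ d₂, fun x hx => hx.elim (fun hx => (h₁ x hx).trans (le_max_left _ _))
      fun hx => (h₂ x hx).trans (le_max_right _ _)⟩
  lower_bord k α := by
    rcases h.bord_union_cases k α with ⟨_, h'⟩ | ⟨_, h'⟩ | ⟨_, h'⟩ <;> rw [h']
    · exact (h.left.lower_bord _ _).union (h.right.lower_bord _ _)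
    · exact h.left.lower_bord _ _
    · exact h.right.lower_bord _ _
  bord_bord {k m} α β hkm := by
    rcases h.bord_union_cases m β with ⟨hm, h'⟩ | ⟨hm, h'⟩ | ⟨hm, h'⟩ <;> rw [h']
    · have hp := h.bord hm β
      rcases lt_trichotomy k n with hk | rfl | hk
      · rw [hp.bord_union_of_lt hk, h.left.bord_bord _ _ hkm, h.bord_union_of_lt hk]
      · by_cases hα : α = γ
        · subst hα
          rw [hp.bord_union_right, h.right.bord_bord _ _ hkm, h.bord_union_right]
        · obtain rfl : α = -γ := by
            rcases Int.units_eq_one_or α with rfl | rfl <;>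
              rcases Int.units_eq_one_or γ with rfl | rfl <;> simp_all
          rw [hp.bord_union_left, h.left.bord_bord _ _ hkm, h.bord_union_left]
      · rw [hp.bord_union_of_gt hk, h.left.bord_bord _ _ hkm, h.right.bord_bord _ _ hkm,
          h.bord_union_of_gt hk]
    · rw [h.left.bord_bord _ _ hkm, h.bord_union_of_lt (hkm.trans_le hm)]
    · rw [h.right.bord_bord _ _ hkm, h.bord_union_of_lt (hkm.trans_le hm),
        h.bord_eq_of_lt (hkm.trans_le hm)]

end IsPasting

namespace IsMolecule

protected lemma nonempty (h : IsMolecule U) : U.Nonempty := by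
  induction h with
  | atom x => exact ⟨x, le_rfl⟩
  | paste U₁ U₂ n _ _ _ _ _ _ ih _ => exact ih.mono Set.subset_union_left

protected lemma lower (h : IsMolecule U) : IsLowerSet U := by
  induction h with
  | atom x => exact isLowerSet_Iic x
  | paste U₁ U₂ n _ _ _ _ _ _ ih₁ ih₂ => exact ih₁.union ih₂

/-- Pasting of molecules, possibly degenerate. -/
lemma paste_of_inter {U₁ U₂ : Set P} {γ : ℤˣ} (h₁ : IsMolecule U₁) (h₂ : IsMolecule U₂)
    (h : U₁ ∩ U₂ = bord n γ U₁) (h' : U₁ ∩ U₂ = bord n (-γ) U₂) : IsMolecule (U₁ ∪ U₂) := by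
  by_cases hne₁ : U₁ = U₁ ∪ U₂
  · rwa [← hne₁]
  by_cases hne₂ : U₂ = U₁ ∪ U₂
  · rwa [← hne₂]
  have s₁ : U₁ ⊂ U₁ ∪ U₂ := Set.subset_union_left.ssubset_of_ne hne₁
  have s₂ : U₂ ⊂ U₁ ∪ U₂ := Set.subset_union_right.ssubset_of_ne hne₂
  rcases Int.units_eq_one_or γ with rfl | rfl
  · exact paste U₁ U₂ n h₁ h₂ s₁ s₂ h h'
  · rw [Set.union_comm] at s₁ s₂ ⊢
    rw [Set.inter_comm] at h h'
    exact paste U₂ U₁ n h₂ h₁ s₂ s₁ (by simpa using h') h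

end IsMolecule

section Atoms

variable {x : P}

lemma mem_bord_Iic_iff (h : n < dim x) {w : P} :
    w ∈ bord n α (Set.Iic x) ↔ ∃ y ∈ sbord n α (Set.Iic x), w ≤ y := by
  refine ⟨fun hw => ?_, Or.inl⟩
  rcases hw with hw | hw
  · exact hw
  · exact absurd (hw.2 x le_rfl hw.1) (by omega)

lemma lower_bord_Iic (n : ℕ) (α : ℤˣ) (x : P) : IsLowerSet (bord n α (Set.Iic x)) := by
  rcases lt_or_ge n (dim x) with h | h
  · intro w v hvw hw
    obtain ⟨y, hy, hwy⟩ := (mem_bord_Iic_iff h).1 hw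
    exact Or.inl ⟨y, hy, hvw.trans hwy⟩
  · rw [bord_eq_self (isLowerSet_Iic x) ((dimLE_Iic x).mono h)]
    exact isLowerSet_Iic x

/-- The element lies under a facet of `x`, and a facet has `x` as its only cover in the closure of
`x`, so it belongs to `sbord` for its own sign. -/
lemma mem_bord_Iic_of_lt (hd : dim x = n + 1) {w : P} (hw : w < x) :
    ∃ α, w ∈ bord n α (Set.Iic x) := by
  obtain ⟨z, hwz, hzx⟩ := exists_le_covBy hw
  have hz := dim_covBy hzx
  refine ⟨orient hzx, Or.inl ⟨z, ⟨hzx.le, by omega, fun y hy hzy => ?_⟩, hwz⟩⟩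
  obtain rfl : y = x := eq_of_le_of_dim_le hy (by rw [hz, dim_covBy hzy])
  rfl

/-- The axiom `globular` covers only codimension two. Lower down, it implies that the `k`-boundary
of `bord n β` does not depend on `β`. Since everything strictly below `x` lies in one of the two
boundaries `bord n β`, covers in the closure of `x` can be tested inside these. -/
lemma bord_bord_pred_Iic (hP : IsRegularDirectedComplex P) (hd : dim x = n + 1)
    (hN : ∀ β, IsGlobular (bord n β (Set.Iic x))) {k : ℕ} (hk : k < n) (α β : ℤˣ) :
    bord k α (bord n β (Set.Iic x)) = bord k α (Set.Iic x) := by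
  obtain ⟨n, rfl⟩ : ∃ m, n = m + 1 := ⟨n - 1, by omega⟩
  rcases (Nat.lt_succ_iff.1 hk).lt_or_eq with hk' | rfl
  swap
  · exact hP.globular x α β k (by omega)
  have hV : ∀ γ, bord k α (bord (n + 1) γ (Set.Iic x)) =
      bord k α (bord (n + 1) β (Set.Iic x)) := fun γ => by
    rw [← (hN γ).bord_bord α 1 hk', ← (hN β).bord_bord α 1 hk',
      hP.globular x _ _ n (by omega), hP.globular x _ _ n (by omega)]
  apply Set.Subset.antisymm
  · intro w hw
    have hwx : w < x := by
      refine lt_of_le_of_ne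
        ((bord_subset (hN β).lower).trans (bord_subset (isLowerSet_Iic x)) hw) ?_
      rintro rfl
      have := dim_le_of_mem_bord hw
      omega
    obtain ⟨z, hwz, hzx⟩ := exists_le_covBy hwx
    have hz := dim_covBy hzx
    obtain ⟨γ, hγ⟩ := mem_bord_Iic_of_lt hd hzx.lt
    rw [← hV γ] at hw
    obtain ⟨y, hy, hwy⟩ := exists_le_sbord_of_mem_bord hw hγ hwz (by omega)
    refine Or.inl ⟨y, ⟨bord_subset (isLowerSet_Iic x) hy.1, hy.2.1, fun t ht hyt => ?_⟩, hwy⟩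
    have htx : t < x := by
      refine lt_of_le_of_ne ht ?_
      rintro rfl
      have := dim_covBy hyt
      have := hy.2.1
      omega
    obtain ⟨δ, hδ⟩ := mem_bord_Iic_of_lt hd htx
    have : y ∈ sbord k α (bord (n + 1) δ (Set.Iic x)) :=
      mem_sbord_of_mem_bord (by rw [hV δ, ← hV γ]; exact sbord_subset_bord hy) hy.2.1.ge
    exact this.2.2 t hδ hyt
  · intro w hw
    obtain ⟨y, hy, hwy⟩ := (mem_bord_Iic_iff (by omega)).1 hw
    have hyx : y < x := by
      refine lt_of_le_of_ne hy.1 ?_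
      rintro rfl
      have := hy.2.1
      omega
    obtain ⟨δ, hδ⟩ := mem_bord_Iic_of_lt hd hyx
    rw [← hV δ]
    exact Or.inl ⟨y, ⟨hδ, hy.2.1, fun t ht => hy.2.2 t (bord_subset (isLowerSet_Iic x) ht)⟩, hwy⟩

end Atoms

/-- Both properties are proved together by induction on dimension: an atom inherits them from its
codimension-one boundaries, which are molecules of smaller dimension, and a pasting inherits them
from its two parts. -/
lemma IsMolecule.isGlobular_and_bord_of_dimLE (hP : IsRegularDirectedComplex P) (d : ℕ) :
    ∀ U : Set P, IsMolecule U → DimLE d U → IsGlobular U ∧ ∀ n α, IsMolecule (bord n α U) := by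
  induction d using Nat.strong_induction_on with
  | _ d ihd =>
  intro U hU
  induction hU with
  | atom x =>
    intro hd
    have hself : ∀ {n} {α}, dim x ≤ n → bord n α (Set.Iic x) = Set.Iic x := fun h =>
      bord_eq_self (isLowerSet_Iic x) ((dimLE_Iic x).mono h)
    rcases Nat.eq_zero_or_pos (dim x) with h0 | hpos
    · have hall : ∀ {n} {α}, bord n α (Set.Iic x) = Set.Iic x := fun {n} => hself (by omega)
      refine ⟨⟨isLowerSet_Iic x, ⟨_, dimLE_Iic x⟩, (lower_bord_Iic · · x),
        fun α β _ => by rw [hall]⟩, fun n α => ?_⟩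
      rw [hall]
      exact .atom x
    · obtain ⟨m, hm⟩ : ∃ m, dim x = m + 1 := ⟨dim x - 1, by omega⟩
      have hdx := hd x le_rfl
      have hN := fun β => ihd m (by omega) _ (hP.molecule x β m hm) dimLE_bord
      have hk := fun {k} (hk : k < m) => bord_bord_pred_Iic hP hm (fun β => (hN β).1) hk
      refine ⟨⟨isLowerSet_Iic x, ⟨_, dimLE_Iic x⟩, (lower_bord_Iic · · x),
        fun {k l} α β hkl => ?_⟩, fun n α => ?_⟩
      · rcases lt_or_ge m l with hl | hl
        · rw [hself (by omega)]
        rcases hl.lt_or_eq with hl | rfl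
        · rw [← hk hl β 1, (hN 1).1.bord_bord _ _ hkl, hk (hkl.trans hl)]
        · exact hk hkl α β
      · rcases lt_trichotomy n m with hn | rfl | hn
        · rw [← hk hn α 1]
          exact (hN 1).2 n α
        · exact hP.molecule x α n hm
        · rw [hself (by omega)]
          exact .atom x
  | paste U₁ U₂ n h₁ h₂ _ _ hout hin ih₁ ih₂ =>
    intro hd
    obtain ⟨g₁, b₁⟩ := ih₁ fun x hx => hd x (Or.inl hx)
    obtain ⟨g₂, b₂⟩ := ih₂ fun x hx => hd x (Or.inr hx)
    have hp : IsPasting n 1 U₁ U₂ := ⟨g₁, g₂, hout, hin⟩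
    refine ⟨hp.isGlobular_union, fun k α => ?_⟩
    rcases hp.bord_union_cases k α with ⟨hk, h'⟩ | ⟨_, h'⟩ | ⟨_, h'⟩ <;> rw [h']
    · exact paste_of_inter (b₁ k α) (b₂ k α) (hp.bord hk α).inter_left (hp.bord hk α).inter_right
    · exact b₁ k α
    · exact b₂ k α

namespace IsMolecule

lemma exists_dimLE (h : IsMolecule U) : ∃ d, DimLE d U := by
  induction h with
  | atom x => exact ⟨dim x, dimLE_Iic x⟩
  | paste U₁ U₂ n _ _ _ _ _ _ ih₁ ih₂ =>
    obtain ⟨d₁, h₁⟩ := ih₁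
    obtain ⟨d₂, h₂⟩ := ih₂
    refine ⟨max d₁ d₂, ?_⟩
    rintro x (hx | hx)
    · exact (h₁ x hx).trans (le_max_left _ _)
    · exact (h₂ x hx).trans (le_max_right _ _)

/-- Only the globularity of atoms is assumed, since this is applied in `P × Q` before that is known
to be a regular directed complex. -/
lemma isGlobular (hG : ∀ x : P, IsGlobular (Set.Iic x)) (h : IsMolecule U) : IsGlobular U := by
  induction h with
  | atom x => exact hG x
  | paste U₁ U₂ n _ _ _ _ hout hin ih₁ ih₂ =>
    exact IsPasting.isGlobular_union (n := n) (γ := 1) ⟨ih₁, ih₂, hout, hin⟩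

protected lemma bord (hP : IsRegularDirectedComplex P) (h : IsMolecule U) (n : ℕ) (α : ℤˣ) :
    IsMolecule (bord n α U) := by
  obtain ⟨d, hd⟩ := h.exists_dimLE
  exact (isGlobular_and_bord_of_dimLE hP d U h hd).2 n α

/-- In a molecule of dimension `n + 1`, an element of dimension `n` has at most one cover of each
sign. -/
lemma cover_unique (h : IsMolecule U) (hd : DimLE (n + 1) U) {w y z : P} (hw : dim w = n)
    (hy : y ∈ U) (hz : z ∈ U) (hwy : w ⋖ y) (hwz : w ⋖ z) (ho : orient hwy = orient hwz) :
    y = z := by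
  induction h with
  | atom x =>
    have hy' := dim_covBy hwy
    have hz' := dim_covBy hwz
    have := hd x le_rfl
    rw [eq_of_le_of_dim_le (show y ≤ x from hy) (by omega),
      eq_of_le_of_dim_le (show z ≤ x from hz) (by omega)]
  | paste U₁ U₂ k h₁ h₂ ne₁ ne₂ hout hin ih₁ ih₂ =>
    have d₁ : DimLE (n + 1) U₁ := fun x hx => hd x (Or.inl hx)
    have d₂ : DimLE (n + 1) U₂ := fun x hx => hd x (Or.inr hx)
    -- Otherwise the overlap would be all of `U₁`, and `U₂` would not be properly contained in the
    -- union.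
    have hk : k < n + 1 := by
      by_contra! hk
      rw [bord_eq_self h₁.lower (d₁.mono hk)] at hout
      rw [Set.union_eq_right.2 (Set.inter_eq_left.1 hout)] at ne₂
      exact ne₂.ne rfl
    -- Covers on different sides put `w` in the overlap, which makes the cover in `U₁` positive and
    -- the one in `U₂` negative.
    have key : ∀ {y z}, y ∈ U₁ → z ∈ U₂ → ∀ (hwy : w ⋖ y) (hwz : w ⋖ z),
        orient hwy ≠ orient hwz := by
      intro y z hy hz hwy hwz ho
      have hM : w ∈ U₁ ∩ U₂ := ⟨h₁.lower hwy.le hy, h₂.lower hwz.le hz⟩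
      have m₁ := mem_sbord_of_mem_bord (hout ▸ hM) (by omega)
      have m₂ := mem_sbord_of_mem_bord (hin ▸ hM) (by omega)
      rw [m₁.2.2 y hy hwy, m₂.2.2 z hz hwz] at ho
      exact absurd ho (by decide)
    rcases hy with hy | hy <;> rcases hz with hz | hz
    · exact ih₁ d₁ hy hz
    · exact absurd ho (key hy hz hwy hwz)
    · exact absurd ho.symm (key hz hy hwz hwy)
    · exact ih₂ d₂ hy hz

end IsMolecule

lemma isGlobular_Iic (hP : IsRegularDirectedComplex P) (x : P) : IsGlobular (Set.Iic x) :=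
  (IsMolecule.isGlobular_and_bord_of_dimLE hP _ _ (.atom x) (dimLE_Iic x)).1

end Boundary

end OGP

namespace OGP

/-! ### Submolecules and gluing along parts of boundaries. -/

section Submolecule

variable {P : Type*} [PartialOrder P] [OrientedGradedPoset P]

/-- `IsSubmolecule A B`: the molecule `B` is obtained from the molecule `A` by successive
pastings. -/
inductive IsSubmolecule : Set P → Set P → Prop
  | refl {A : Set P} (hA : IsMolecule A) : IsSubmolecule A A
  | paste {A B C : Set P} {n : ℕ} {γ : ℤˣ} (h : IsSubmolecule A B) (hC : IsMolecule C)
      (h₁ : B ∩ C = bord n γ B) (h₂ : B ∩ C = bord n (-γ) C) : IsSubmolecule A (B ∪ C)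

namespace IsSubmolecule

variable {A B C : Set P}

lemma isMolecule_right (h : IsSubmolecule A B) : IsMolecule B := by
  induction h with
  | refl hA => exact hA
  | paste _ hC h₁ h₂ ih => exact ih.paste_of_inter hC h₁ h₂

lemma subset (h : IsSubmolecule A B) : A ⊆ B := by
  induction h with
  | refl _ => exact subset_rfl
  | paste _ _ _ _ ih => exact ih.trans Set.subset_union_left

lemma trans (h : IsSubmolecule A B) (h' : IsSubmolecule B C) : IsSubmolecule A C := by
  induction h' with
  | refl _ => exact h
  | paste _ hC h₁ h₂ ih => exact .paste ih hC h₁ h₂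

/-- If a boundary of `S` is a submolecule of `W`, then `S` can be attached to `W` along it. -/
lemma attach (hG : ∀ x : P, IsGlobular (Set.Iic x)) {S W : Set P} {m : ℕ} {γ : ℤˣ}
    (hS : IsMolecule S)
    (h : IsSubmolecule (bord m γ S) W) (hd : DimLE m W) (hSW : S ∩ W = bord m γ S) :
    IsSubmolecule S (W ∪ S) ∧ bord m γ (W ∪ S) = W := by
  generalize hA : bord m γ S = A at h
  induction h with
  | refl _ =>
    subst hA
    rw [Set.union_eq_right.2 (bord_subset hS.lower)]
    exact ⟨.refl hS, rfl⟩
  | @paste B C k δ hAB hC h₁ h₂ ih =>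
    subst hA
    have hdB : DimLE m B := fun x hx => hd x (Or.inl hx)
    have hdC : DimLE m C := fun x hx => hd x (Or.inr hx)
    have hB := hAB.isMolecule_right
    have hSB : S ∩ B = bord m γ S := by
      apply Set.Subset.antisymm
      · exact (Set.inter_subset_inter_right _ Set.subset_union_left).trans hSW.subset
      · exact Set.subset_inter (bord_subset hS.lower) hAB.subset
    obtain ⟨hsub, hbord⟩ := ih hdB hSB
    -- For `k < m` the `k`-boundary of `B ∪ S` is that of its `m`-boundary `B`, so `C` can be pasted
    -- to `B ∪ S` exactly as it was to `B`. For `k ≥ m` the dimension bound forces `C = B`.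
    rcases lt_or_ge k m with hk | hk
    · have hBS := hsub.isMolecule_right
      have hint : (B ∪ S) ∩ C = B ∩ C := by
        apply Set.Subset.antisymm
        · rintro x ⟨hx | hx, hxC⟩
          · exact ⟨hx, hxC⟩
          · exact ⟨hAB.subset (hSW.subset ⟨hx, Or.inr hxC⟩), hxC⟩
        · exact Set.inter_subset_inter_left _ Set.subset_union_left
      have hl : (B ∪ S) ∩ C = bord k δ (B ∪ S) := by
        rw [hint, h₁, ← (hBS.isGlobular hG).bord_bord δ γ hk, hbord]
      have hr : (B ∪ S) ∩ C = bord k (-δ) C := by rw [hint, h₂]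
      have hp : IsPasting k δ (B ∪ S) C := ⟨hBS.isGlobular hG, hC.isGlobular hG, hl, hr⟩
      rw [Set.union_right_comm]
      refine ⟨.paste hsub hC hl hr, ?_⟩
      rw [hp.bord_union_of_gt hk, hbord, bord_eq_self hC.lower hdC]
    · rw [bord_eq_self hB.lower (hdB.mono hk)] at h₁
      rw [bord_eq_self hC.lower (hdC.mono hk), h₁] at h₂
      subst h₂
      rw [Set.union_self]
      exact ⟨hsub, hbord⟩

/-- Two molecules that meet along parts of their boundaries can be pasted, provided that the
boundaries are submolecules of their union. -/
lemma glue (hG : ∀ x : P, IsGlobular (Set.Iic x)) {S T : Set P} {m : ℕ} {γ : ℤˣ} (hS : IsMolecule S)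
    (hT : IsMolecule T) (hSM : IsSubmolecule (bord m γ S) (bord m γ S ∪ bord m (-γ) T))
    (hTM : IsSubmolecule (bord m (-γ) T) (bord m γ S ∪ bord m (-γ) T))
    (h₁ : S ∩ T ⊆ bord m γ S) (h₂ : S ∩ T ⊆ bord m (-γ) T) :
    IsSubmolecule S (S ∪ T) ∧ IsSubmolecule T (S ∪ T) := by
  have bS : bord m γ S ⊆ S := bord_subset hS.lower
  have bT : bord m (-γ) T ⊆ T := bord_subset hT.lower
  set M := bord m γ S ∪ bord m (-γ) T with hM
  have hd : DimLE m M := by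
    rintro x (hx | hx)
    · exact dim_le_of_mem_bord hx
    · exact dim_le_of_mem_bord hx
  obtain ⟨s₁, b₁⟩ := attach hG hS hSM hd (by
    apply Set.Subset.antisymm
    · rintro x ⟨hxS, hx | hx⟩
      · exact hx
      · exact h₁ ⟨hxS, bT hx⟩
    · exact Set.subset_inter bS Set.subset_union_left)
  obtain ⟨s₂, b₂⟩ := attach hG hT hTM hd (by
    apply Set.Subset.antisymm
    · rintro x ⟨hxT, hx | hx⟩
      · exact h₂ ⟨bS hx, hxT⟩
      · exact hx
    · exact Set.subset_inter bT Set.subset_union_right)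
  -- After `M` has been attached to both sides, the overlap is exactly `M`, a full `m`-boundary of
  -- each, so this is an honest pasting.
  have hint : (M ∪ S) ∩ (M ∪ T) = M := by
    rw [← Set.union_inter_distrib_left, Set.union_eq_left]
    exact h₁.trans Set.subset_union_left
  have hun : (M ∪ S) ∪ (M ∪ T) = S ∪ T := by
    apply Set.Subset.antisymm
    · have : M ⊆ S ∪ T := Set.union_subset_union bS bT
      exact Set.union_subset (Set.union_subset this Set.subset_union_left)
        (Set.union_subset this Set.subset_union_right)
    · exact Set.union_subset_union Set.subset_union_right Set.subset_union_right
  have e₁ : IsSubmolecule (M ∪ S) (S ∪ T) := by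
    rw [← hun]
    exact .paste (.refl s₁.isMolecule_right) s₂.isMolecule_right (by rw [hint, b₁])
      (by rw [hint, b₂])
  have e₂ : IsSubmolecule (M ∪ T) (S ∪ T) := by
    rw [← hun, Set.union_comm (M ∪ S)]
    exact .paste (γ := -γ) (.refl s₂.isMolecule_right) s₁.isMolecule_right
      (by rw [Set.inter_comm, hint, b₂]) (by rw [Set.inter_comm, hint, neg_neg, b₁])
  exact ⟨s₁.trans e₁, s₂.trans e₂⟩

end IsSubmolecule

end Submolecule

end OGP

/-! ### Boundaries of Gray products and of staircases. -/

namespace OGP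

lemma sign_eq_or_eq_neg (α β : ℤˣ) : α = β ∨ α = -β := by
  rcases Int.units_eq_one_or α with rfl | rfl <;> rcases Int.units_eq_one_or β with rfl | rfl <;>
    simp

lemma sign_mul_sign (i : ℕ) (α : ℤˣ) : (-1) ^ i * ((-1) ^ i * α) = α := by
  rw [← mul_assoc, ← mul_pow]; simp

lemma covBy_prod_mk_left {P Q : Type*} [PartialOrder P] [PartialOrder Q] {x x' : P} (h : x ⋖ x')
    (y : Q) : (x, y) ⋖ (x', y) :=
  Prod.mk_covBy_mk_iff.2 (Or.inl ⟨h, rfl⟩)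

lemma covBy_prod_mk_right {P Q : Type*} [PartialOrder P] [PartialOrder Q] {y y' : Q} (x : P)
    (h : y ⋖ y') : (x, y) ⋖ (x, y') :=
  Prod.mk_covBy_mk_iff.2 (Or.inr ⟨h, rfl⟩)

section Product

variable {P Q : Type*} [PartialOrder P] [OrientedGradedPoset P] [PartialOrder Q]
  [OrientedGradedPoset Q] {U : Set P} {V : Set Q}

lemma dim_prod (p : P × Q) : dim p = dim p.1 + dim p.2 := rfl

lemma orient_prod_left {x x' : P} {y : Q} (h : x ⋖ x') (h' : (x, y) ⋖ (x', y)) :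
    orient h' = orient h := by
  classical
  change (if h₁ : x ⋖ x' then orient h₁ else _) = _
  rw [dif_pos h]

lemma orient_prod_right {x : P} {y y' : Q} (h : y ⋖ y') (h' : (x, y) ⋖ (x, y')) :
    orient h' = (-1) ^ dim x * orient h := by
  classical
  change (if h₁ : x ⋖ x then orient h₁ else
    if h₂ : y ⋖ y' then (-1) ^ dim x * orient h₂ else 1) = _
  rw [dif_neg fun h => h.lt.ne rfl, dif_pos h]

lemma mem_sbord_prod {n : ℕ} {α : ℤˣ} {u : P} {v : Q} :
    (u, v) ∈ sbord n α (U ×ˢ V) ↔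
      dim u + dim v = n ∧ u ∈ sbord (dim u) α U ∧ v ∈ sbord (dim v) ((-1) ^ dim u * α) V := by
  constructor
  · rintro ⟨⟨hu, hv⟩, hd, hc⟩
    refine ⟨hd, ⟨hu, rfl, fun u' hu' h => ?_⟩, ⟨hv, rfl, fun v' hv' h => ?_⟩⟩
    · rw [← orient_prod_left h (covBy_prod_mk_left h v)]
      exact hc (u', v) ⟨hu', hv⟩ _
    · rw [← hc (u, v') ⟨hu, hv'⟩ (covBy_prod_mk_right u h), orient_prod_right h, sign_mul_sign]
  · rintro ⟨hd, ⟨hu, -, hcu⟩, ⟨hv, -, hcv⟩⟩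
    refine ⟨⟨hu, hv⟩, hd, ?_⟩
    rintro ⟨u', v'⟩ ⟨hu', hv'⟩ h
    rcases Prod.mk_covBy_mk_iff.1 h with ⟨c, rfl⟩ | ⟨c, rfl⟩
    · rw [orient_prod_left c, hcu u' hu']
    · rw [orient_prod_right c, hcv v' hv', sign_mul_sign]

/-- The boundaries of a Gray product. -/
lemma mem_bord_prod (hU : IsGlobular U) (hV : IsGlobular V) {r : ℕ} {α : ℤˣ} {u : P} {v : Q} :
    (u, v) ∈ bord r α (U ×ˢ V) ↔
      ∃ i j, i + j = r ∧ u ∈ bord i α U ∧ v ∈ bord j ((-1) ^ i * α) V := by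
  constructor
  · rintro (⟨⟨u', v'⟩, h, hle⟩ | ⟨⟨hu, hv⟩, hd⟩)
    · obtain ⟨hd, hu, hv⟩ := mem_sbord_prod.1 h
      exact ⟨_, _, hd, Or.inl ⟨u', hu, hle.1⟩, Or.inl ⟨v', hv, hle.2⟩⟩
    · obtain ⟨u', huu', hmax, hle⟩ := hU.exists_max_dim hu
      have key : ∀ v' ∈ V, v ≤ v' → dim u' + dim v' ≤ r := fun v' hv' hvv' =>
        hd (u', v') ⟨hmax.1, hv'⟩ ⟨huu', hvv'⟩
      have := key v hv le_rfl
      refine ⟨dim u', r - dim u', by omega, Or.inr ⟨hu, hle⟩, Or.inr ⟨hv, fun v' hv' hvv' => ?_⟩⟩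
      have := key v' hv' hvv'
      omega
  · rintro ⟨i, j, rfl, hu, hv⟩
    have huU := bord_subset hU.lower hu
    have hvV := bord_subset hV.lower hv
    by_cases hall : ∀ p ∈ U ×ˢ V, (u, v) ≤ p → dim p ≤ i + j
    · exact Or.inr ⟨⟨huU, hvV⟩, hall⟩
    push Not at hall
    obtain ⟨⟨p, q⟩, ⟨hp, hq⟩, ⟨hup, hvq⟩, hd⟩ := hall
    obtain ⟨u', huu', humax, hule⟩ := hU.exists_max_dim huU
    obtain ⟨v', hvv', hvmax, hvle⟩ := hV.exists_max_dim hvV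
    have hpu := hule p hp hup
    have hqv := hvle q hq hvq
    rw [dim_prod] at hd
    simp only at hd
    -- The degrees `i`, `j` need adjusting when nothing above one coordinate exceeds its degree: a
    -- maximal element is used there, and the surplus degree moves to the other coordinate.
    suffices h : ∃ k l, k + l = i + j ∧ (∃ x ∈ sbord k α U, u ≤ x) ∧
        ∃ y ∈ sbord l ((-1) ^ k * α) V, v ≤ y by
      obtain ⟨k, l, hkl, ⟨x, hx, hux⟩, ⟨y, hy, hvy⟩⟩ := h
      refine Or.inl ⟨(x, y), mem_sbord_prod.2 ⟨?_, ?_, ?_⟩, hux, hvy⟩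
      · rw [hx.2.1, hy.2.1, hkl]
      · rwa [hx.2.1]
      · rwa [hx.2.1, hy.2.1]
    rcases lt_or_ge i (dim u') with hi | hi
    · rcases lt_or_ge j (dim v') with hj | hj
      · exact ⟨i, j, rfl, exists_le_sbord_of_mem_bord hu humax.1 huu' hi,
          exists_le_sbord_of_mem_bord hv hvmax.1 hvv' hj⟩
      · exact ⟨i + j - dim v', dim v', by omega,
          exists_le_sbord_of_mem_bord (hU.bord_mono (by omega) (fun _ => rfl) hu) humax.1 huu'
            (by omega), v', mem_sbord_of_maximal hvmax, hvv'⟩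
    · have hj : j < dim v' := by omega
      refine ⟨dim u', i + j - dim u', by omega, ⟨u', mem_sbord_of_maximal humax, huu'⟩,
        exists_le_sbord_of_mem_bord (hV.bord_mono (by omega) (fun h => ?_) hv) hvmax.1 hvv'
            (by omega)⟩
      rw [show i = dim u' by omega]

/-- A union of products of boundaries of `U` and of `V`, of total dimension `r`, with compatible
signs. -/
def stairs (U : Set P) (V : Set Q) (ε : ℕ → ℤˣ) (r a b : ℕ) : Set (P × Q) :=
  {p | ∃ i j, i + j = r ∧ a ≤ i ∧ i ≤ b ∧ p.1 ∈ bord i (ε (i + 1)) U ∧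
    p.2 ∈ bord j ((-1) ^ i * ε i) V}

/-- The signs of the boundary of sign `γ` of a staircase. -/
def stairSigns (ε : ℕ → ℤˣ) (a b : ℕ) (γ : ℤˣ) (i : ℕ) : ℤˣ :=
  if i < a then -ε a else if i ≤ b then γ else ε i

lemma bord_prod_eq_stairs (hU : IsGlobular U) (hV : IsGlobular V) (r : ℕ) (α : ℤˣ) :
    bord r α (U ×ˢ V) = stairs U V (fun _ => α) r 0 r := by
  ext ⟨u, v⟩
  rw [mem_bord_prod hU hV]
  constructor
  · rintro ⟨i, j, hij, h⟩
    exact ⟨i, j, hij, by omega, by omega, h⟩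
  · rintro ⟨i, j, hij, -, -, h⟩
    exact ⟨i, j, hij, h⟩

lemma stairs_congr {ε ε' : ℕ → ℤˣ} {r a b : ℕ} (h : ∀ i, a ≤ i → i ≤ b + 1 → ε i = ε' i) :
    stairs U V ε r a b = stairs U V ε' r a b := by
  ext p
  constructor
  · rintro ⟨i, j, hij, ha, hb, hp⟩
    exact ⟨i, j, hij, ha, hb, by rwa [← h i ha (by omega), ← h (i + 1) (by omega) (by omega)]⟩
  · rintro ⟨i, j, hij, ha, hb, hp⟩
    exact ⟨i, j, hij, ha, hb, by rwa [h i ha (by omega), h (i + 1) (by omega) (by omega)]⟩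

/-- Passing to a boundary of codimension one lowers the degree of at least one coordinate. -/
lemma mem_of_mem_bord_prod_bord (hU : IsGlobular U) (hV : IsGlobular V) {i j r : ℕ} {s t γ : ℤˣ}
    {u : P} {v : Q} (hij : i + j = r + 1) (h : (u, v) ∈ bord r γ (bord i s U ×ˢ bord j t V)) :
    (∃ i', i' + 1 = i ∧ u ∈ bord i' γ U ∧ v ∈ bord j t V) ∨
      ∃ j', j' + 1 = j ∧ u ∈ bord i s U ∧ v ∈ bord j' ((-1) ^ i * γ) V := by
  obtain ⟨i', j', hij', hu, hv⟩ := (mem_bord_prod (hU.bord _ _) (hV.bord _ _)).1 h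
  rcases lt_or_ge i' i with hi | hi
  · rw [hU.bord_bord _ _ hi] at hu
    exact Or.inl ⟨i - 1, by omega, hU.bord_mono (by omega) (fun _ => rfl) hu,
      bord_subset (hV.lower_bord _ _) hv⟩
  · rw [hV.bord_bord _ _ (by omega)] at hv
    refine Or.inr ⟨j - 1, by omega, bord_subset (hU.lower_bord _ _) hu,
      hV.bord_mono (by omega) (fun h => ?_) hv⟩
    rw [show i' = i by omega]

lemma isLowerSet_stairs (hU : IsGlobular U) (hV : IsGlobular V) (ε : ℕ → ℤˣ) (r a b : ℕ) :
    IsLowerSet (stairs U V ε r a b) := by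
  rintro p q hqp ⟨i, j, hij, ha, hb, h₁, h₂⟩
  exact ⟨i, j, hij, ha, hb, hU.lower_bord _ _ hqp.1 h₁, hV.lower_bord _ _ hqp.2 h₂⟩

variable {ε : ℕ → ℤˣ} {r a b : ℕ} {γ : ℤˣ}

lemma stairSigns_of_mem {i : ℕ} (ha : a ≤ i) (hb : i ≤ b) : stairSigns ε a b γ i = γ := by
  rw [stairSigns, if_neg (by omega), if_pos hb]

lemma stairSigns_of_lt {i : ℕ} (ha : i < a) : stairSigns ε a b γ i = -ε a := by
  rw [stairSigns, if_pos ha]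

lemma stairSigns_of_gt {i : ℕ} (hab : a ≤ b) (hb : b < i) : stairSigns ε a b γ i = ε i := by
  rw [stairSigns, if_neg (by omega), if_neg (by omega)]

/-- The value `ε (i + 1)` governs the `U`-side of step `i` and the `V`-side of step `i + 1`.
Comparing it with `γ` decides in which of these two neighbouring steps a point lies. -/
lemma stairs_stairSigns_subset (hU : IsGlobular U) (hV : IsGlobular V) (hab : a ≤ b) :
    stairs U V (stairSigns ε a b γ) r (a - 1) b ⊆ stairs U V ε (r + 1) a b := by
  rintro ⟨u, v⟩ ⟨j, l, hjl, ha, hb, hu, hv⟩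
  simp only at hu hv
  rcases lt_or_ge j a with hj | hj
  · obtain rfl : j + 1 = a := by omega
    rw [stairSigns_of_lt hj] at hv
    refine ⟨j + 1, l, by omega, le_rfl, hab, hU.bord_subset_bord _ _ (by omega) hu, ?_⟩
    rw [pow_succ]
    simpa using hv
  rw [stairSigns_of_mem hj hb] at hv
  rcases hb.lt_or_eq with hb | rfl
  · rw [stairSigns_of_mem (by omega) (by omega)] at hu
    rcases sign_eq_or_eq_neg (ε (j + 1)) γ with h | h
    · exact ⟨j, l + 1, by omega, hj, hb.le, h ▸ hu, hV.bord_subset_bord _ _ (by omega) hv⟩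
    · refine ⟨j + 1, l, by omega, by omega, hb, hU.bord_subset_bord _ _ (by omega) hu, ?_⟩
      rw [h, pow_succ]
      simpa using hv
  · rw [stairSigns_of_gt hab (by omega)] at hu
    exact ⟨j, l + 1, by omega, hj, le_rfl, hu, hV.bord_subset_bord _ _ (by omega) hv⟩

/-- By dimension, a cover of `(u, v)` in the staircase lies in step `k + 1` or in step `k`,
according to the coordinate that it raises; if that step is present, the sign of `stairSigns` there
is `γ`. -/
lemma mem_sbord_stairs (hU : IsGlobular U) (hV : IsGlobular V) (hab : a ≤ b) {k l : ℕ}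
    (hkl : k + l = r) (ha : a - 1 ≤ k) (hb : k ≤ b) {u : P} {v : Q}
    (hu : u ∈ sbord k (stairSigns ε a b γ (k + 1)) U)
    (hv : v ∈ sbord l ((-1) ^ k * stairSigns ε a b γ k) V) :
    (u, v) ∈ sbord r γ (stairs U V ε (r + 1) a b) := by
  refine ⟨stairs_stairSigns_subset (γ := γ) hU hV hab ⟨k, l, hkl, ha, hb, sbord_subset_bord hu,
    sbord_subset_bord hv⟩, ?_, ?_⟩
  · rw [dim_prod, hu.2.1, hv.2.1, hkl]
  rintro ⟨u', v'⟩ ⟨i, j, hij, ha', hb', hu', hv'⟩ h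
  have hud := hu.2.1
  have hvd := hv.2.1
  have h₁ := dim_le_of_mem_bord hu'
  have h₂ := dim_le_of_mem_bord hv'
  rcases Prod.mk_covBy_mk_iff.1 h with ⟨c, rfl⟩ | ⟨c, rfl⟩
  · have := dim_covBy c
    simp only at h₁ h₂
    obtain rfl : i = k + 1 := by omega
    rw [orient_prod_left c, hu.2.2 u' (bord_subset hU.lower hu') c, stairSigns_of_mem ha' hb']
  · have := dim_covBy c
    simp only at h₁ h₂
    obtain rfl : i = k := by omega
    rw [orient_prod_right c, hv.2.2 v' (bord_subset hV.lower hv') c, hud, sign_mul_sign,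
      stairSigns_of_mem ha' hb']

/-- Walls between consecutive steps all take the sign `γ`, while the two outer walls keep theirs.
The new first step `a - 1` lowers the `U`-side of step `a`; the sign `-ε a` compensates for the
change in `(-1) ^ i`. For `a = 0` there is no such step, in agreement with truncated subtraction. -/
lemma bord_stairs (hU : IsGlobular U) (hV : IsGlobular V) (hab : a ≤ b) :
    bord r γ (stairs U V ε (r + 1) a b) = stairs U V (stairSigns ε a b γ) r (a - 1) b := by
  apply Set.Subset.antisymm
  -- A boundary point of the union is a boundary point of every step that contains it.
  · have key : ∀ p : P × Q, p ∈ stairs U V ε (r + 1) a b →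
        (∀ i j, i + j = r + 1 → a ≤ i → i ≤ b →
          p ∈ bord i (ε (i + 1)) U ×ˢ bord j ((-1) ^ i * ε i) V →
          p ∈ bord r γ (bord i (ε (i + 1)) U ×ˢ bord j ((-1) ^ i * ε i) V)) →
        p ∈ stairs U V (stairSigns ε a b γ) r (a - 1) b := by
      rintro ⟨u, v⟩ ⟨i, j, hij, ha, hb, hu, hv⟩ hp
      simp only at hu hv
      rcases mem_of_mem_bord_prod_bord hU hV hij (hp i j hij ha hb ⟨hu, hv⟩) with
        ⟨i, rfl, hu', -⟩ | ⟨j, rfl, -, hv'⟩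
      · rcases ha.lt_or_eq with hai | rfl
        -- If the wall has sign `γ`, the point also lies in the neighbouring step, whose boundary
        -- gives the missing condition; if not, the wall already supplies the `V`-coordinate.
        · rcases sign_eq_or_eq_neg (ε (i + 1)) γ with h | h
          · rcases mem_of_mem_bord_prod_bord hU hV (by omega) (hp i (j + 1) (by omega) (by omega)
              (by omega) ⟨h ▸ hu', hV.bord_subset_bord _ _ (by omega) hv⟩) with
              ⟨i, rfl, hu'', -⟩ | ⟨j', hj', -, hv''⟩
            · refine ⟨i, j + 1, by omega, by omega, by omega, ?_,
                hV.bord_subset_bord _ _ (by omega) hv⟩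
              rwa [stairSigns_of_mem (by omega) (by omega)]
            · obtain rfl : j' = j := by omega
              refine ⟨i, j', by omega, by omega, by omega, ?_, ?_⟩
              · rwa [stairSigns_of_mem (by omega) (by omega)]
              · rwa [stairSigns_of_mem (by omega) (by omega)]
          · refine ⟨i, j, by omega, by omega, by omega, ?_, ?_⟩
            · rwa [stairSigns_of_mem (by omega) (by omega)]
            · rw [stairSigns_of_mem (by omega) (by omega)]
              rw [h, pow_succ] at hv
              simpa using hv
        · refine ⟨i, j, by omega, by omega, by omega, ?_, ?_⟩
          · rwa [stairSigns_of_mem (by omega) (by omega)]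
          · rw [stairSigns_of_lt (by omega)]
            rw [pow_succ] at hv
            simpa using hv
      · rcases hb.lt_or_eq with hib | rfl
        · rcases sign_eq_or_eq_neg (ε (i + 1)) γ with h | h
          · refine ⟨i, j, by omega, by omega, by omega, ?_, ?_⟩
            · rw [stairSigns_of_mem (by omega) (by omega)]
              exact h ▸ hu
            · rwa [stairSigns_of_mem (by omega) (by omega)]
          · rcases mem_of_mem_bord_prod_bord hU hV (by omega) (hp (i + 1) j (by omega) (by omega)
              (by omega) ⟨hU.bord_subset_bord _ _ (by omega) hu, by
                rw [h, pow_succ]; simpa using hv'⟩) with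
              ⟨i', hi', hu'', -⟩ | ⟨j, rfl, -, hv''⟩
            · obtain rfl : i' = i := by omega
              refine ⟨i', j, by omega, by omega, by omega, ?_, ?_⟩
              · rwa [stairSigns_of_mem (by omega) (by omega)]
              · rwa [stairSigns_of_mem (by omega) (by omega)]
            · refine ⟨i + 1, j, by omega, by omega, by omega,
                hU.bord_subset_bord _ _ (by omega) hu, ?_⟩
              rwa [stairSigns_of_mem (by omega) (by omega)]
        · refine ⟨i, j, by omega, by omega, by omega, ?_, ?_⟩
          · rwa [stairSigns_of_gt hab (by omega)]
          · rwa [stairSigns_of_mem (by omega) (by omega)]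
    have hsub : ∀ {i j}, i + j = r + 1 → a ≤ i → i ≤ b →
        bord i (ε (i + 1)) U ×ˢ bord j ((-1) ^ i * ε i) V ⊆ stairs U V ε (r + 1) a b :=
      fun hij ha hb p hp => ⟨_, _, hij, ha, hb, hp⟩
    rintro p (⟨q, hq, hpq⟩ | ⟨hp, hd⟩)
    · refine isLowerSet_stairs hU hV _ _ _ _ hpq (key q hq.1 fun i j hij ha hb hq' => ?_)
      exact sbord_subset_bord ⟨hq', hq.2.1, fun t ht => hq.2.2 t (hsub hij ha hb ht)⟩
    · exact key p hp fun i j hij ha hb hp' =>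
        Or.inr ⟨hp', fun t ht => hd t (hsub hij ha hb ht)⟩
  · intro p hp
    have hpS := stairs_stairSigns_subset hU hV hab hp
    by_cases hall : ∀ q ∈ stairs U V ε (r + 1) a b, p ≤ q → dim q ≤ r
    · exact Or.inr ⟨hpS, hall⟩
    push Not at hall
    obtain ⟨u, v⟩ := p
    obtain ⟨⟨x, y⟩, ⟨i, m, him, hai, hib, hx, hy⟩, ⟨hux, hvy⟩, hd⟩ := hall
    obtain ⟨j, l, hjl, haj, hjb, hu, hv⟩ := hp
    simp only at hu hv hx hy hux hvy
    rw [dim_prod] at hd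
    simp only at hd
    have hxi := dim_le_of_mem_bord hx
    have hym := dim_le_of_mem_bord hy
    have hxU := bord_subset hU.lower hx
    have hyV := bord_subset hV.lower hy
    suffices h : ∃ k n, k + n = r ∧ a - 1 ≤ k ∧ k ≤ b ∧
        (∃ u' ∈ sbord k (stairSigns ε a b γ (k + 1)) U, u ≤ u') ∧
        ∃ v' ∈ sbord n ((-1) ^ k * stairSigns ε a b γ k) V, v ≤ v' by
      obtain ⟨k, n, hkn, hk₁, hk₂, ⟨u', hu', huu'⟩, ⟨v', hv', hvv'⟩⟩ := h
      exact Or.inl ⟨(u', v'), mem_sbord_stairs hU hV hab hkn hk₁ hk₂ hu' hv', huu', hvv'⟩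
    -- The element above `p` has dimension `r + 1`, so its coordinates have dimensions exactly `i`
    -- and `m`. Comparing `j` with `i` tells which coordinate of `p` certainly lies below something
    -- of larger degree.
    rcases lt_or_ge j i with hji | hji
    · obtain ⟨v', hvv', hmax, hle⟩ := hV.exists_max_dim (bord_subset hV.lower hv)
      have := hle y hyV hvy
      rcases lt_or_ge l (dim v') with hl | hl
      · exact ⟨j, l, hjl, haj, hjb, exists_le_sbord_of_mem_bord hu hxU hux (by omega),
          exists_le_sbord_of_mem_bord hv hmax.1 hvv' hl⟩
      · refine ⟨r - dim v', dim v', by omega, by omega, by omega, exists_le_sbord_of_mem_bord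
          (hU.bord_mono (by omega) (fun h => ?_) hu) hxU hux (by omega), v',
          mem_sbord_of_maximal hmax, hvv'⟩
        rw [h]
    · obtain ⟨u', huu', hmax, hle⟩ := hU.exists_max_dim (bord_subset hU.lower hu)
      have := hle x hxU hux
      rcases lt_or_ge j (dim u') with hj | hj
      · exact ⟨j, l, hjl, haj, hjb, exists_le_sbord_of_mem_bord hu hmax.1 huu' hj,
          exists_le_sbord_of_mem_bord hv hyV hvy (by omega)⟩
      · refine ⟨dim u', r - dim u', by omega, by omega, by omega,
          ⟨u', mem_sbord_of_maximal hmax, huu'⟩, exists_le_sbord_of_mem_bord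
          (hV.bord_mono (by omega) (fun h => ?_) hv) hyV hvy (by omega)⟩
        rw [show j = dim u' by omega]

lemma mem_bord_prod_of_forall (hU : IsGlobular U) (hV : IsGlobular V) {i j k : ℕ} {s t α : ℤˣ}
    {u : P} {v : Q} (h : (u, v) ∈ bord k α (bord i s U ×ˢ bord j t V))
    (hu : ∀ σ, u ∈ bord i σ U) (hv : ∀ τ, v ∈ bord j τ V) : (u, v) ∈ bord k α (U ×ˢ V) := by
  obtain ⟨i', j', hij', hu', hv'⟩ := (mem_bord_prod (hU.bord _ _) (hV.bord _ _)).1 h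
  refine (mem_bord_prod hU hV).2 ⟨i', j', hij', ?_, ?_⟩
  · rcases lt_or_ge i' i with hi | hi
    · rwa [hU.bord_bord _ _ hi] at hu'
    · exact hU.bord_mono hi (fun _ => rfl) (hu α)
  · rcases lt_or_ge j' j with hj | hj
    · rwa [hV.bord_bord _ _ hj] at hv'
    · exact hV.bord_mono hj (fun _ => rfl) (hv _)

lemma mem_bord_prod_cases (hU : IsGlobular U) (hV : IsGlobular V) {i j k : ℕ} {s t α : ℤˣ}
    {u : P} {v : Q} (h : (u, v) ∈ bord k α (bord i s U ×ˢ bord j t V)) :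
    (u, v) ∈ bord k α (U ×ˢ V) ∨ (∃ l τ, i + l = k ∧ v ∈ bord l τ V) ∨
      ∃ l σ, l + j = k ∧ u ∈ bord l σ U := by
  obtain ⟨i', j', hij', hu, hv⟩ := (mem_bord_prod (hU.bord _ _) (hV.bord _ _)).1 h
  rw [mem_bord_prod hU hV]
  by_cases hi : i' = i
  · subst hi
    rcases lt_or_ge j' j with hj | hj
    · rw [hV.bord_bord _ _ hj] at hv
      exact Or.inr (Or.inl ⟨j', _, hij', hv⟩)
    · rw [hV.bord_bord_of_le _ _ hj] at hv
      rcases hj.lt_or_eq with hj | rfl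
      · exact Or.inr (Or.inl ⟨j', 1, hij', hV.bord_subset_bord _ _ hj hv⟩)
      · exact Or.inr (Or.inl ⟨j, _, hij', hv⟩)
  by_cases hj : j' = j
  · subst hj
    rcases lt_or_ge i' i with hi' | hi'
    · rw [hU.bord_bord _ _ hi'] at hu
      exact Or.inr (Or.inr ⟨i', _, hij', hu⟩)
    · rw [hU.bord_bord_of_le _ _ hi'] at hu
      exact Or.inr (Or.inr ⟨i', 1, hij', hU.bord_subset_bord _ _ (by omega) hu⟩)
  refine Or.inl ⟨i', j', hij', ?_, ?_⟩
  · rcases lt_or_ge i' i with hi' | hi'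
    · rwa [hU.bord_bord _ _ hi'] at hu
    · rw [hU.bord_bord_of_le _ _ hi'] at hu
      exact hU.bord_subset_bord _ _ (by omega) hu
  · rcases lt_or_ge j' j with hj' | hj'
    · rwa [hV.bord_bord _ _ hj'] at hv
    · rw [hV.bord_bord_of_le _ _ hj'] at hv
      exact hV.bord_subset_bord _ _ (by omega) hv

protected lemma IsGlobular.prod (hU : IsGlobular U) (hV : IsGlobular V) :
    IsGlobular (U ×ˢ V) where
  lower := hU.lower.prod hV.lower
  bounded := by
    obtain ⟨d, hd⟩ := hU.bounded
    obtain ⟨e, he⟩ := hV.bounded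
    exact ⟨d + e, fun p hp => add_le_add (hd _ hp.1) (he _ hp.2)⟩
  lower_bord n α := by
    rw [bord_prod_eq_stairs hU hV]
    exact isLowerSet_stairs hU hV _ _ _ _
  bord_bord {k m} α β hkm := by
    -- Codimension one is `bord_stairs` with a constant sign.
    rcases (Nat.succ_le_of_lt hkm).lt_or_eq with hkm' | rfl
    swap
    · rw [bord_prod_eq_stairs hU hV, bord_prod_eq_stairs hU hV, Nat.succ_eq_add_one,
        bord_stairs hU hV (by omega)]
      ext p
      constructor
      · rintro ⟨i, j, hij, -, hi, h₁, h₂⟩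
        rw [stairSigns_of_mem (by omega) (by omega)] at h₁ h₂
        exact ⟨i, j, hij, by omega, by omega, h₁, h₂⟩
      · rintro ⟨i, j, hij, -, hi, h₁, h₂⟩
        refine ⟨i, j, hij, by omega, by omega, ?_, ?_⟩
        · rwa [stairSigns_of_mem (by omega) (by omega)]
        · rwa [stairSigns_of_mem (by omega) (by omega)]
    have hpiece : ∀ {i j}, i + j = m →
        bord i β U ×ˢ bord j ((-1) ^ i * β) V ⊆ bord m β (U ×ˢ V) :=
      fun hij p hp => (mem_bord_prod hU hV).2 ⟨_, _, hij, hp⟩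
    have hsub : bord k α (U ×ˢ V) ⊆ bord m β (U ×ˢ V) := by
      rintro ⟨u, v⟩ h
      obtain ⟨i, j, hij, hu, hv⟩ := (mem_bord_prod hU hV).1 h
      exact (mem_bord_prod hU hV).2 ⟨i + 1, m - (i + 1), by omega,
        hU.bord_subset_bord _ _ (by omega) hu, hV.bord_subset_bord _ _ (by omega) hv⟩
    have hbs : bord m β (U ×ˢ V) ⊆ U ×ˢ V := bord_subset (hU.lower.prod hV.lower)
    apply Set.Subset.antisymm
    -- In higher codimension, a point not obviously in the `k`-boundary has one coordinate of spare
    -- degree. It then lies in a neighbouring product with every choice of signs, and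
    -- `mem_bord_prod_of_forall` applies there.
    · have key : ∀ p : P × Q, p ∈ bord m β (U ×ˢ V) →
          (∀ i j, i + j = m → p ∈ bord i β U ×ˢ bord j ((-1) ^ i * β) V →
            p ∈ bord k α (bord i β U ×ˢ bord j ((-1) ^ i * β) V)) →
          p ∈ bord k α (U ×ˢ V) := by
        rintro ⟨u, v⟩ hp h
        obtain ⟨i, j, hij, hu, hv⟩ := (mem_bord_prod hU hV).1 hp
        rcases mem_bord_prod_cases hU hV (h i j hij ⟨hu, hv⟩) with
          h' | ⟨l, τ, hl, hv'⟩ | ⟨l, σ, hl, hu'⟩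
        · exact h'
        · have hu' : ∀ σ, u ∈ bord (i + 1) σ U := fun σ =>
            hU.bord_subset_bord _ _ (by omega) hu
          have hv' : ∀ τ, v ∈ bord (j - 1) τ V := fun τ =>
            hV.bord_subset_bord _ _ (by omega) hv'
          exact mem_bord_prod_of_forall hU hV (h (i + 1) (j - 1) (by omega) ⟨hu' _, hv' _⟩) hu' hv'
        · have hu' : ∀ σ, u ∈ bord (i - 1) σ U := fun σ =>
            hU.bord_subset_bord _ _ (by omega) hu'
          have hv' : ∀ τ, v ∈ bord (j + 1) τ V := fun τ =>
            hV.bord_subset_bord _ _ (by omega) hv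
          exact mem_bord_prod_of_forall hU hV (h (i - 1) (j + 1) (by omega) ⟨hu' _, hv' _⟩) hu' hv'
      rintro p (⟨q, hq, hpq⟩ | ⟨hp, hd⟩)
      · have hl : IsLowerSet (bord k α (U ×ˢ V)) := by
          rw [bord_prod_eq_stairs hU hV]
          exact isLowerSet_stairs hU hV _ _ _ _
        refine hl hpq (key q hq.1 fun i j hij hq' => ?_)
        exact sbord_subset_bord ⟨hq', hq.2.1, fun t ht => hq.2.2 t (hpiece hij ht)⟩
      · exact key p hp fun i j hij hp' => Or.inr ⟨hp', fun t ht => hd t (hpiece hij ht)⟩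
    · intro p hp
      rcases hp with ⟨q, hq, hpq⟩ | hp'
      · exact Or.inl ⟨q, ⟨hsub (sbord_subset_bord hq), hq.2.1, fun t ht => hq.2.2 t (hbs ht)⟩, hpq⟩
      · exact Or.inr ⟨hsub (Or.inr hp'), fun t ht => hp'.2 t (hbs ht)⟩

lemma isGlobular_Iic_prod (hP : IsRegularDirectedComplex P) (hQ : IsRegularDirectedComplex Q)
    (p : P × Q) : IsGlobular (Set.Iic p) := by
  rw [show p = (p.1, p.2) from rfl, ← Set.Iic_prod_Iic]
  exact (isGlobular_Iic hP _).prod (isGlobular_Iic hQ _)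

end Product

end OGP

namespace OGP

/-! ### Staircases and products of pastings are molecules. -/

section Stairs

variable {P Q : Type*} [PartialOrder P] [OrientedGradedPoset P] [PartialOrder Q]
  [OrientedGradedPoset Q] {U : Set P} {V : Set Q}

lemma stairs_min (ε : ℕ → ℤˣ) (r a b : ℕ) :
    stairs U V ε r a b = stairs U V ε r a (min b r) := by
  ext p
  constructor
  · rintro ⟨i, j, hij, ha, hb, hp⟩
    exact ⟨i, j, hij, ha, by omega, hp⟩
  · rintro ⟨i, j, hij, ha, hb, hp⟩
    exact ⟨i, j, hij, ha, by omega, hp⟩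

lemma stairs_union (ε : ℕ → ℤˣ) (r : ℕ) {a b b' c : ℕ} (hb : b' ≤ b + 1) (ha : a ≤ b')
    (hc : b ≤ c) : stairs U V ε r a b ∪ stairs U V ε r b' c = stairs U V ε r a c := by
  ext p
  constructor
  · rintro (⟨i, j, hij, ha, hb, hp⟩ | ⟨i, j, hij, ha, hb, hp⟩)
    · exact ⟨i, j, hij, ha, by omega, hp⟩
    · exact ⟨i, j, hij, by omega, hb, hp⟩
  · rintro ⟨i, j, hij, ha, hb, hp⟩
    rcases le_or_gt i b with h | h
    · exact Or.inl ⟨i, j, hij, ha, h, hp⟩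
    · exact Or.inr ⟨i, j, hij, by omega, hb, hp⟩

lemma stairs_self (ε : ℕ → ℤˣ) {r i j : ℕ} (h : i + j = r) :
    stairs U V ε r i i = bord i (ε (i + 1)) U ×ˢ bord j ((-1) ^ i * ε i) V := by
  ext p
  constructor
  · rintro ⟨i', j', hij, ha, hb, hp⟩
    obtain rfl : i' = i := by omega
    obtain rfl : j' = j := by omega
    exact hp
  · intro hp
    exact ⟨i, j, h, le_rfl, le_rfl, hp⟩

/-- The two parts of the staircase meet inside step `b` of a staircase of one dimension less. Their
boundaries facing each other are consecutive parts of a single such staircase, with signs `e`, in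
which they are submolecules by `ih`; so `IsSubmolecule.glue` applies. -/
lemma stairs_split (hP : IsRegularDirectedComplex P) (hQ : IsRegularDirectedComplex Q)
    (hU : IsGlobular U) (hV : IsGlobular V) {r : ℕ}
    (ih : ∀ (ε : ℕ → ℤˣ) (a c a' c' : ℕ), a ≤ a' → a' ≤ c' → c' ≤ c → a' ≤ r →
      IsSubmolecule (stairs U V ε r a' c') (stairs U V ε r a c))
    {ε : ℕ → ℤˣ} {a b c : ℕ} (hab : a ≤ b) (hbc : b < c) (hc : c ≤ r + 1)
    (h₁ : IsMolecule (stairs U V ε (r + 1) a b))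
    (h₂ : IsMolecule (stairs U V ε (r + 1) (b + 1) c)) :
    IsSubmolecule (stairs U V ε (r + 1) a b) (stairs U V ε (r + 1) a c) ∧
      IsSubmolecule (stairs U V ε (r + 1) (b + 1) c) (stairs U V ε (r + 1) a c) := by
  obtain ⟨γ, hγ⟩ : ∃ γ, γ = -ε (b + 1) := ⟨_, rfl⟩
  have hγ' : ε (b + 1) = -γ := by rw [hγ, neg_neg]
  set e : ℕ → ℤˣ := fun i =>
    if i ≤ b then stairSigns ε a b γ i else stairSigns ε (b + 1) c (-γ) i with he
  have e₁ : bord r γ (stairs U V ε (r + 1) a b) = stairs U V e r (a - 1) b := by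
    rw [bord_stairs hU hV hab]
    refine stairs_congr fun i _ hi => ?_
    rcases hi.lt_or_eq with hi | rfl
    · rw [he]; simp only; rw [if_pos (by omega)]
    · rw [he]; simp only; rw [if_neg (by omega), stairSigns_of_gt hab (by omega),
        stairSigns_of_mem le_rfl (by omega), hγ']
  have e₂ : bord r (-γ) (stairs U V ε (r + 1) (b + 1) c) = stairs U V e r b c := by
    rw [bord_stairs hU hV (by omega), Nat.add_sub_cancel]
    refine stairs_congr fun i hi _ => ?_
    rcases hi.lt_or_eq with hi | rfl
    · rw [he]; simp only; rw [if_neg (by omega)]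
    · rw [he]; simp only; rw [if_pos le_rfl, stairSigns_of_lt (by omega),
        stairSigns_of_mem hab le_rfl, hγ]
  have hM : stairs U V e r (a - 1) b ∪ stairs U V e r b c = stairs U V e r (a - 1) c :=
    stairs_union _ _ (by omega) (by omega) hbc.le
  have hint : stairs U V ε (r + 1) a b ∩ stairs U V ε (r + 1) (b + 1) c ⊆ stairs U V e r b b := by
    rintro ⟨u, v⟩ ⟨⟨i, j, hij, hai, hib, hu, -⟩, ⟨i', j', hij', hbi', -, -, hv⟩⟩
    refine ⟨b, r - b, by omega, le_rfl, le_rfl, ?_, ?_⟩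
    · rw [he]; simp only; rw [if_neg (by omega), stairSigns_of_mem le_rfl (by omega)]
      refine hU.bord_mono hib (fun h => ?_) hu
      rw [h, hγ']
    · rw [he]; simp only; rw [if_pos le_rfl, stairSigns_of_mem hab le_rfl]
      refine hV.bord_mono (by omega) (fun h => ?_) hv
      obtain rfl : i' = b + 1 := by omega
      rw [hγ', pow_succ]
      simp
  have := IsSubmolecule.glue (isGlobular_Iic_prod hP hQ) (m := r) (γ := γ) h₁ h₂
  rw [e₁, e₂, hM, stairs_union _ _ le_rfl (by omega) hbc.le] at this
  refine this (ih _ _ _ _ _ le_rfl (by omega) hbc.le (by omega))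
    (ih _ _ _ _ _ (by omega) hbc.le le_rfl (by omega)) (hint.trans ?_) (hint.trans ?_)
  · rintro p ⟨i, j, hij, ha, hb, hp⟩
    exact ⟨i, j, hij, by omega, hb, hp⟩
  · rintro p ⟨i, j, hij, ha, hb, hp⟩
    exact ⟨i, j, hij, ha, by omega, hp⟩

/-- By induction on `r`, then on the number of steps, splitting off the first or the last step. The
stronger claim about submolecules is what `stairs_split` needs one dimension below. -/
lemma isSubmolecule_stairs (hP : IsRegularDirectedComplex P) (hQ : IsRegularDirectedComplex Q)
    (hU : IsGlobular U) (hV : IsGlobular V) (r : ℕ)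
    (hT : ∀ i j α β, i + j ≤ r → IsMolecule (bord i α U ×ˢ bord j β V))
    (ε : ℕ → ℤˣ) (a c a' c' : ℕ) (ha : a ≤ a') (hac : a' ≤ c') (hc : c' ≤ c) (hr : a' ≤ r) :
    IsSubmolecule (stairs U V ε r a' c') (stairs U V ε r a c) := by
  induction r generalizing ε a c a' c' with
  | zero =>
    rw [stairs_min _ _ a, stairs_min _ _ a']
    obtain rfl : a' = 0 := by omega
    obtain rfl : a = 0 := by omega
    simp only [min_zero]
    rw [stairs_self ε (add_zero 0)]
    exact .refl (hT _ _ _ _ le_rfl)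
  | succ r ih =>
    replace ih := ih fun i j α β hij => hT i j α β (by omega)
    rw [stairs_min _ _ a c, stairs_min _ _ a' c']
    have hc₁ : min c' (r + 1) ≤ min c (r + 1) := by omega
    have hc₂ : min c (r + 1) ≤ r + 1 := by omega
    have hac' : a' ≤ min c' (r + 1) := by omega
    generalize min c (r + 1) = c at *
    generalize min c' (r + 1) = c' at *
    clear hac hc hr
    obtain ⟨n, hn⟩ : ∃ n, n = c - a := ⟨_, rfl⟩
    induction n using Nat.strong_induction_on generalizing a c a' c' with
    | _ n ihn =>
    subst hn
    rcases (show a ≤ c by omega).lt_or_eq with hlt | rfl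
    · have hmol : ∀ {x y}, a ≤ x → x ≤ y → y ≤ c → y - x < c - a →
          IsMolecule (stairs U V ε (r + 1) x y) := fun {x y} hx hxy hy hlt =>
        (ihn (y - x) hlt x x le_rfl y (by omega) y hxy le_rfl rfl).isMolecule_right
      by_cases haa : a = a'
      · subst haa
        rcases hc₁.lt_or_eq with hcc | rfl
        · refine (ihn (c - 1 - a) (by omega) a a le_rfl (c - 1) (by omega) c' hac' (by omega)
            rfl).trans (stairs_split hP hQ hU hV ih (by omega) (by omega) hc₂
              (hmol le_rfl (by omega) (by omega) (by omega))
              (hmol (by omega) (by omega) (by omega) (by omega))).1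
        · refine .refl (stairs_split hP hQ hU hV ih (b := a) (by omega) (by omega) hc₂
              (hmol le_rfl (by omega) (by omega) (by omega))
              (hmol (by omega) (by omega) (by omega) (by omega))).1.isMolecule_right
      · exact (ihn (c - (a + 1)) (by omega) (a + 1) a' (by omega) c hc₂ c' hac' (by omega)
            rfl).trans (stairs_split hP hQ hU hV ih le_rfl (by omega) hc₂
              (hmol le_rfl (by omega) (by omega) (by omega))
              (hmol (by omega) (by omega) (by omega) (by omega))).2
    · obtain rfl : a' = a := by omega
      obtain rfl : c' = a' := by omega
      rw [stairs_self ε (show c' + (r + 1 - c') = r + 1 by omega)]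
      exact .refl (hT _ _ _ _ (by omega))

lemma isMolecule_stairs (hP : IsRegularDirectedComplex P) (hQ : IsRegularDirectedComplex Q)
    (hU : IsGlobular U) (hV : IsGlobular V) {r : ℕ}
    (hT : ∀ i j α β, i + j ≤ r → IsMolecule (bord i α U ×ˢ bord j β V))
    (ε : ℕ → ℤˣ) {a c : ℕ} (hac : a ≤ c) (hr : a ≤ r) : IsMolecule (stairs U V ε r a c) :=
  (isSubmolecule_stairs hP hQ hU hV r hT ε a c a c le_rfl hac le_rfl hr).isMolecule_right

/-- Below `n` the two sets have the same boundaries, and at `n` both sides are the overlap. Hence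
two staircases with these signs share their steps up to `n`. -/
lemma bord_eq_bord_of_signs {U₁ U₂ : Set P} {n : ℕ} {γ : ℤˣ} (h : IsPasting n γ U₁ U₂)
    {e₁ e₂ : ℕ → ℤˣ} {a i : ℕ} (he : ∀ i, a ≤ i → i ≤ n → e₁ i = e₂ i) (h₁ : e₁ (n + 1) = γ)
    (h₂ : e₂ (n + 1) = -γ) (ha : a ≤ i) (hi : i ≤ n) :
    bord i (e₂ (i + 1)) U₂ = bord i (e₁ (i + 1)) U₁ := by
  rcases hi.lt_or_eq with hi | rfl
  · rw [← he _ (by omega) (by omega), h.bord_eq_of_lt hi]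
  · rw [h₁, h₂, ← h.inter_left, ← h.inter_right]

/-- The two staircases coincide on the steps from `a` to `n`, so their union is the first one with
the later steps of the second glued on. The boundaries involved again form such a pair one dimension
lower; the induction hypothesis is used in both orders. -/
lemma isSubmolecule_double_stairs (hP : IsRegularDirectedComplex P)
    (hQ : IsRegularDirectedComplex Q) (hV : IsGlobular V) {n : ℕ} (r : ℕ) (hn : n ≤ r)
    {U₁ U₂ : Set P} {γ : ℤˣ} (h : IsPasting n γ U₁ U₂)
    (hT₁ : ∀ i j α β, i + j ≤ r → IsMolecule (bord i α U₁ ×ˢ bord j β V))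
    (hT₂ : ∀ i j α β, i + j ≤ r → IsMolecule (bord i α U₂ ×ˢ bord j β V))
    {ε₁ ε₂ : ℕ → ℤˣ} {a b₁ b₂ : ℕ} (ha : a ≤ n) (hb₁ : n ≤ b₁) (hb₂ : n ≤ b₂)
    (hε : ∀ i, a ≤ i → i ≤ n → ε₁ i = ε₂ i) (hε₁ : ε₁ (n + 1) = γ) (hε₂ : ε₂ (n + 1) = -γ) :
    IsSubmolecule (stairs U₁ V ε₁ r a b₁) (stairs U₁ V ε₁ r a b₁ ∪ stairs U₂ V ε₂ r a b₂) := by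
  induction r generalizing U₁ U₂ γ ε₁ ε₂ a b₁ b₂ with
  | zero =>
    rw [Set.union_eq_left.2]
    · exact .refl (isMolecule_stairs hP hQ h.left hV hT₁ _ (by omega) (by omega))
    · rintro p ⟨i, j, hij, hai, hib, hp, hp'⟩
      rw [bord_eq_bord_of_signs h hε hε₁ hε₂ hai (by omega)] at hp
      rw [← hε i hai (by omega)] at hp'
      exact ⟨i, j, hij, hai, by omega, hp, hp'⟩
  | succ r ih =>
    have hS := isMolecule_stairs hP hQ h.left hV hT₁ ε₁ (a := a) (c := b₁) (by omega) (by omega)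
    by_cases hdeg : b₂ = n ∨ r + 1 = n
    -- Here the second staircase has no step beyond `n`.
    · rw [Set.union_eq_left.2]
      · exact .refl hS
      · rintro p ⟨i, j, hij, hai, hib, hp, hp'⟩
        rw [bord_eq_bord_of_signs h hε hε₁ hε₂ hai (by omega)] at hp
        rw [← hε i hai (by omega)] at hp'
        exact ⟨i, j, hij, hai, by omega, hp, hp'⟩
    push Not at hdeg
    have hT := isMolecule_stairs hP hQ h.right hV hT₂ ε₂ (a := n + 1) (c := b₂) (by omega)
      (by omega)
    have hun : stairs U₁ V ε₁ (r + 1) a b₁ ∪ stairs U₂ V ε₂ (r + 1) a b₂ =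
        stairs U₁ V ε₁ (r + 1) a b₁ ∪ stairs U₂ V ε₂ (r + 1) (n + 1) b₂ := by
      apply Set.Subset.antisymm
      · refine Set.union_subset Set.subset_union_left ?_
        rintro p ⟨i, j, hij, hai, hib, hp, hp'⟩
        rcases le_or_gt i n with hi | hi
        · rw [bord_eq_bord_of_signs h hε hε₁ hε₂ hai hi] at hp
          rw [← hε i hai hi] at hp'
          exact Or.inl ⟨i, j, hij, hai, by omega, hp, hp'⟩
        · exact Or.inr ⟨i, j, hij, hi, hib, hp, hp'⟩
      · refine Set.union_subset_union_right _ ?_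
        rintro p ⟨i, j, hij, hai, hib, hp⟩
        exact ⟨i, j, hij, by omega, hib, hp⟩
    set e₁ : ℕ → ℤˣ := stairSigns ε₁ a b₁ γ with he₁
    set e₂ : ℕ → ℤˣ := fun i =>
      if i ≤ n then e₁ i else stairSigns ε₂ (n + 1) b₂ (-γ) i with he₂
    have he₁n : e₁ n = γ := stairSigns_of_mem ha hb₁
    have he₁n' : e₁ (n + 1) = γ := by
      rcases hb₁.lt_or_eq with hb | rfl
      · exact stairSigns_of_mem (by omega) hb
      · rw [he₁, stairSigns_of_gt (by omega) (by omega), hε₁]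
    have he₂n : e₂ n = γ := by rw [he₂]; simp only; rw [if_pos le_rfl, he₁n]
    have he₂n' : e₂ (n + 1) = -γ := by
      rw [he₂]; simp only; rw [if_neg (by omega), stairSigns_of_mem le_rfl (by omega)]
    have hee : ∀ i, a - 1 ≤ i → i ≤ n → e₁ i = e₂ i := fun i _ hi => by
      rw [he₂]; simp only; rw [if_pos hi]
    have bS : bord r γ (stairs U₁ V ε₁ (r + 1) a b₁) = stairs U₁ V e₁ r (a - 1) b₁ :=
      bord_stairs h.left hV (by omega)
    have bT : bord r (-γ) (stairs U₂ V ε₂ (r + 1) (n + 1) b₂) = stairs U₂ V e₂ r n b₂ := by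
      rw [bord_stairs h.right hV (by omega), Nat.add_sub_cancel]
      refine stairs_congr fun i hi _ => ?_
      rcases hi.lt_or_eq with hi | rfl
      · rw [he₂]; simp only; rw [if_neg (by omega)]
      · rw [he₂n, stairSigns_of_lt (by omega), hε₂, neg_neg]
    have hM : stairs U₁ V e₁ r (a - 1) b₁ ∪ stairs U₂ V e₂ r n b₂ =
        stairs U₁ V e₁ r (a - 1) b₁ ∪ stairs U₂ V e₂ r (a - 1) b₂ := by
      apply Set.Subset.antisymm
      · refine Set.union_subset_union_right _ ?_
        rintro p ⟨i, j, hij, hai, hib, hp⟩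
        exact ⟨i, j, hij, by omega, hib, hp⟩
      · refine Set.union_subset Set.subset_union_left ?_
        rintro p ⟨i, j, hij, hai, hib, hp, hp'⟩
        rcases le_or_gt i n with hi | hi
        · rw [bord_eq_bord_of_signs h hee he₁n' he₂n' hai hi] at hp
          rw [← hee i hai hi] at hp'
          exact Or.inl ⟨i, j, hij, hai, by omega, hp, hp'⟩
        · exact Or.inr ⟨i, j, hij, hi.le, hib, hp, hp'⟩
    have hT₁' : ∀ i j α β, i + j ≤ r → IsMolecule (bord i α U₁ ×ˢ bord j β V) :=
      fun i j α β hij => hT₁ i j α β (by omega)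
    have hT₂' : ∀ i j α β, i + j ≤ r → IsMolecule (bord i α U₂ ×ˢ bord j β V) :=
      fun i j α β hij => hT₂ i j α β (by omega)
    have sub₁ := ih (by omega) h hT₁' hT₂' (a := a - 1) (by omega) hb₁ hb₂ hee he₁n' he₂n'
    have sub₂ := ih (by omega) h.symm hT₂' hT₁' (a := a - 1) (by omega) hb₂ hb₁
      (fun i h₁ h₂ => (hee i h₁ h₂).symm) he₂n' (by rw [he₁n', neg_neg])
    have hv : ∀ {p}, p ∈ stairs U₂ V ε₂ (r + 1) (n + 1) b₂ →
        p.2 ∈ bord (r - n) ((-1) ^ n * γ) V := by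
      rintro p ⟨i, j, hij, hai, -, -, hp⟩
      refine hV.bord_mono (by omega) (fun hj => ?_) hp
      obtain rfl : i = n + 1 := by omega
      rw [hε₂, pow_succ]
      simp
    have hu : ∀ {p}, p ∈ stairs U₁ V ε₁ (r + 1) a b₁ → p ∈ stairs U₂ V ε₂ (r + 1) (n + 1) b₂ →
        p.1 ∈ U₁ ∩ U₂ := by
      rintro p ⟨i, j, -, -, -, hp, -⟩ ⟨i', j', -, -, -, hp', -⟩
      exact ⟨bord_subset h.left.lower hp, bord_subset h.right.lower hp'⟩
    have := IsSubmolecule.glue (isGlobular_Iic_prod hP hQ) (m := r) (γ := γ) hS hT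
    rw [bS, bT, hM] at this
    rw [hun]
    refine (this sub₁ ?_ ?_ ?_).1
    · rw [Set.union_comm]
      exact (isSubmolecule_stairs hP hQ h.right hV r hT₂' _ _ _ _ _ (by omega) hb₂ le_rfl
        (by omega)).trans sub₂
    · rintro p ⟨hp, hp'⟩
      refine ⟨n, r - n, by omega, by omega, hb₁, ?_, ?_⟩
      · rw [he₁n', ← h.inter_left]
        exact hu hp hp'
      · rw [he₁n]
        exact hv hp'
    · rintro p ⟨hp, hp'⟩
      refine ⟨n, r - n, by omega, by omega, hb₂, ?_, ?_⟩
      · rw [he₂n', ← h.inter_right]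
        exact hu hp hp'
      · rw [he₂n]
        exact hv hp'

/-- Steps before `n` are absorbed by step `n`, where the `V`-side is already all of `V`. The signs
up to `n` are therefore free, and can be matched with those of the other staircase. -/
lemma bord_prod_eq_stairs_of_dimLE (hU : IsGlobular U) (hV : IsGlobular V) {n q : ℕ}
    (hq : DimLE q V) {α : ℤˣ} {ε : ℕ → ℤˣ} (hε : ∀ i, n < i → ε i = α) :
    bord (n + q) α (U ×ˢ V) = stairs U V ε (n + q) n (n + q) := by
  ext ⟨u, v⟩
  rw [mem_bord_prod hU hV]
  constructor
  · rintro ⟨i, j, hij, hu, hv⟩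
    rcases lt_or_ge n i with hi | hi
    · refine ⟨i, j, hij, hi.le, by omega, ?_, ?_⟩
      · rwa [hε _ (by omega)]
      · rwa [hε _ (by omega)]
    · refine ⟨n, q, rfl, le_rfl, by omega, ?_, ?_⟩
      · rw [hε _ (by omega)]
        exact hU.bord_mono hi (fun _ => rfl) hu
      · rw [bord_eq_self hV.lower hq]
        exact bord_subset hV.lower hv
  · rintro ⟨i, j, hij, hi, -, hu, hv⟩
    rw [hε _ (by omega)] at hu
    refine ⟨i, j, hij, hu, ?_⟩
    rcases hi.lt_or_eq with hi | rfl
    · rwa [hε _ (by omega)] at hv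
    · obtain rfl : j = q := by omega
      rw [bord_eq_self hV.lower hq] at hv ⊢
      exact hv

/-- The products meet in `(U₁ ∩ U₂) × V`, which is only part of their `(n + q)`-boundaries. These
boundaries are staircases sharing step `n`, so `isSubmolecule_double_stairs` supplies the hypotheses
of `IsSubmolecule.glue`. -/
lemma isMolecule_prod_of_isPasting (hP : IsRegularDirectedComplex P)
    (hQ : IsRegularDirectedComplex Q) (hV : IsGlobular V) {n q : ℕ} (hq : DimLE q V)
    {U₁ U₂ : Set P} {γ : ℤˣ} (h : IsPasting n γ U₁ U₂)
    (hT₁ : ∀ i j α β, i + j ≤ n + q → IsMolecule (bord i α U₁ ×ˢ bord j β V))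
    (hT₂ : ∀ i j α β, i + j ≤ n + q → IsMolecule (bord i α U₂ ×ˢ bord j β V))
    (h₁ : IsMolecule (U₁ ×ˢ V)) (h₂ : IsMolecule (U₂ ×ˢ V)) :
    IsMolecule ((U₁ ∪ U₂) ×ˢ V) := by
  have b₁ : bord (n + q) γ (U₁ ×ˢ V) = stairs U₁ V (fun _ => γ) (n + q) n (n + q) :=
    bord_prod_eq_stairs_of_dimLE h.left hV hq fun _ _ => rfl
  have b₂ : bord (n + q) (-γ) (U₂ ×ˢ V) =
      stairs U₂ V (fun i => if i ≤ n then γ else -γ) (n + q) n (n + q) :=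
    bord_prod_eq_stairs_of_dimLE h.right hV hq fun _ hi => if_neg (by omega)
  have s₁ := isSubmolecule_double_stairs hP hQ hV (n + q) (by omega) h hT₁ hT₂ (a := n)
    (b₁ := n + q) (b₂ := n + q) (ε₁ := fun _ => γ) (ε₂ := fun i => if i ≤ n then γ else -γ)
    le_rfl (by omega) (by omega) (fun i _ hi => (if_pos hi).symm) rfl (if_neg (by omega))
  have s₂ := isSubmolecule_double_stairs hP hQ hV (n + q) (by omega) h.symm hT₂ hT₁ (a := n)
    (b₁ := n + q) (b₂ := n + q) (ε₂ := fun _ => γ) (ε₁ := fun i => if i ≤ n then γ else -γ)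
    le_rfl (by omega) (by omega) (fun i _ hi => if_pos hi) (if_neg (by omega)) (neg_neg γ).symm
  rw [Set.union_comm] at s₂
  rw [← b₁, ← b₂] at s₁ s₂
  rw [Set.union_prod]
  have hint : U₁ ×ˢ V ∩ U₂ ×ˢ V = (U₁ ∩ U₂) ×ˢ V := by rw [Set.prod_inter_prod, Set.inter_self]
  refine (IsSubmolecule.glue (isGlobular_Iic_prod hP hQ) h₁ h₂ s₁ s₂ ?_ ?_).1.isMolecule_right
  · rw [hint, h.inter_left]
    rintro p ⟨hu, hv⟩
    refine (mem_bord_prod h.left hV).2 ⟨n, q, rfl, hu, ?_⟩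
    rwa [bord_eq_self hV.lower hq]
  · rw [hint, h.inter_right]
    rintro p ⟨hu, hv⟩
    refine (mem_bord_prod h.right hV).2 ⟨n, q, rfl, hu, ?_⟩
    rwa [bord_eq_self hV.lower hq]

lemma isMolecule_prod_of_forall_atom (hP : IsRegularDirectedComplex P)
    (hQ : IsRegularDirectedComplex Q) {d p q : ℕ}
    (hlow : ∀ (U : Set P) (V : Set Q) (k l : ℕ), IsMolecule U → IsMolecule V → DimLE k U →
      DimLE l V → k + l < d → IsMolecule (U ×ˢ V))
    (hU : IsMolecule U) (hV : IsMolecule V) (hp : DimLE p U) (hq : DimLE q V) (hd : p + q ≤ d)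
    (hat : ∀ x ∈ U, IsMolecule (Set.Iic x ×ˢ V)) : IsMolecule (U ×ˢ V) := by
  have hGP := isGlobular_Iic hP
  have hVG := hV.isGlobular (isGlobular_Iic hQ)
  induction hU with
  | atom x => exact hat x le_rfl
  | paste U₁ U₂ n h₁ h₂ ne₁ ne₂ hout hin ih₁ ih₂ =>
    have d₁ : DimLE p U₁ := fun x hx => hp x (Or.inl hx)
    have d₂ : DimLE p U₂ := fun x hx => hp x (Or.inr hx)
    have hn : n < p := by
      by_contra! hn
      rw [bord_eq_self h₁.lower (d₁.mono hn)] at hout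
      rw [Set.union_eq_right.2 (Set.inter_eq_left.1 hout)] at ne₂
      exact ne₂.ne rfl
    refine isMolecule_prod_of_isPasting hP hQ hVG hq (γ := 1)
      ⟨h₁.isGlobular hGP, h₂.isGlobular hGP, hout, hin⟩ (fun i j α β hij => ?_)
      (fun i j α β hij => ?_) (ih₁ d₁ fun x hx => hat x (Or.inl hx))
      (ih₂ d₂ fun x hx => hat x (Or.inr hx))
    · exact hlow _ _ i j (h₁.bord hP _ _) (hV.bord hQ _ _) dimLE_bord dimLE_bord (by omega)
    · exact hlow _ _ i j (h₂.bord hP _ _) (hV.bord hQ _ _) dimLE_bord dimLE_bord (by omega)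

end Stairs

end OGP

namespace OGP

/-! ### Closed embeddings up to sign, and odd duals. -/

section Embedding

variable {P Q : Type*} [PartialOrder P] [OrientedGradedPoset P] [PartialOrder Q]
  [OrientedGradedPoset Q]

/-- Order embeddings with closed image that preserve dimensions, and preserve or reverse
orientations depending on the dimension. -/
structure IsSignedEmbedding (s : ℕ → ℤˣ) (f : P → Q) : Prop where
  le_iff : ∀ {x y}, f x ≤ f y ↔ x ≤ y
  lower : IsLowerSet (Set.range f)
  dim_map : ∀ x, dim (f x) = dim x
  orient_map : ∀ {x y} (h : x ⋖ y) (h' : f x ⋖ f y), orient h' = s (dim x) * orient h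

namespace IsSignedEmbedding

variable {s : ℕ → ℤˣ} {f : P → Q} (hf : IsSignedEmbedding s f)
include hf

lemma injective : Function.Injective f := fun _ _ h =>
  le_antisymm (hf.le_iff.1 h.le) (hf.le_iff.1 h.ge)

lemma covBy_iff {x y : P} : f x ⋖ f y ↔ x ⋖ y := by
  have hlt : ∀ {x y}, f x < f y ↔ x < y := fun {x y} => by
    rw [lt_iff_le_not_ge, lt_iff_le_not_ge, hf.le_iff, hf.le_iff]
  constructor
  · exact fun h => ⟨hlt.1 h.1, fun z h₁ h₂ => h.2 (hlt.2 h₁) (hlt.2 h₂)⟩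
  · refine fun h => ⟨hlt.2 h.1, fun z h₁ h₂ => ?_⟩
    obtain ⟨z, rfl⟩ := hf.lower h₂.le ⟨y, rfl⟩
    exact h.2 (hlt.1 h₁) (hlt.1 h₂)

lemma image_Iic (x : P) : f '' Set.Iic x = Set.Iic (f x) := by
  ext y
  constructor
  · rintro ⟨z, hz, rfl⟩
    exact hf.le_iff.2 hz
  · intro hy
    obtain ⟨z, rfl⟩ := hf.lower hy ⟨x, rfl⟩
    exact ⟨z, hf.le_iff.1 hy, rfl⟩

lemma map_mem_sbord_iff {n : ℕ} {α : ℤˣ} {U : Set P} {x : P} :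
    f x ∈ sbord n (s n * α) (f '' U) ↔ x ∈ sbord n α U := by
  constructor
  · rintro ⟨⟨x', hx', hxx'⟩, hd, hc⟩
    obtain rfl := hf.injective hxx'
    have hd' := hd
    rw [hf.dim_map] at hd
    refine ⟨hx', hd, fun y hy h => ?_⟩
    have := hc (f y) ⟨y, hy, rfl⟩ (hf.covBy_iff.2 h)
    rw [hf.orient_map h, hd] at this
    exact mul_left_cancel this
  · rintro ⟨hx, hd, hc⟩
    refine ⟨⟨x, hx, rfl⟩, by rw [hf.dim_map, hd], ?_⟩
    rintro _ ⟨y, hy, rfl⟩ h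
    rw [hf.orient_map (hf.covBy_iff.1 h) h, hc y hy, hd]

lemma bord_image (n : ℕ) (α : ℤˣ) (U : Set P) :
    bord n (s n * α) (f '' U) = f '' bord n α U := by
  ext z
  constructor
  · rintro (⟨y, hy, hzy⟩ | ⟨hz, hd⟩)
    · obtain ⟨x, hx, rfl⟩ := hy.1
      obtain ⟨z, rfl⟩ := hf.lower hzy ⟨x, rfl⟩
      exact ⟨z, Or.inl ⟨x, hf.map_mem_sbord_iff.1 hy, hf.le_iff.1 hzy⟩, rfl⟩
    · obtain ⟨z, hz, rfl⟩ := hz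
      refine ⟨z, Or.inr ⟨hz, fun y hy hzy => ?_⟩, rfl⟩
      rw [← hf.dim_map]
      exact hd _ ⟨y, hy, rfl⟩ (hf.le_iff.2 hzy)
  · rintro ⟨z, ⟨y, hy, hzy⟩ | ⟨hz, hd⟩, rfl⟩
    · exact Or.inl ⟨f y, hf.map_mem_sbord_iff.2 hy, hf.le_iff.2 hzy⟩
    · refine Or.inr ⟨⟨z, hz, rfl⟩, ?_⟩
      rintro _ ⟨y, hy, rfl⟩ hzy
      rw [hf.dim_map]
      exact hd y hy (hf.le_iff.1 hzy)

/-- A negative sign `s n` merely exchanges the roles of the two parts of an `n`-pasting, which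
`paste_of_inter` permits. -/
lemma isMolecule_image {U : Set P} (h : IsMolecule U) : IsMolecule (f '' U) := by
  induction h with
  | atom x =>
    rw [hf.image_Iic]
    exact .atom _
  | paste U₁ U₂ n _ _ _ _ hout hin ih₁ ih₂ =>
    rw [Set.image_union]
    refine ih₁.paste_of_inter (n := n) (γ := s n) ih₂ ?_ ?_
    · rw [← Set.image_inter hf.injective, hout, ← hf.bord_image, mul_one]
    · rw [← Set.image_inter hf.injective, hin, ← hf.bord_image, mul_neg_one]

lemma isMolecule_preimage {V : Set Q} (h : IsMolecule V) (hV : V ⊆ Set.range f) :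
    IsMolecule (f ⁻¹' V) := by
  induction h with
  | atom x =>
    obtain ⟨x, rfl⟩ := hV (Set.mem_Iic.2 le_rfl)
    rw [← hf.image_Iic, Set.preimage_image_eq _ hf.injective]
    exact .atom _
  | paste V₁ V₂ n _ _ _ _ hout hin ih₁ ih₂ =>
    have r₁ := Set.subset_union_left.trans hV
    have r₂ := Set.subset_union_right.trans hV
    have key : ∀ {W : Set Q} {α}, W ⊆ Set.range f →
        f ⁻¹' bord n (s n * α) W = bord n α (f ⁻¹' W) := fun {W α} hW => by
      conv_lhs => rw [← Set.image_preimage_eq_of_subset hW, hf.bord_image,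
        Set.preimage_image_eq _ hf.injective]
    have hs : s n * s n = 1 := Int.units_mul_self _
    rw [Set.preimage_union]
    refine (ih₁ r₁).paste_of_inter (n := n) (γ := s n) (ih₂ r₂) ?_ ?_
    · rw [← Set.preimage_inter, hout, ← key r₁, hs]
    · rw [← Set.preimage_inter, hin, ← key r₂, mul_neg, hs]

lemma preimage_bord_Iic (n : ℕ) (α : ℤˣ) (x : P) :
    f ⁻¹' bord n (s n * α) (Set.Iic (f x)) = bord n α (Set.Iic x) := by
  rw [← hf.image_Iic, hf.bord_image, Set.preimage_image_eq _ hf.injective]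

lemma isRegularDirectedComplex (hQ : IsRegularDirectedComplex Q) :
    IsRegularDirectedComplex P where
  spherical x k hk := by
    have h := hQ.spherical (f x) k (by rwa [hf.dim_map])
    have hp : ∀ m, f ⁻¹' (bord m 1 (Set.Iic (f x))) = bord m (s m) (Set.Iic x) ∧
        f ⁻¹' (bord m (-1) (Set.Iic (f x))) = bord m (-(s m)) (Set.Iic x) := fun m => by
      rw [← hf.preimage_bord_Iic, ← hf.preimage_bord_Iic, Int.units_mul_self, mul_neg,
        Int.units_mul_self]
      exact ⟨rfl, rfl⟩
    have h' : bord k 1 (Set.Iic x) ∩ bord k (-1) (Set.Iic x) =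
        f ⁻¹' (bord k 1 (Set.Iic (f x)) ∩ bord k (-1) (Set.Iic (f x))) := by
      rw [Set.preimage_inter, (hp k).1, (hp k).2]
      rcases Int.units_eq_one_or (s k) with hs | hs <;> rw [hs]
      rw [neg_neg, Set.inter_comm]
    rw [h', h]
    ext w
    refine exists_congr fun m => and_congr_right fun _ => ?_
    change w ∈ f ⁻¹' bord m 1 (Set.Iic (f x)) ∨ w ∈ f ⁻¹' bord m (-1) (Set.Iic (f x)) ↔ _
    rw [(hp m).1, (hp m).2]
    rcases Int.units_eq_one_or (s m) with hs | hs <;> rw [hs]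
    rw [neg_neg, or_comm]
  molecule x α n hd := by
    rw [← hf.preimage_bord_Iic]
    refine hf.isMolecule_preimage (hQ.molecule _ _ _ (by rwa [hf.dim_map])) ?_
    rw [← hf.image_Iic]
    exact (bord_subset (by rw [hf.image_Iic]; exact isLowerSet_Iic _)).trans
      (Set.image_subset_range _ _)
  globular x α β n hd := by
    apply hf.injective.image_injective
    rw [← hf.bord_image, ← hf.bord_image, ← hf.bord_image, hf.image_Iic]
    exact hQ.globular _ _ _ _ (by rwa [hf.dim_map])

end IsSignedEmbedding

end Embedding

/-- The dual of an oriented graded poset that reverses the orientation of edges `y → x` with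
`dim y` odd. -/
def OddDual (P : Type*) : Type _ := P

namespace OddDual

variable {P Q : Type*} [PartialOrder P] [OrientedGradedPoset P] [PartialOrder Q]
  [OrientedGradedPoset Q]

instance : PartialOrder (OddDual P) := inferInstanceAs (PartialOrder P)

instance : OrientedGradedPoset (OddDual P) where
  toGradeMinOrder := inferInstanceAs (GradeMinOrder ℕ P)
  orient _ y h := (-1) ^ dim (P := P) y * OGP.orient (P := P) h

/-- The identity function to the dual. -/
def of : P → OddDual P := fun x => x

/-- The identity function from the dual. -/
def undo : OddDual P → P := fun x => x

lemma dim_of (x : P) : dim (of x) = dim x := rfl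

lemma orient_of {x y : P} (h : x ⋖ y) (h' : of x ⋖ of y) :
    orient h' = (-1) ^ dim y * orient h := rfl

/-- The exponent is `n + 1` because `n` is the dimension of the lower end of the edge, while the
dual looks at the upper end. -/
lemma isSignedEmbedding_of :
    IsSignedEmbedding (fun n => (-1) ^ (n + 1)) (of : P → OddDual P) where
  le_iff := Iff.rfl
  lower := by
    rintro x y _ _
    exact ⟨undo y, rfl⟩
  dim_map _ := rfl
  orient_map h h' := by rw [orient_of h h', dim_covBy h]

lemma isSignedEmbedding_undo :
    IsSignedEmbedding (fun n => (-1) ^ (n + 1)) (undo : OddDual P → P) where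
  le_iff := Iff.rfl
  lower := by
    rintro x y _ _
    exact ⟨of y, rfl⟩
  dim_map _ := rfl
  orient_map {x y} h h' := by
    have e := orient_of (x := undo x) (y := undo y) h' h
    rw [show orient h = _ from e, dim_covBy h', show dim x = dim (undo x) from rfl, sign_mul_sign]

lemma isRegularDirectedComplex (hP : IsRegularDirectedComplex P) :
    IsRegularDirectedComplex (OddDual P) :=
  isSignedEmbedding_undo.isRegularDirectedComplex hP

/-- The duality isomorphism between `P ⊠ Q` and the Gray product of the duals in the opposite
order. -/
def swap (p : P × Q) : OddDual Q × OddDual P := (of p.2, of p.1)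

lemma isSignedEmbedding_swap :
    IsSignedEmbedding (fun n => (-1) ^ (n + 1)) (swap : P × Q → OddDual Q × OddDual P) where
  le_iff := and_comm
  lower := by
    rintro x y _ _
    exact ⟨(undo y.2, undo y.1), rfl⟩
  dim_map p := add_comm _ _
  orient_map := by
    rintro ⟨x, y⟩ ⟨x', y'⟩ h h'
    rcases Prod.mk_covBy_mk_iff.1 h with ⟨c, rfl⟩ | ⟨c, rfl⟩
    · rw [orient_prod_left c]
      change orient (covBy_prod_mk_right (of y) (show of x ⋖ of x' from c)) = _
      rw [orient_prod_right (show of x ⋖ of x' from c), orient_of c, dim_covBy c, dim_prod,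
        ← mul_assoc, ← pow_add]
      congr 2
      rw [dim_of]
      ring
    · rw [orient_prod_right c]
      change orient (covBy_prod_mk_left (show of y ⋖ of y' from c) (of x)) = _
      rw [orient_prod_left (show of y ⋖ of y' from c), orient_of c, dim_covBy c, dim_prod,
        ← mul_assoc, ← pow_add]
      congr 1
      rw [show dim (x, y).1 + dim (x, y).2 + 1 + dim x = 2 * dim x + (dim y + 1) by
        simp only; ring, pow_add _ (2 * dim x), pow_mul]
      simp

end OddDual

/-! ### Products of molecules and of regular directed complexes. -/

section Product

variable {P Q : Type*} [PartialOrder P] [OrientedGradedPoset P] [PartialOrder Q]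
  [OrientedGradedPoset Q]

/-- The first factor is reduced to an atom; the odd dual then exchanges the factors, the other one
is reduced in the same way, and a product of two atoms is an atom. Both reductions use products of
smaller total dimension. -/
lemma isMolecule_prod_of_dimLE (hP : IsRegularDirectedComplex P) (hQ : IsRegularDirectedComplex Q)
    (d : ℕ) : ∀ (U : Set P) (V : Set Q) (p q : ℕ), IsMolecule U → IsMolecule V → DimLE p U →
      DimLE q V → p + q ≤ d → IsMolecule (U ×ˢ V) := by
  induction d using Nat.strong_induction_on with
  | _ d ih =>
  intro U V p q hU hV hp hq hd
  refine isMolecule_prod_of_forall_atom hP hQ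
    (fun U' V' k l hU' hV' hk hl hkl => ih _ hkl U' V' k l hU' hV' hk hl le_rfl)
    hU hV hp hq hd fun x hx => ?_
  have key : IsMolecule ((OddDual.of '' V) ×ˢ (OddDual.of '' Set.Iic x)) := by
    refine isMolecule_prod_of_forall_atom (OddDual.isRegularDirectedComplex hQ)
      (OddDual.isRegularDirectedComplex hP) (d := d) (p := q) (q := dim x) ?_
      (OddDual.isSignedEmbedding_of.isMolecule_image hV)
      (OddDual.isSignedEmbedding_of.isMolecule_image (.atom x)) ?_ ?_
      (by have := hp x hx; omega) ?_
    · intro V' U' k l hV' hU' hk hl hkl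
      have h := OddDual.isSignedEmbedding_swap.isMolecule_image (ih (l + k) (by omega)
        (OddDual.of ⁻¹' U') (OddDual.of ⁻¹' V') l k
        (OddDual.isSignedEmbedding_of.isMolecule_preimage hU' fun z _ => ⟨OddDual.undo z, rfl⟩)
        (OddDual.isSignedEmbedding_of.isMolecule_preimage hV' fun z _ => ⟨OddDual.undo z, rfl⟩)
        (fun z hz => hl _ hz) (fun z hz => hk _ hz) le_rfl)
      convert h using 1
      ext z
      constructor
      · rintro ⟨h₁, h₂⟩
        exact ⟨(OddDual.undo z.2, OddDual.undo z.1), ⟨h₂, h₁⟩, rfl⟩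
      · rintro ⟨w, ⟨h₁, h₂⟩, rfl⟩
        exact ⟨h₂, h₁⟩
    · rintro _ ⟨v, hv, rfl⟩
      exact hq v hv
    · rintro _ ⟨v, hv, rfl⟩
      exact dim_mono hv
    · intro y _
      rw [OddDual.isSignedEmbedding_of.image_Iic, Set.Iic_prod_Iic]
      exact .atom _
  have h := OddDual.isSignedEmbedding_swap.isMolecule_preimage (P := P × Q) key
    fun z _ => ⟨(OddDual.undo z.2, OddDual.undo z.1), rfl⟩
  convert h using 1
  ext ⟨a, b⟩
  constructor
  · rintro ⟨h₁, h₂⟩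
    exact ⟨⟨b, h₂, rfl⟩, ⟨a, h₁, rfl⟩⟩
  · rintro ⟨⟨b', h₂, hb⟩, ⟨a', h₁, ha⟩⟩
    obtain rfl : b' = b := hb
    obtain rfl : a' = a := ha
    exact ⟨h₁, h₂⟩

lemma IsMolecule.prod (hP : IsRegularDirectedComplex P) (hQ : IsRegularDirectedComplex Q)
    {U : Set P} {V : Set Q} (hU : IsMolecule U) (hV : IsMolecule V) : IsMolecule (U ×ˢ V) := by
  obtain ⟨p, hp⟩ := hU.exists_dimLE
  obtain ⟨q, hq⟩ := hV.exists_dimLE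
  exact isMolecule_prod_of_dimLE hP hQ _ U V p q hU hV hp hq le_rfl

lemma mem_bord_Iic_prod (hP : IsRegularDirectedComplex P) (hQ : IsRegularDirectedComplex Q)
    {n : ℕ} {α : ℤˣ} {p q : P × Q} :
    p ∈ bord n α (Set.Iic q) ↔ ∃ i j, i + j = n ∧ p.1 ∈ bord i α (Set.Iic q.1) ∧
      p.2 ∈ bord j ((-1) ^ i * α) (Set.Iic q.2) := by
  rw [show q = (q.1, q.2) from rfl, ← Set.Iic_prod_Iic]
  exact mem_bord_prod (isGlobular_Iic hP _) (isGlobular_Iic hQ _)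

/-- Gray products of regular directed complexes are regular directed complexes. -/
theorem IsRegularDirectedComplex.prod (hP : IsRegularDirectedComplex P)
    (hQ : IsRegularDirectedComplex Q) : IsRegularDirectedComplex (P × Q) where
  spherical := by
    rintro ⟨x, y⟩ k hk
    have gx := isGlobular_Iic hP x
    have gy := isGlobular_Iic hQ y
    apply Set.Subset.antisymm
    · rintro ⟨u, v⟩ ⟨h₁, h₂⟩
      obtain ⟨i, j, hij, hu, hv⟩ := (mem_bord_Iic_prod hP hQ).1 h₁
      obtain ⟨i', j', hij', hu', hv'⟩ := (mem_bord_Iic_prod hP hQ).1 h₂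
      simp only at hu hv hu' hv'
      have mem : ∀ {m σ}, m + 1 = k → (u, v) ∈ bord m σ (Set.Iic (x, y)) →
          (u, v) ∈ bordPred k (Set.Iic (x, y)) := fun {m σ} hm h => by
        rcases Int.units_eq_one_or σ with rfl | rfl
        · exact ⟨m, hm, Or.inl h⟩
        · exact ⟨m, hm, Or.inr h⟩
      -- If the degrees differ, the smaller degree of each coordinate gives a total of at most `k -
      -- 1`. If they agree, both coordinates lie in boundaries of both signs, and sphericity in one
      -- factor lowers a degree.
      rcases lt_trichotomy i i' with hi | rfl | hi
      · refine mem (m := k - 1) (σ := 1) (by omega) ((mem_bord_Iic_prod hP hQ).2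
          ⟨i, k - 1 - i, by omega, hu, gy.bord_mono (by omega) (fun h => ?_) hv'⟩)
        obtain rfl : i' = i + 1 := by omega
        rw [pow_succ]
        simp
      · obtain rfl : j' = j := by omega
        have hu'' : ∀ σ, u ∈ bord i σ (Set.Iic x) := fun σ => by
          rcases Int.units_eq_one_or σ with rfl | rfl <;> assumption
        have hv'' : ∀ σ, v ∈ bord j' σ (Set.Iic y) := fun σ => by
          rcases sign_eq_or_eq_neg σ ((-1) ^ i * 1) with rfl | rfl
          · exact hv
          · rwa [← mul_neg]
        rcases lt_or_ge i (dim x) with hix | hix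
        · have h := (hP.spherical x i hix).subset ⟨hu'' 1, hu'' (-1)⟩
          obtain ⟨m, σ, rfl, hm⟩ : ∃ m σ, m + 1 = i ∧ u ∈ bord m σ (Set.Iic x) := by
            obtain ⟨m, hm, h | h⟩ := h
            exacts [⟨m, _, hm, h⟩, ⟨m, _, hm, h⟩]
          exact mem (m := m + j') (by omega) ((mem_bord_Iic_prod hP hQ).2
            ⟨m, j', rfl, hm, hv'' _⟩)
        · have hjy : j' < dim y := by
            have : k < dim x + dim y := hk
            omega
          have h := (hQ.spherical y j' hjy).subset ⟨hv'' 1, hv'' (-1)⟩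
          obtain ⟨m, σ, rfl, hm⟩ : ∃ m σ, m + 1 = j' ∧ v ∈ bord m σ (Set.Iic y) := by
            obtain ⟨m, hm, h | h⟩ := h
            exacts [⟨m, _, hm, h⟩, ⟨m, _, hm, h⟩]
          exact mem (m := i + m) (σ := (-1) ^ i * σ) (by omega) ((mem_bord_Iic_prod hP hQ).2
            ⟨i, m, rfl, hu'' _, by rwa [sign_mul_sign]⟩)
      · refine mem (m := k - 1) (σ := -1) (by omega) ((mem_bord_Iic_prod hP hQ).2
          ⟨i', k - 1 - i', by omega, hu', gy.bord_mono (by omega) (fun h => ?_) hv⟩)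
        obtain rfl : i = i' + 1 := by omega
        rw [pow_succ]
        simp
    · rintro p ⟨m, hm, h | h⟩
      · have g := isGlobular_Iic_prod hP hQ (x, y)
        exact ⟨g.bord_subset_bord _ _ (by omega) h, g.bord_subset_bord _ _ (by omega) h⟩
      · have g := isGlobular_Iic_prod hP hQ (x, y)
        exact ⟨g.bord_subset_bord _ _ (by omega) h, g.bord_subset_bord _ _ (by omega) h⟩
  molecule := by
    rintro ⟨x, y⟩ α n hn
    rw [← Set.Iic_prod_Iic, bord_prod_eq_stairs (isGlobular_Iic hP _) (isGlobular_Iic hQ _)]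
    exact isMolecule_stairs hP hQ (isGlobular_Iic hP _) (isGlobular_Iic hQ _)
      (fun i j α β _ => ((IsMolecule.atom x).bord hP i α).prod hP hQ
        ((IsMolecule.atom y).bord hQ j β))
      _ (Nat.zero_le _) (Nat.zero_le _)
  globular p α β n _ := (isGlobular_Iic_prod hP hQ p).bord_bord α β (Nat.lt_succ_self n)

namespace Map

/-- The projection of a Gray product to the first factor. -/
def fst (hP : IsRegularDirectedComplex P) (hQ : IsRegularDirectedComplex Q) : Map (P × Q) P where
  toFun := Prod.fst
  bord_map p n α := by
    apply Set.Subset.antisymm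
    · intro u hu
      -- Molecules are nonempty, so any point of the `0`-boundary of the other factor completes `u`.
      obtain ⟨v, hv⟩ := ((IsMolecule.atom p.2).bord hQ 0 ((-1) ^ n * α)).nonempty
      exact ⟨(u, v), (mem_bord_Iic_prod hP hQ).2 ⟨n, 0, rfl, hu, hv⟩, rfl⟩
    · rintro _ ⟨q, hq, rfl⟩
      obtain ⟨i, j, hij, h, -⟩ := (mem_bord_Iic_prod hP hQ).1 hq
      exact (isGlobular_Iic hP _).bord_mono (by omega) (fun _ => rfl) h

/-- The projection of a Gray product to the second factor. -/
def snd (hP : IsRegularDirectedComplex P) (hQ : IsRegularDirectedComplex Q) : Map (P × Q) Q where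
  toFun := Prod.snd
  bord_map p n α := by
    apply Set.Subset.antisymm
    · intro v hv
      obtain ⟨u, hu⟩ := ((IsMolecule.atom p.1).bord hP 0 α).nonempty
      exact ⟨(u, v), (mem_bord_Iic_prod hP hQ).2 ⟨0, n, zero_add n, hu, by simpa using hv⟩, rfl⟩
    · rintro _ ⟨q, hq, rfl⟩
      obtain ⟨i, j, hij, -, h⟩ := (mem_bord_Iic_prod hP hQ).1 hq
      refine (isGlobular_Iic hQ _).bord_mono (by omega) (fun hj => ?_) h
      obtain rfl : i = 0 := by omega
      simp

/-- The Gray product of two maps. -/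
def prod {P' Q' : Type*} [PartialOrder P'] [OrientedGradedPoset P'] [PartialOrder Q']
    [OrientedGradedPoset Q'] (hP : IsRegularDirectedComplex P) (hQ : IsRegularDirectedComplex Q)
    (hP' : IsRegularDirectedComplex P') (hQ' : IsRegularDirectedComplex Q')
    (f : Map P P') (g : Map Q Q') : Map (P × Q) (P' × Q') where
  toFun p := (f p.1, g p.2)
  bord_map p n α := by
    ext q
    rw [mem_bord_Iic_prod hP' hQ']
    constructor
    · rintro ⟨i, j, hij, h₁, h₂⟩
      rw [f.bord_map] at h₁
      rw [g.bord_map] at h₂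
      obtain ⟨u, hu, hu'⟩ := h₁
      obtain ⟨v, hv, hv'⟩ := h₂
      exact ⟨(u, v), (mem_bord_Iic_prod hP hQ).2 ⟨i, j, hij, hu, hv⟩, Prod.ext hu' hv'⟩
    · rintro ⟨r, hr, rfl⟩
      obtain ⟨i, j, hij, h₁, h₂⟩ := (mem_bord_Iic_prod hP hQ).1 hr
      refine ⟨i, j, hij, ?_, ?_⟩
      · rw [f.bord_map]; exact ⟨_, h₁, rfl⟩
      · rw [g.bord_map]; exact ⟨_, h₂, rfl⟩

end Map

end Product

end OGP

namespace OGP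

/-! ### Maps and isomorphisms of oriented graded posets. -/

section Maps

variable {P Q R : Type*} [PartialOrder P] [OrientedGradedPoset P] [PartialOrder Q]
  [OrientedGradedPoset Q] [PartialOrder R] [OrientedGradedPoset R]

namespace Map

lemma image_Iic (f : Map P Q) (x : P) : f '' Set.Iic x = Set.Iic (f x) := by
  have h := f.bord_map x (max (dim x) (dim (f x))) 1
  rwa [bord_eq_self (isLowerSet_Iic _) ((dimLE_Iic _).mono (le_max_right _ _)),
    bord_eq_self (isLowerSet_Iic _) ((dimLE_Iic _).mono (le_max_left _ _)), eq_comm] at h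

lemma monotone (f : Map P Q) : Monotone f := fun x y h => by
  have : f x ∈ f '' Set.Iic y := ⟨x, h, rfl⟩
  rwa [f.image_Iic] at this

lemma dim_le (f : Map P Q) (x : P) : dim (f x) ≤ dim x := by
  have h := f.bord_map x (dim x) 1
  rw [bord_eq_self (isLowerSet_Iic x) (dimLE_Iic x)] at h
  have : f x ∈ bord (dim x) 1 (Set.Iic (f x)) := h ▸ ⟨x, le_rfl, rfl⟩
  exact dim_le_of_mem_bord this

/-- The orientation of an edge `y → x` is recovered from boundaries: it is a sign for which `x` lies
in the corresponding boundary of `y`. -/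
lemma IsIsomorphism.isSignedEmbedding {f : Map P Q} (hf : f.IsIsomorphism) :
    IsSignedEmbedding (fun _ => 1) f := by
  obtain ⟨g, hgf, hfg⟩ := hf
  have hgf' : ∀ x, g (f x) = x := fun x => congrArg (fun m : Map P P => m x) hgf
  have hfg' : ∀ x, f (g x) = x := fun x => congrArg (fun m : Map Q Q => m x) hfg
  have hd : ∀ x, dim (f x) = dim x := fun x =>
    le_antisymm (f.dim_le x) (by simpa [hgf'] using g.dim_le (f x))
  refine ⟨fun {x y} => ⟨fun h => ?_, fun h => f.monotone h⟩, fun x y _ _ => ⟨g y, hfg' y⟩, hd,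
    fun {x y} h h' => ?_⟩
  · simpa [hgf'] using g.monotone h
  · have hx : x ∈ bord (dim x) (orient h) (Set.Iic y) := by
      refine sbord_subset_bord ⟨h.le, rfl, fun z hz hxz => ?_⟩
      obtain rfl : z = y := eq_of_le_of_dim_le hz (by rw [dim_covBy h, dim_covBy hxz])
      rfl
    have hfx : f x ∈ bord (dim x) (orient h) (Set.Iic (f y)) := by
      rw [f.bord_map]
      exact ⟨x, hx, rfl⟩
    rw [one_mul]
    exact (mem_sbord_of_mem_bord hfx (hd x).ge).2.2 _ le_rfl h'

end Map

/-- Orientation-preserving closed embeddings are maps. -/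
def IsSignedEmbedding.toMap {f : P → Q} (hf : IsSignedEmbedding (fun _ => 1) f) : Map P Q where
  toFun := f
  bord_map x n α := by
    rw [← hf.image_Iic, ← hf.bord_image, one_mul]

namespace Map

/-- A lift of a map along an injective map is a map. -/
def lift (m : Map Q R) (hm : Function.Injective m) (h : Map P R) (k : P → Q)
    (hk : ∀ x, m (k x) = h x) : Map P Q where
  toFun := k
  bord_map x n α := by
    apply hm.image_injective
    rw [← m.bord_map, hk, h.bord_map, Set.image_image]
    simp only [hk]

end Map

end Maps

/-! ### Molecules have no nontrivial automorphisms. -/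

section Rigidity

variable {P : Type*} [PartialOrder P] [OrientedGradedPoset P] {φ : P → P} {U : Set P}

/-- `φ` restricts to an automorphism of `U`. -/
structure IsAutOn (φ : P → P) (U : Set P) : Prop where
  image_eq : φ '' U = U
  le_iff : ∀ x ∈ U, ∀ y ∈ U, φ x ≤ φ y ↔ x ≤ y
  dim_map : ∀ x ∈ U, dim (φ x) = dim x
  orient_map : ∀ x ∈ U, ∀ y ∈ U, ∀ (h : x ⋖ y) (h' : φ x ⋖ φ y), orient h' = orient h

namespace IsAutOn

lemma map_mem (h : IsAutOn φ U) {x : P} (hx : x ∈ U) : φ x ∈ U := h.image_eq ▸ ⟨x, hx, rfl⟩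

lemma restrict (h : IsAutOn φ U) {V : Set P} (hV : V ⊆ U) (hV' : ∀ x ∈ U, φ x ∈ V ↔ x ∈ V) :
    IsAutOn φ V where
  image_eq := by
    apply Set.Subset.antisymm
    · rintro _ ⟨x, hx, rfl⟩
      exact (hV' x (hV hx)).2 hx
    · intro y hy
      obtain ⟨x, hx, rfl⟩ := h.image_eq.symm.subset (hV hy)
      exact ⟨x, (hV' x hx).1 hy, rfl⟩
  le_iff x hx y hy := h.le_iff x (hV hx) y (hV hy)
  dim_map x hx := h.dim_map x (hV hx)
  orient_map x hx y hy := h.orient_map x (hV hx) y (hV hy)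

lemma lt_iff (h : IsAutOn φ U) {x y : P} (hx : x ∈ U) (hy : y ∈ U) : φ x < φ y ↔ x < y := by
  rw [lt_iff_le_not_ge, lt_iff_le_not_ge, h.le_iff x hx y hy, h.le_iff y hy x hx]

lemma covBy_iff (h : IsAutOn φ U) {x y : P} (hx : x ∈ U) (hy : y ∈ U) : φ x ⋖ φ y ↔ x ⋖ y := by
  constructor
  · intro hc
    have := dim_covBy hc
    rw [h.dim_map x hx, h.dim_map y hy] at this
    exact covBy_of_lt_of_dim ((h.lt_iff hx hy).1 hc.lt) this.le
  · intro hc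
    have := dim_covBy hc
    rw [← h.dim_map x hx, ← h.dim_map y hy] at this
    exact covBy_of_lt_of_dim ((h.lt_iff hx hy).2 hc.lt) this.le

lemma mem_sbord_iff (h : IsAutOn φ U) {n : ℕ} {α : ℤˣ} {x : P} (hx : x ∈ U) :
    φ x ∈ sbord n α U ↔ x ∈ sbord n α U := by
  constructor
  · rintro ⟨-, hd, hc⟩
    refine ⟨hx, by rw [← hd, h.dim_map x hx], fun y hy hxy => ?_⟩
    have hxy' := (h.covBy_iff hx hy).2 hxy
    rw [← h.orient_map x hx y hy hxy hxy']
    exact hc _ (h.map_mem hy) _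
  · rintro ⟨-, hd, hc⟩
    refine ⟨h.map_mem hx, by rw [← hd, h.dim_map x hx], fun y hy hxy => ?_⟩
    obtain ⟨y, hyU, rfl⟩ := h.image_eq.symm.subset hy
    rw [h.orient_map x hx y hyU ((h.covBy_iff hx hyU).1 hxy)]
    exact hc _ hyU _

lemma mem_bord_iff (h : IsAutOn φ U) {n : ℕ} {α : ℤˣ} {x : P} (hx : x ∈ U) :
    φ x ∈ bord n α U ↔ x ∈ bord n α U := by
  constructor
  · rintro (⟨y, hy, hxy⟩ | ⟨-, hd⟩)
    · obtain ⟨y, hyU, rfl⟩ := h.image_eq.symm.subset hy.1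
      exact Or.inl ⟨y, (h.mem_sbord_iff hyU).1 hy, (h.le_iff x hx y hyU).1 hxy⟩
    · refine Or.inr ⟨hx, fun y hy hxy => ?_⟩
      rw [← h.dim_map y hy]
      exact hd _ (h.map_mem hy) ((h.le_iff x hx y hy).2 hxy)
  · rintro (⟨y, hy, hxy⟩ | ⟨-, hd⟩)
    · exact Or.inl ⟨φ y, (h.mem_sbord_iff hy.1).2 hy, (h.le_iff x hx y hy.1).2 hxy⟩
    · refine Or.inr ⟨h.map_mem hx, fun y hy hxy => ?_⟩
      obtain ⟨y, hyU, rfl⟩ := h.image_eq.symm.subset hy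
      rw [h.dim_map y hyU]
      exact hd y hyU ((h.le_iff x hx y hyU).1 hxy)

lemma bord (h : IsAutOn φ U) (hU : IsLowerSet U) (n : ℕ) (α : ℤˣ) : IsAutOn φ (bord n α U) :=
  h.restrict (bord_subset hU) fun _ hx => h.mem_bord_iff hx

lemma apply_top {x : P} (h : IsAutOn φ (Set.Iic x)) : φ x = x := by
  obtain ⟨y, hy, hyx⟩ := h.image_eq.symm.subset (Set.mem_Iic.2 (le_refl x))
  have := h.dim_map y hy
  rw [hyx] at this
  rwa [eq_of_le_of_dim_le (show y ≤ x from hy) this.le] at hyx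

end IsAutOn

lemma IsAutOn.eq_self_Iic (hP : IsRegularDirectedComplex P) {n : ℕ}
    (ih : ∀ m < n, ∀ U : Set P, IsMolecule U → DimLE m U → IsAutOn φ U → ∀ x ∈ U, φ x = x)
    {x : P} (hx : dim x ≤ n) (h : IsAutOn φ (Set.Iic x)) : ∀ w ∈ Set.Iic x, φ w = w := by
  intro w hw
  rcases (show w ≤ x from hw).lt_or_eq with hlt | rfl
  · have := dim_strictMono hlt
    obtain ⟨m, hm⟩ : ∃ m, dim x = m + 1 := ⟨dim x - 1, by omega⟩
    obtain ⟨σ, hσ⟩ := mem_bord_Iic_of_lt hm hlt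
    exact ih m (by omega) _ (hP.molecule x σ m hm) dimLE_bord (h.bord (isLowerSet_Iic x) _ _) w hσ
  · exact h.apply_top

/-- Molecules in regular directed complexes have no nontrivial automorphisms. -/
theorem IsAutOn.eq_self (hP : IsRegularDirectedComplex P) (n : ℕ) :
    ∀ U : Set P, IsMolecule U → DimLE n U → IsAutOn φ U → ∀ x ∈ U, φ x = x := by
  induction n using Nat.strong_induction_on with
  | _ n ih =>
  intro Z hZ hd hφ
  have hcut : ∀ {U₁ U₂ : Set P} {k : ℕ}, IsMolecule U₁ → U₁ ⊆ Z → U₂ ⊂ U₁ ∪ U₂ →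
      U₁ ∩ U₂ = OGP.bord k 1 U₁ → k < n := by
    intro U₁ U₂ k h₁ hs ne₂ hout
    by_contra! hk
    rw [bord_eq_self h₁.lower (DimLE.mono (fun x hx => hd x (hs hx)) hk)] at hout
    rw [Set.union_eq_right.2 (Set.inter_eq_left.1 hout)] at ne₂
    exact ne₂.ne rfl
  rcases n with _ | m
  · cases hZ with
    | atom x => exact hφ.eq_self_Iic hP ih (hd x le_rfl)
    | paste U₁ U₂ k h₁ _ _ ne₂ hout _ =>
      exact absurd (hcut h₁ Set.subset_union_left ne₂ hout) (by omega)
  -- The input `m`-boundary is fixed by induction on dimension; being fixed then spreads through the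
  -- pastings that build `Z`.
  have key : ∀ W : Set P, IsMolecule W → W ⊆ Z → (∀ w ∈ OGP.bord m (-1) W, φ w = w) →
      ∀ w ∈ W, φ w = w := by
    intro W hW
    induction hW with
    | atom x =>
      intro hs hb
      have hxZ : x ∈ Z := hs (Set.mem_Iic.2 le_rfl)
      rcases (hd x hxZ).lt_or_eq with hlt | hx
      · rwa [bord_eq_self (isLowerSet_Iic x) ((dimLE_Iic x).mono (by omega))] at hb
      obtain ⟨w, hw⟩ := (hP.molecule x (-1) m hx).nonempty
      obtain ⟨w, hw, -⟩ := (mem_bord_Iic_iff (by omega)).1 hw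
      have hwx : w ⋖ x := by
        have hdw := hw.2.1
        refine covBy_of_lt_of_dim (lt_of_le_of_ne hw.1 ?_) (by omega)
        rintro rfl
        omega
      have hwφ : φ w = w := hb w (sbord_subset_bord hw)
      have hwZ : w ∈ Z := hs hw.1
      have hc := (hφ.covBy_iff hwZ hxZ).2 hwx
      have ho := hφ.orient_map w hwZ x hxZ hwx hc
      -- Both `x` and `φ x` cover the fixed input facet `w` with the same sign, and such a cover is
      -- unique in `Z`.
      have hφx : φ x = x := by
        have hc' : w ⋖ φ x := by rwa [hwφ] at hc
        refine hZ.cover_unique hd hw.2.1 (hφ.map_mem hxZ) hxZ hc' hwx ?_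
        rw [← ho]
        congr 1
        exact hwφ.symm
      refine IsAutOn.eq_self_Iic hP ih hx.le (hφ.restrict hs fun y hy => ?_)
      have := hφ.le_iff y hy x hxZ
      rwa [hφx] at this
    | paste U₁ U₂ k h₁ h₂ ne₁ ne₂ hout hin ih₁ ih₂ =>
      intro hs hb
      have s₁ := Set.subset_union_left.trans hs
      have s₂ := Set.subset_union_right.trans hs
      have hk := hcut h₁ s₁ ne₂ hout
      have hp : IsPasting k 1 U₁ U₂ :=
        ⟨h₁.isGlobular (isGlobular_Iic hP), h₂.isGlobular (isGlobular_Iic hP), hout, hin⟩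
      rcases (Nat.lt_succ_iff.1 hk).lt_or_eq with hk | rfl
      · rw [hp.bord_union_of_gt hk] at hb
        rintro w (hw | hw)
        · exact ih₁ s₁ (fun v hv => hb v (Or.inl hv)) w hw
        · exact ih₂ s₂ (fun v hv => hb v (Or.inr hv)) w hw
      -- When the pasting is along `m`-boundaries, `U₁` is fixed before `U₂`, whose input boundary
      -- lies in `U₁`.
      · rw [hp.bord_union_left] at hb
        have e₁ := ih₁ s₁ hb
        rintro w (hw | hw)
        · exact e₁ w hw
        · refine ih₂ s₂ (fun v hv => e₁ v ?_) w hw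
          rw [← hin] at hv
          exact hv.1
  exact key Z hZ subset_rfl
    (ih m (Nat.lt_succ_self m) _ (hZ.bord hP _ _) dimLE_bord (hφ.bord hZ.lower _ _))

/-- Isomorphisms between regular directed complexes with a greatest element are unique. -/
lemma Map.IsIsomorphism.eq {Q : Type*} [PartialOrder Q] [OrientedGradedPoset Q]
    (hP : IsRegularDirectedComplex P) {t : P} (ht : ∀ x, x ≤ t) {e e' : Map P Q}
    (he : e.IsIsomorphism) (he' : e'.IsIsomorphism) : e = e' := by
  have hs := he.isSignedEmbedding
  have hs' := he'.isSignedEmbedding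
  obtain ⟨g, hge, heg⟩ := he
  obtain ⟨g', hge', heg'⟩ := he'
  have hg : Map.IsIsomorphism g := ⟨e, heg, hge⟩
  have hsg := hg.isSignedEmbedding
  have huniv : Set.Iic t = Set.univ := Set.eq_univ_of_forall ht
  have hφ : IsAutOn (fun x => g (e' x)) (Set.Iic t) := by
    refine ⟨?_, fun x _ y _ => ?_, fun x _ => ?_, fun x _ y _ h h' => ?_⟩
    · rw [huniv, Set.image_univ]
      refine Set.eq_univ_of_forall fun x => ⟨g' (e x), ?_⟩
      have : e' (g' (e x)) = e x := congrArg (fun m : Map Q Q => m (e x)) heg'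
      simp only [this]
      exact congrArg (fun m : Map P P => m x) hge
    · rw [hsg.le_iff, hs'.le_iff]
    · simp only [hsg.dim_map, hs'.dim_map]
    · have h₁ := hs'.covBy_iff.2 h
      rw [hsg.orient_map h₁ h', hs'.orient_map h h₁, one_mul, one_mul]
  ext x
  have h := hφ.eq_self hP (dim t) _ (.atom t) (dimLE_Iic t) x (ht x)
  have h' : e (g (e' x)) = e' x := congrArg (fun m : Map Q Q => m (e' x)) heg
  rw [← h']
  exact congrArg e h.symm

end Rigidity

end OGP

namespace OGP

/-! ### Closures of elements as atoms, and factorization of maps. -/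

section Comap

variable {A P : Type*} [PartialOrder A] [PartialOrder P]

lemma map_covBy_map {f : A → P} (hle : ∀ x y, f x ≤ f y ↔ x ≤ y) (hl : IsLowerSet (Set.range f))
    {x y : A} (h : x ⋖ y) : f x ⋖ f y := by
  have hlt : ∀ {x y}, f x < f y ↔ x < y := fun {x y} => by
    rw [lt_iff_le_not_ge, lt_iff_le_not_ge, hle, hle]
  refine ⟨hlt.2 h.1, fun z h₁ h₂ => ?_⟩
  obtain ⟨z, rfl⟩ := hl h₂.le ⟨y, rfl⟩
  exact h.2 (hlt.1 h₁) (hlt.1 h₂)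

variable [OrientedGradedPoset P]

/-- The oriented graded poset structure induced by an order embedding with closed image. -/
abbrev comap (f : A → P) (hle : ∀ x y, f x ≤ f y ↔ x ≤ y) (hl : IsLowerSet (Set.range f)) :
    OrientedGradedPoset A where
  grade x := dim (f x)
  grade_strictMono x y h := dim_strictMono (by
    rw [lt_iff_le_not_ge, hle, hle, ← lt_iff_le_not_ge]; exact h)
  covBy_grade _ _ h := (map_covBy_map hle hl h).grade ℕ
  isMin_grade {x} h := by
    have : IsMin (f x) := fun z hz => by
      obtain ⟨z, rfl⟩ := hl hz ⟨x, rfl⟩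
      exact (hle _ _).2 (h ((hle _ _).1 hz))
    exact this.grade ℕ
  orient _ _ h := orient (map_covBy_map hle hl h)

lemma isSignedEmbedding_comap (f : A → P) (hle : ∀ x y, f x ≤ f y ↔ x ≤ y)
    (hl : IsLowerSet (Set.range f)) :
    letI := comap f hle hl
    IsSignedEmbedding (fun _ => 1) f :=
  letI := comap f hle hl
  { le_iff := hle _ _
    lower := hl
    dim_map := fun _ => rfl
    orient_map := fun _ _ => (one_mul _).symm }

end Comap

end OGP

namespace RegularAtom

variable {P : Type*} [PartialOrder P] [Finite P]

/-- An enumeration of the closure of an element. -/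
noncomputable def iicEnum (u : P) (v : Vertices (Nat.card (Set.Iic u))) : P :=
  ((Finite.equivFin (Set.Iic u)).symm v).1

lemma iicEnum_injective (u : P) : Function.Injective (iicEnum u) :=
  Subtype.val_injective.comp (Finite.equivFin (Set.Iic u)).symm.injective

lemma range_iicEnum (u : P) : Set.range (iicEnum u) = Set.Iic u := by
  ext x
  constructor
  · rintro ⟨v, rfl⟩
    exact ((Finite.equivFin (Set.Iic u)).symm v).2
  · intro hx
    exact ⟨Finite.equivFin (Set.Iic u) ⟨x, hx⟩,
      congrArg Subtype.val ((Finite.equivFin (Set.Iic u)).symm_apply_apply ⟨x, hx⟩)⟩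

lemma isLowerSet_range_iicEnum (u : P) : IsLowerSet (Set.range (iicEnum u)) := by
  rw [range_iicEnum]
  exact isLowerSet_Iic u

variable [OrientedGradedPoset P]

/-- The closure of an element of a finite regular directed complex, as a regular atom. -/
noncomputable def ofIic (hP : IsRegularDirectedComplex P) (u : P) : RegularAtom :=
  letI order : PartialOrder (Vertices (Nat.card (Set.Iic u))) :=
    PartialOrder.lift (iicEnum u) (iicEnum_injective u)
  letI ogp := OGP.comap (iicEnum u) (fun _ _ => Iff.rfl) (isLowerSet_range_iicEnum u)
  have ht := (range_iicEnum u).symm.subset (Set.mem_Iic.2 (le_refl u))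
  { card := Nat.card (Set.Iic u)
    order := order
    ogp := ogp
    regular := (isSignedEmbedding_comap (iicEnum u) (fun _ _ => Iff.rfl)
      (isLowerSet_range_iicEnum u)).isRegularDirectedComplex hP
    top := ht.choose
    le_top := fun x => by
      change iicEnum u x ≤ iicEnum u ht.choose
      rw [ht.choose_spec]
      exact (range_iicEnum u).subset ⟨x, rfl⟩ }

lemma isSignedEmbedding_ofIic (hP : IsRegularDirectedComplex P) (u : P) :
    IsSignedEmbedding (P := (ofIic hP u).Pts) (fun _ => 1) (iicEnum u) :=
  letI : PartialOrder (Vertices (Nat.card (Set.Iic u))) :=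
    PartialOrder.lift (iicEnum u) (iicEnum_injective u)
  isSignedEmbedding_comap (iicEnum u) (fun _ _ => Iff.rfl) (isLowerSet_range_iicEnum u)

end RegularAtom

namespace Atom

/-- The greatest element of an atom. -/
noncomputable def top (U : Atom) : U.Pts := U.rep.top

lemma le_top (U : Atom) (x : U.Pts) : x ≤ U.top := U.rep.le_top x

lemma Iic_top (U : Atom) : Set.Iic U.top = Set.univ := Set.eq_univ_of_forall U.le_top

lemma regular (U : Atom) : IsRegularDirectedComplex U.Pts := U.rep.regular

lemma dim_top (U : Atom) : OGP.dim U.top = U.dim := rfl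

/-- The morphism of atoms with a given underlying map. -/
noncomputable def ofMap {U V : Atom} (f : Map U.Pts V.Pts) : U ⟶ V :=
  (fromSkeleton RegularAtom).preimage (X := U) (Y := V) f

lemma toMap_ofMap {U V : Atom} (f : Map U.Pts V.Pts) : toMap (ofMap f) = f :=
  (fromSkeleton RegularAtom).map_preimage (X := U) (Y := V) f

lemma toMap_injective {U V : Atom} : Function.Injective (toMap : (U ⟶ V) → _) :=
  (fromSkeleton RegularAtom).map_injective

lemma toMap_comp_apply {U V W : Atom} (f : U ⟶ V) (g : V ⟶ W) (x : U.Pts) :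
    toMap (f ≫ g) x = toMap g (toMap f x) := rfl

lemma hom_ext {U V : Atom} {f g : U ⟶ V} (h : ∀ x, toMap f x = toMap g x) : f = g :=
  toMap_injective (Map.ext (funext h))

/-- The greatest element exceeds the boundary in dimension, and everything else lies under one of
its facets. -/
lemma mem_boundary_iff {U : Atom} {x : U.Pts} : x ∈ U.boundary ↔ x ≠ U.top := by
  rw [boundary, ← Iic_top]
  constructor
  · rintro ⟨k, hk, h | h⟩ rfl
    · have := dim_le_of_mem_bord h
      rw [dim_top] at this
      omega
    · have := dim_le_of_mem_bord h
      rw [dim_top] at this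
      omega
  · intro h
    have hlt := lt_of_le_of_ne (U.le_top x) h
    have := dim_strictMono hlt
    rw [dim_top] at this
    obtain ⟨σ, hσ⟩ := mem_bord_Iic_of_lt (n := U.dim - 1) (by rw [dim_top]; omega) hlt
    refine ⟨U.dim - 1, by omega, ?_⟩
    rcases Int.units_eq_one_or σ with rfl | rfl
    · exact Or.inl hσ
    · exact Or.inr hσ

/-- Closures of elements of finite regular directed complexes are atoms. -/
lemma exists_map_range_eq_Iic {P : Type*} [PartialOrder P] [OrientedGradedPoset P] [Finite P]
    (hP : IsRegularDirectedComplex P) (u : P) : ∃ (A : Atom) (i : Map A.Pts P),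
      IsSignedEmbedding (fun _ => 1) i ∧ i A.top = u ∧ Set.range i = Set.Iic u := by
  let R := RegularAtom.ofIic hP u
  have hR := RegularAtom.isSignedEmbedding_ofIic hP u
  let A : Atom := toSkeleton R
  let ι := fromSkeletonToSkeletonIso R
  let g : Map A.Pts R.Pts := ι.hom
  let g' : Map R.Pts A.Pts := ι.inv
  have hg : g.IsIsomorphism := ⟨g', ι.hom_inv_id, ι.inv_hom_id⟩
  have hgg' : ∀ x, g (g' x) = x := fun x =>
    congrArg (fun m : Map R.Pts R.Pts => m x) ι.inv_hom_id
  have hge := hg.isSignedEmbedding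
  have hrange : Set.range (hR.toMap.comp g) = Set.Iic u := by
    rw [← RegularAtom.range_iicEnum u]
    ext x
    constructor
    · rintro ⟨y, rfl⟩
      exact ⟨g y, rfl⟩
    · rintro ⟨y, rfl⟩
      exact ⟨g' y, congrArg (RegularAtom.iicEnum u) (hgg' y)⟩
  refine ⟨A, hR.toMap.comp g, ⟨?_, ?_, ?_, ?_⟩, ?_, hrange⟩
  · intro x y
    exact hR.le_iff.trans hge.le_iff
  · rw [hrange]
    exact isLowerSet_Iic u
  · intro x
    exact (hR.dim_map _).trans (hge.dim_map x)
  · intro x y h h'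
    have h₁ := hge.covBy_iff.2 h
    exact (hR.orient_map h₁ h').trans (by rw [one_mul, one_mul, hge.orient_map h h₁, one_mul])
  · obtain ⟨x, hx⟩ := hrange.symm.subset (Set.mem_Iic.2 (le_refl u))
    refine le_antisymm (hrange.subset ⟨_, rfl⟩) ?_
    exact hx.symm.trans_le ((hR.toMap.comp g).monotone (le_top _ x))

/-- A finite regular directed complex with a greatest element is isomorphic to an atom. -/
lemma exists_isIsomorphism {P : Type*} [PartialOrder P] [OrientedGradedPoset P] [Finite P]
    (hP : IsRegularDirectedComplex P) {t : P} (ht : ∀ x, x ≤ t) :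
    ∃ (A : Atom) (e : Map A.Pts P), e.IsIsomorphism := by
  obtain ⟨A, i, hi, -, hrange⟩ := exists_map_range_eq_Iic hP t
  have hsurj : ∀ x, ∃ y, i y = x := fun x => hrange.symm.subset (ht x)
  choose k hk using hsurj
  refine ⟨A, i, i.lift hi.injective (Map.id P) k hk, ?_, ?_⟩
  · ext x
    exact hi.injective (hk (i x))
  · ext x
    exact hk x

lemma map_isIsomorphism_top {P : Type*} [PartialOrder P] [OrientedGradedPoset P]
    {t : P} (ht : ∀ x, x ≤ t) {A : Atom} {e : Map A.Pts P} (he : e.IsIsomorphism) :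
    e A.top = t := by
  obtain ⟨g, -, hg⟩ := he
  refine le_antisymm (ht _) ?_
  rw [← show e (g t) = t from congrArg (fun m : Map P P => m t) hg]
  exact e.monotone (le_top _ _)

/-- Morphisms of atoms factor through the closure of the image of the greatest element. -/
lemma exists_factorization {W V : Atom} (f : W ⟶ V) : ∃ (A : Atom) (i : A ⟶ V) (g : W ⟶ A),
    f = g ≫ i ∧ toMap g W.top = A.top ∧ toMap i A.top = toMap f W.top ∧
      A.dim = OGP.dim (toMap f W.top) := by
  obtain ⟨A, i, hi, htop, hrange⟩ := exists_map_range_eq_Iic V.regular (toMap f W.top)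
  have hsurj : ∀ x, ∃ y, i y = toMap f x := fun x =>
    hrange.symm.subset ((toMap f).monotone (W.le_top x))
  choose k hk using hsurj
  refine ⟨A, ofMap i, ofMap (i.lift hi.injective (toMap f) k hk), hom_ext fun x => ?_, ?_, ?_, ?_⟩
  · rw [toMap_comp_apply, toMap_ofMap, toMap_ofMap]
    exact (hk x).symm
  · rw [toMap_ofMap]
    exact hi.injective ((hk _).trans htop.symm)
  · rw [toMap_ofMap, htop]
  · rw [← dim_top, ← hi.dim_map, htop]

lemma eq_of_isIsomorphism {U V : Atom} {e : Map U.Pts V.Pts} (he : e.IsIsomorphism) : U = V := by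
  obtain ⟨g, h₁, h₂⟩ := he
  refine skeleton_skeletal RegularAtom
    ⟨⟨ofMap e, ofMap g, hom_ext fun x => ?_, hom_ext fun x => ?_⟩⟩
  · rw [toMap_comp_apply, toMap_ofMap, toMap_ofMap]
    exact congrArg (fun m : Map U.Pts U.Pts => m x) h₁
  · rw [toMap_comp_apply, toMap_ofMap, toMap_ofMap]
    exact congrArg (fun m : Map V.Pts V.Pts => m x) h₂

end Atom

/-! ### Diagrammatic complexes and normal forms. -/

/-- The characteristic function of `p` on `B` and the constant `False` on `C` agree on `A`, so they
factor through the pushout and keep `p` apart from everything else. -/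
lemma CategoryTheory.IsPushout.types_separate {A B C D : Type u} {i : A ⟶ B} {a : A ⟶ C}
    {c : B ⟶ D} {s : C ⟶ D} (h : IsPushout i a c s) {p : B} (hp : p ∉ Set.range i) :
    (∀ q, c q = c p → q = p) ∧ ∀ q, s q ≠ c p := by
  let φ : B ⟶ ULift.{u} Prop := TypeCat.ofHom fun q => ⟨q = p⟩
  let ψ : C ⟶ ULift.{u} Prop := TypeCat.ofHom fun _ => ⟨False⟩
  have w : i ≫ φ = a ≫ ψ := by
    refine ConcreteCategory.hom_ext _ _ fun x => ?_
    exact congrArg ULift.up (propext ⟨fun hx => hp ⟨x, hx⟩, False.elim⟩)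
  have hφ : ∀ q, h.desc φ ψ w (c q) = ⟨q = p⟩ := fun q => types_congr_hom (h.inl_desc φ ψ w) q
  have hψ : ∀ q, h.desc φ ψ w (s q) = ⟨False⟩ := fun q => types_congr_hom (h.inr_desc φ ψ w) q
  constructor
  · intro q hq
    have := hφ q
    rw [hq, hφ p] at this
    exact (congrArg ULift.down this).mp rfl
  · intro q hq
    have := hψ q
    rw [hq, hφ p] at this
    exact (congrArg ULift.down this).mp rfl

lemma Atom.forall_mem_boundary_iff {W V : Atom} (f : W ⟶ V) :
    (∀ w, toMap f w ∈ V.boundary) ↔ toMap f W.top ≠ V.top := by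
  refine ⟨fun h => mem_boundary_iff.1 (h _), fun h w => mem_boundary_iff.2 fun hw => h ?_⟩
  exact le_antisymm (V.le_top _) (hw ▸ (toMap f).monotone (W.le_top w))

/-- Every cell is in a unique way the pullback of a generating cell along a map of atoms that
preserves the greatest element. -/
structure HasNormalForms (X : DiagrammaticSet.{u}) (gen : ℕ → Set (Cell X)) : Prop where
  exists_eq_map : ∀ (W : Atom) (w : X.obj (op W)), ∃ n, ∃ x ∈ gen n, ∃ f : W ⟶ x.1,
    Atom.toMap f W.top = x.1.top ∧ w = X.map f.op x.2
  unique : ∀ (W : Atom) (n n' : ℕ), ∀ x ∈ gen n, ∀ x' ∈ gen n', ∀ (f : W ⟶ x.1) (f' : W ⟶ x'.1),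
    Atom.toMap f W.top = x.1.top → Atom.toMap f' W.top = x'.1.top →
    X.map f.op x.2 = X.map f'.op x'.2 →
    (⟨x, f⟩ : Σ x : Cell X, (W ⟶ x.1)) = ⟨x', f'⟩

lemma map_map_apply {X : DiagrammaticSet.{u}} {U V W : Atom} (g : U ⟶ V) (f : V ⟶ W)
    (x : X.obj (op W)) : X.map g.op (X.map f.op x) = X.map (g ≫ f).op x := by
  rw [op_comp, Functor.map_comp]
  rfl

namespace IsDiagrammaticComplex

variable {X : DiagrammaticSet.{u}} {gen : ℕ → Set (Cell X)}

lemma separate (hX : IsDiagrammaticComplex X gen) {W : Atom} {n : ℕ} {x : Cell X}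
    (hx : x ∈ gen n) {f : W ⟶ x.1} (hf : Atom.toMap f W.top = x.1.top) :
    X.map f.op x.2 ∉ (skeletonBelow X n).obj (op W) ∧
    ∀ x' ∈ gen n, ∀ f' : W ⟶ x'.1, X.map f'.op x'.2 = X.map f.op x.2 →
      (⟨x, f⟩ : Σ x : Cell X, (W ⟶ x.1)) = ⟨x', f'⟩ := by
  obtain ⟨att, h⟩ := hX.pushout n
  let p : (coprodShapes (gen n)).obj (op W) := ⟨⟨x, hx⟩, f⟩
  have hp : p ∉ Set.range ((coprodBoundaries (gen n)).ι.app (op W)) := by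
    rintro ⟨⟨q, hq⟩, rfl⟩
    exact (Atom.forall_mem_boundary_iff _).1 hq hf
  obtain ⟨h₁, h₂⟩ := (h.app (op W)).types_separate hp
  refine ⟨fun hs => h₂ ⟨_, hs⟩ rfl, fun x' hx' f' he => ?_⟩
  have := h₁ ⟨⟨x', hx'⟩, f'⟩ (Subtype.ext he)
  exact congrArg (fun q : Σ x : gen n, (W ⟶ x.1.1) =>
    (⟨q.1.1, q.2⟩ : Σ x : Cell X, (W ⟶ x.1))) this.symm

/-- By induction on the skeleton: a pushout is covered by its two legs, and a map into a shape that
misses the greatest element is sent by the attaching map to the previous skeleton. -/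
lemma exists_eq_map_of_mem_skeletonBelow (hX : IsDiagrammaticComplex X gen) {W : Atom} (m : ℕ) :
    ∀ w ∈ (skeletonBelow X m).obj (op W), ∃ n, ∃ x ∈ gen n, ∃ f : W ⟶ x.1,
      Atom.toMap f W.top = x.1.top ∧ w = X.map f.op x.2 := by
  induction m with
  | zero =>
    rintro w ⟨V, f, y, hV, -⟩
    exact absurd hV (Nat.not_lt_zero _)
  | succ m ih =>
    intro w hw
    obtain ⟨att, h⟩ := hX.pushout m
    have h' := h.app (op W)
    rcases Limits.Types.eq_or_eq_of_isPushout h' ⟨w, hw⟩ with ⟨⟨⟨x, hx⟩, f⟩, hp⟩ | ⟨⟨v, hv⟩, hp⟩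
    · by_cases hf : Atom.toMap f W.top = x.1.top
      · exact ⟨m, x, hx, f, hf, congrArg Subtype.val hp.symm⟩
      · let q : (coprodBoundaries (gen m)).toFunctor.obj (op W) :=
          ⟨⟨⟨x, hx⟩, f⟩, (Atom.forall_mem_boundary_iff _).2 hf⟩
        have hq := types_congr_hom h'.w q
        have hw' : w = (att.app (op W) q).1 := (congrArg Subtype.val hp.symm).trans
          (congrArg Subtype.val hq)
        rw [hw']
        exact ih _ (att.app (op W) q).2
    · obtain rfl : v = w := congrArg Subtype.val hp
      exact ih v hv

theorem hasNormalForms (hX : IsDiagrammaticComplex X gen) : HasNormalForms X gen where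
  exists_eq_map W w := hX.exists_eq_map_of_mem_skeletonBelow (W.dim + 1) w
    ⟨W, 𝟙 W, w, Nat.lt_succ_self _, by simp⟩
  unique W n n' x hx x' hx' f f' hf hf' h := by
    -- Generators of different dimensions cannot have a common pullback of this kind: it would lie
    -- in the skeleton below the larger dimension, contrary to `separate`.
    have key : ∀ {n n' : ℕ} {x x' : Cell X} {f : W ⟶ x.1} {f' : W ⟶ x'.1}, x ∈ gen n → x' ∈ gen n' →
        Atom.toMap f' W.top = x'.1.top →
        X.map f.op x.2 = X.map f'.op x'.2 → ¬ n < n' := fun {n n' x x' f f'} hx hx' hf' h hn =>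
      (hX.separate hx' hf').1 ⟨x.1, f, x.2, by rwa [hX.dim_eq n x hx], h.symm⟩
    obtain rfl : n = n' := by
      have := key hx hx' hf' h
      have := key hx' hx hf h.symm
      omega
    exact (hX.separate hx hf).2 x' hx' f' h.symm

end IsDiagrammaticComplex

namespace HasNormalForms

variable {X : DiagrammaticSet.{u}} {gen : ℕ → Set (Cell X)}

/-- Factoring the map to `V` through the closure `A` of the image of the greatest element and taking
the normal form over `A` gives a second normal form of the same cell. By uniqueness, the shape of
`x` is an image of `A`, and maps do not raise dimension. -/
lemma lt_of_mem_skeletonBelow (h : HasNormalForms X gen)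
    (hd : ∀ n, ∀ x ∈ gen n, Atom.dim x.1 = n) {W : Atom} {m n : ℕ} {x : Cell X} (hx : x ∈ gen n)
    {f : W ⟶ x.1} (hf : Atom.toMap f W.top = x.1.top)
    (hm : X.map f.op x.2 ∈ (skeletonBelow X m).obj (op W)) : n < m := by
  obtain ⟨V, k, y, hV, hk⟩ := hm
  obtain ⟨A, i, g, rfl, hg, hi, hA⟩ := Atom.exists_factorization k
  obtain ⟨n', x', hx', f', hf', he⟩ := h.exists_eq_map A (X.map i.op y)
  have hgf : Atom.toMap (g ≫ f') W.top = x'.1.top := by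
    rw [Atom.toMap_comp_apply, hg, hf']
  have := h.unique W n n' x hx x' hx' f (g ≫ f') hf hgf (by
    rw [hk, ← map_map_apply, he, map_map_apply])
  obtain rfl : x = x' := congrArg Sigma.fst this
  rw [← hd n x hx]
  refine lt_of_le_of_lt ?_ hV
  have h₁ := (Atom.toMap f').dim_le A.top
  rw [hf', Atom.dim_top, Atom.dim_top, hA] at h₁
  exact h₁.trans (OGP.dim_mono (Atom.le_top _ _))

/-- The attaching map of the generating cells. -/
noncomputable def attach (X : DiagrammaticSet.{u}) (gen : ℕ → Set (Cell X))
    (hd : ∀ n, ∀ x ∈ gen n, Atom.dim x.1 = n) (n : ℕ) :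
    (coprodBoundaries (gen n)).toFunctor ⟶ (skeletonBelow X n).toFunctor where
  app W := TypeCat.ofHom fun p => ⟨X.map p.1.2.op p.1.1.1.2, by
    obtain ⟨A, i, g, hf, hg, hi, hA⟩ := Atom.exists_factorization p.1.2
    refine ⟨A, g, X.map i.op p.1.1.1.2, ?_, ?_⟩
    · rw [hA]
      exact (dim_strictMono (lt_of_le_of_ne (Atom.le_top _ _)
        ((Atom.forall_mem_boundary_iff _).1 p.2))).trans_eq (hd n _ p.1.1.2)
    · rw [hf, map_map_apply]⟩
  naturality W W' g := ConcreteCategory.hom_ext _ _ fun p => by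
    apply Subtype.ext
    change X.map (g.unop ≫ p.1.2).op p.1.1.1.2 = X.map g.unop.op (X.map p.1.2.op p.1.1.1.2)
    rw [map_map_apply]

theorem isDiagrammaticComplex (h : HasNormalForms X gen)
    (hd : ∀ n, ∀ x ∈ gen n, Atom.dim x.1 = n) : IsDiagrammaticComplex X gen where
  dim_eq := hd
  pushout n := by
    refine ⟨attach X gen hd n, IsPushout.of_forall_isPushout_app fun W => IsPushout.flip ?_⟩
    have : Mono ((Subfunctor.homOfLe (skeletonBelow_le_succ X n)).app W) := by
      rw [mono_iff_injective]
      intro x y hxy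
      exact Subtype.ext (congrArg
        (Subtype.val : (skeletonBelow X (n + 1)).toFunctor.obj W → X.obj W) hxy)
    have hrange : ∀ p : (coprodShapes (gen n)).obj W,
        p ∉ Set.range ((coprodBoundaries (gen n)).ι.app W) →
        Atom.toMap p.2 W.unop.top = p.1.1.1.top := fun p hp => by
      by_contra hf
      exact hp ⟨⟨p, (Atom.forall_mem_boundary_iff _).2 hf⟩, rfl⟩
    -- A commutative square of sets whose bottom map is injective is a pushout if it is a pullback,
    -- its legs cover the corner, and the other leg is injective off the boundary.
    apply Limits.Types.isPushout_of_isPullback_of_mono'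
    · rw [Limits.Types.isPullback_iff]
      refine ⟨?_, fun p q hpq => Subtype.ext hpq.2, fun v p hvp => ?_⟩
      · ext p
        rfl
      · have hv : v.1 = X.map p.2.op p.1.1.2 := congrArg Subtype.val hvp
        have hp : Atom.toMap p.2 W.unop.top ≠ p.1.1.1.top := fun hf =>
          absurd (h.lt_of_mem_skeletonBelow hd p.1.2 hf (hv ▸ v.2)) (lt_irrefl n)
        exact ⟨⟨p, (Atom.forall_mem_boundary_iff _).2 hp⟩, Subtype.ext hv.symm, rfl⟩
    · refine Set.eq_univ_of_forall fun w => ?_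
      obtain ⟨m, x, hx, f, hf, he⟩ := h.exists_eq_map W.unop w.1
      have hm := h.lt_of_mem_skeletonBelow hd hx hf (he ▸ w.2)
      rcases (Nat.lt_succ_iff.1 hm).lt_or_eq with hm | rfl
      · exact Or.inl ⟨⟨w.1, x.1, f, x.2, by rwa [hd m x hx], he⟩, rfl⟩
      · exact Or.inr ⟨⟨⟨x, hx⟩, f⟩, Subtype.ext he.symm⟩
    · intro p q hp hq hpq
      have := h.unique W.unop n n p.1.1 p.1.2 q.1.1 q.1.2 p.2 q.2 (hrange p hp) (hrange q hq)
        (congrArg Subtype.val hpq)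
      obtain ⟨⟨x, hx⟩, f⟩ := p
      obtain ⟨⟨x', hx'⟩, f'⟩ := q
      obtain rfl : x = x' := congrArg Sigma.fst this
      obtain rfl : f = f' := eq_of_heq (Sigma.mk.inj this).2
      rfl

end HasNormalForms

/-! ### Normal forms in Gray products of diagrammatic sets. -/

section GrayProjections

variable {X Y : DiagrammaticSet.{u}}

/-- The projection of the Gray product onto its first factor. -/
noncomputable def grayFst {W : Atom} : (gray X Y).obj (op W) → X.obj (op W) :=
  Quot.lift (fun t => X.map
    (Atom.ofMap ((Map.fst t.1.regular t.2.1.regular).comp t.2.2.1)).op t.2.2.2.1) (by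
    rintro _ _ ⟨a, b, h, h', x, y, hh⟩
    dsimp only
    rw [map_map_apply]
    congr 3
    refine congrArg Quiver.Hom.op (Atom.hom_ext fun w => ?_)
    rw [Atom.toMap_comp_apply, Atom.toMap_ofMap, Atom.toMap_ofMap]
    exact (congrArg Prod.fst (hh w)).symm)

/-- The projection of the Gray product onto its second factor. -/
noncomputable def graySnd {W : Atom} : (gray X Y).obj (op W) → Y.obj (op W) :=
  Quot.lift (fun t => Y.map
    (Atom.ofMap ((Map.snd t.1.regular t.2.1.regular).comp t.2.2.1)).op t.2.2.2.2) (by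
    rintro _ _ ⟨a, b, h, h', x, y, hh⟩
    dsimp only
    rw [map_map_apply]
    congr 3
    refine congrArg Quiver.Hom.op (Atom.hom_ext fun w => ?_)
    rw [Atom.toMap_comp_apply, Atom.toMap_ofMap, Atom.toMap_ofMap]
    exact (congrArg Prod.snd (hh w)).symm)

/-- The class of a triple in the Gray product. -/
def grayMk {W : Atom} (x : Cell X) (y : Cell Y) (h : Map W.Pts (x.1.Pts × y.1.Pts)) :
    (gray X Y).obj (op W) :=
  Quot.mk _ (⟨x.1, y.1, h, x.2, y.2⟩ : GrayTriple X Y W)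

lemma exists_grayMk_eq {W : Atom} (z : (gray X Y).obj (op W)) :
    ∃ (x : Cell X) (y : Cell Y) (h : Map W.Pts (x.1.Pts × y.1.Pts)), z = grayMk x y h := by
  obtain ⟨⟨U, V, h, x, y⟩, rfl⟩ := Quot.exists_rep z
  exact ⟨⟨U, x⟩, ⟨V, y⟩, h, rfl⟩

lemma map_grayMk {W W' : Atom} (f : W' ⟶ W) (x : Cell X) (y : Cell Y)
    (h : Map W.Pts (x.1.Pts × y.1.Pts)) :
    (gray X Y).map f.op (grayMk x y h) = grayMk x y (h.comp (Atom.toMap f)) := rfl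

lemma grayMk_map {W : Atom} {U V : Atom} {x : Cell X} {y : Cell Y} (a : U ⟶ x.1) (b : V ⟶ y.1)
    (h : Map W.Pts (U.Pts × V.Pts)) (h' : Map W.Pts (x.1.Pts × y.1.Pts))
    (hh : ∀ w, h' w = (Atom.toMap a (h w).1, Atom.toMap b (h w).2)) :
    grayMk (⟨U, X.map a.op x.2⟩ : Cell X) (⟨V, Y.map b.op y.2⟩ : Cell Y) h = grayMk x y h' :=
  Quot.sound (GrayRel.mk a b h h' x.2 y.2 hh)

/-- The projections of the cell to `X` and `Y` are in normal form, with maps the two coordinates of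
`h`; these determine `h`. -/
lemma grayMk_injective {genX : ℕ → Set (Cell X)} {genY : ℕ → Set (Cell Y)}
    (hX : HasNormalForms X genX) (hY : HasNormalForms Y genY) {W : Atom} {k k' l l' : ℕ}
    {x x' : Cell X} {y y' : Cell Y} (hx : x ∈ genX k) (hx' : x' ∈ genX k') (hy : y ∈ genY l)
    (hy' : y' ∈ genY l') {h : Map W.Pts (x.1.Pts × y.1.Pts)} {h' : Map W.Pts (x'.1.Pts × y'.1.Pts)}
    (ht : h W.top = (x.1.top, y.1.top)) (ht' : h' W.top = (x'.1.top, y'.1.top))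
    (he : grayMk x y h = grayMk x' y' h') :
    (⟨x, y, h⟩ : Σ (x : Cell X) (y : Cell Y), Map W.Pts (x.1.Pts × y.1.Pts)) = ⟨x', y', h'⟩ := by
  have e₁ := hX.unique W k k' x hx x' hx' _ _ (by rw [Atom.toMap_ofMap]; exact congrArg Prod.fst ht)
    (by rw [Atom.toMap_ofMap]; exact congrArg Prod.fst ht') (congrArg grayFst he)
  have e₂ := hY.unique W l l' y hy y' hy' _ _ (by rw [Atom.toMap_ofMap]; exact congrArg Prod.snd ht)
    (by rw [Atom.toMap_ofMap]; exact congrArg Prod.snd ht') (congrArg graySnd he)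
  obtain rfl : x = x' := congrArg Sigma.fst e₁
  obtain rfl : y = y' := congrArg Sigma.fst e₂
  have f₁ := congrArg Atom.toMap (eq_of_heq (Sigma.mk.inj e₁).2)
  have f₂ := congrArg Atom.toMap (eq_of_heq (Sigma.mk.inj e₂).2)
  simp only [Atom.toMap_ofMap] at f₁ f₂
  obtain rfl : h = h' := by
    ext1
    funext w
    exact Prod.ext (congrArg (fun m : Map _ _ => m w) f₁) (congrArg (fun m : Map _ _ => m w) f₂)
  rfl

lemma Atom.le_top_prod (U V : Atom) (p : U.Pts × V.Pts) : p ≤ (U.top, V.top) :=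
  ⟨U.le_top _, V.le_top _⟩

lemma IsGrayCell.exists_grayMk {x : Cell X} {y : Cell Y} {z : Cell (gray X Y)}
    (hz : IsGrayCell x y z) : ∃ e : Map z.1.Pts (x.1.Pts × y.1.Pts), e.IsIsomorphism ∧
      e z.1.top = (x.1.top, y.1.top) ∧ z.2 = grayMk x y e := by
  obtain ⟨e, he, hz⟩ := hz
  exact ⟨e, he, Atom.map_isIsomorphism_top (Atom.le_top_prod _ _) he, hz⟩

lemma exists_isGrayCell (x : Cell X) (y : Cell Y) : ∃ z : Cell (gray X Y), IsGrayCell x y z := by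
  obtain ⟨A, e, he⟩ := Atom.exists_isIsomorphism (x.1.regular.prod y.1.regular)
    (Atom.le_top_prod x.1 y.1)
  exact ⟨⟨A, grayMk x y e⟩, e, he, rfl⟩

/-- The shapes agree because the category of atoms is skeletal, and the two isomorphisms with the
product agree by rigidity. -/
lemma IsGrayCell.eq {x : Cell X} {y : Cell Y} {z z' : Cell (gray X Y)} (hz : IsGrayCell x y z)
    (hz' : IsGrayCell x y z') : z = z' := by
  obtain ⟨A, z⟩ := z
  obtain ⟨A', z'⟩ := z'
  obtain ⟨e, he, hze⟩ : ∃ e : Map A.Pts (x.1.Pts × y.1.Pts), e.IsIsomorphism ∧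
    z = grayMk x y e := hz
  obtain ⟨e', he', hze'⟩ : ∃ e : Map A'.Pts (x.1.Pts × y.1.Pts), e.IsIsomorphism ∧
    z' = grayMk x y e := hz'
  subst hze hze'
  obtain rfl : A = A' := by
    obtain ⟨g, h₁, h₂⟩ := he
    obtain ⟨g', h₁', h₂'⟩ := he'
    refine Atom.eq_of_isIsomorphism (e := g'.comp e) ⟨g.comp e', ?_, ?_⟩
    · ext a
      have : e' (g' (e a)) = e a := congrArg (fun m : Map _ _ => m (e a)) h₂'
      exact (congrArg g this).trans (congrArg (fun m : Map _ _ => m a) h₁)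
    · ext a
      have : e (g (e' a)) = e' a := congrArg (fun m : Map _ _ => m (e' a)) h₂
      exact (congrArg g' this).trans (congrArg (fun m : Map _ _ => m a) h₁')
  obtain rfl : e = e' := he.eq A.regular A.le_top he'
  rfl

lemma IsGrayCell.dim_eq {x : Cell X} {y : Cell Y} {z : Cell (gray X Y)} (hz : IsGrayCell x y z) :
    z.1.dim = x.1.dim + y.1.dim := by
  obtain ⟨e, he, ht, -⟩ := hz.exists_grayMk
  rw [← Atom.dim_top, ← he.isSignedEmbedding.dim_map, ht]
  rfl

/-- Every cell of the Gray product is represented by a top-preserving map. -/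
lemma exists_grayMk_eq_of_top {W : Atom} (z : (gray X Y).obj (op W)) :
    ∃ (x : Cell X) (y : Cell Y) (h : Map W.Pts (x.1.Pts × y.1.Pts)),
      h W.top = (x.1.top, y.1.top) ∧ z = grayMk x y h := by
  obtain ⟨x, y, h, rfl⟩ := exists_grayMk_eq z
  -- The map takes values below the image of the greatest element, so it lifts to the product of the
  -- closures of the two coordinates; the coend relation absorbs the restriction of the cells.
  obtain ⟨A, i, hi, hit, hir⟩ := Atom.exists_map_range_eq_Iic x.1.regular (h W.top).1
  obtain ⟨B, j, hj, hjt, hjr⟩ := Atom.exists_map_range_eq_Iic y.1.regular (h W.top).2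
  have hsurj : ∀ w, ∃ p : A.Pts × B.Pts, (i p.1, j p.2) = h w := fun w => by
    have hw := h.monotone (W.le_top w)
    obtain ⟨a, ha⟩ := hir.symm.subset (Set.mem_Iic.2 hw.1)
    obtain ⟨b, hb⟩ := hjr.symm.subset (Set.mem_Iic.2 hw.2)
    exact ⟨(a, b), Prod.ext ha hb⟩
  choose k hk using hsurj
  let m := Map.prod A.regular B.regular x.1.regular y.1.regular i j
  have hm : Function.Injective m := hi.injective.prodMap hj.injective
  refine ⟨⟨A, X.map (Atom.ofMap i).op x.2⟩, ⟨B, Y.map (Atom.ofMap j).op y.2⟩, m.lift hm h k hk,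
    hm ((hk _).trans (Prod.ext hit.symm hjt.symm)), (grayMk_map _ _ _ _ fun w => ?_).symm⟩
  rw [Atom.toMap_ofMap, Atom.toMap_ofMap]
  exact (hk w).symm

theorem HasNormalForms.gray {genX : ℕ → Set (Cell X)} {genY : ℕ → Set (Cell Y)}
    (hX : HasNormalForms X genX) (hY : HasNormalForms Y genY) :
    HasNormalForms (gray X Y) (grayGen genX genY) where
  exists_eq_map W w := by
    obtain ⟨⟨A, x⟩, ⟨B, y⟩, h, ht, rfl⟩ := exists_grayMk_eq_of_top w
    obtain ⟨k, x₀, hx₀, f, hf, rfl⟩ := hX.exists_eq_map A x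
    obtain ⟨l, y₀, hy₀, g, hg, rfl⟩ := hY.exists_eq_map B y
    obtain ⟨z, hz⟩ := exists_isGrayCell x₀ y₀
    obtain ⟨e, he, het, hze⟩ := hz.exists_grayMk
    have hinj := he.isSignedEmbedding.injective
    -- The cell of shape `z` is defined through the isomorphism `e`, so the map `K` into the product
    -- of shapes is transported along the inverse of `e`.
    obtain ⟨e', -, hee'⟩ := he
    let K := (Map.prod A.regular B.regular x₀.1.regular y₀.1.regular
      (Atom.toMap f) (Atom.toMap g)).comp h
    have hK : e.comp (e'.comp K) = K := by
      ext1
      funext w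
      exact congrArg (fun m : Map _ _ => m (K w)) hee'
    have hKt : K W.top = (x₀.1.top, y₀.1.top) := by
      rw [← hf, ← hg]
      exact congrArg (fun p : A.Pts × B.Pts => (Atom.toMap f p.1, Atom.toMap g p.2)) ht
    refine ⟨k + l, z, ⟨k, l, rfl, x₀, hx₀, y₀, hy₀, hz⟩, Atom.ofMap (e'.comp K), ?_, ?_⟩
    · rw [Atom.toMap_ofMap]
      exact hinj ((congrArg (fun m : Map _ _ => m W.top) hK).trans (hKt.trans het.symm))
    · rw [hze, map_grayMk, Atom.toMap_ofMap, hK]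
      exact grayMk_map f g h K fun _ => rfl
  unique := by
    rintro W n n' z ⟨k, l, -, x, hx, y, hy, hz⟩ z' ⟨k', l', -, x', hx', y', hy', hz'⟩ f f' hf hf' h
    obtain ⟨e, he, het, hze⟩ := hz.exists_grayMk
    obtain ⟨e', he', het', hze'⟩ := hz'.exists_grayMk
    rw [hze, hze', map_grayMk, map_grayMk] at h
    have key := grayMk_injective hX hY hx hx' hy hy' ((congrArg e hf).trans het)
      ((congrArg e' hf').trans het') h
    obtain rfl : x = x' := congrArg Sigma.fst key
    have key := eq_of_heq (Sigma.mk.inj key).2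
    obtain rfl : y = y' := congrArg Sigma.fst key
    have key := eq_of_heq (Sigma.mk.inj key).2
    obtain rfl := hz.eq hz'
    obtain rfl : e = e' := he.eq z.1.regular z.1.le_top he'
    obtain rfl : f = f' := Atom.hom_ext fun w =>
      he.isSignedEmbedding.injective (congrArg (fun m : Map _ _ => m w) key)
    rfl

end GrayProjections

/-- Each pair of cells `x`, `y` has exactly one product cell `x ⊠ y`, distinct pairs of generating
cells have distinct products, and `X ⊠ Y` with the products of generating cells is a diagrammatic
complex. -/
theorem mainTheorem11 (X Y : DiagrammaticSet.{u})
    (genX : ℕ → Set (Cell X)) (genY : ℕ → Set (Cell Y))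
    (hX : IsDiagrammaticComplex X genX) (hY : IsDiagrammaticComplex Y genY) :
    (∀ (x : Cell X) (y : Cell Y), ∃! z : Cell (gray X Y), IsGrayCell x y z) ∧
    (∀ k l k' l', ∀ x ∈ genX k, ∀ y ∈ genY l, ∀ x' ∈ genX k', ∀ y' ∈ genY l',
      ∀ z : Cell (gray X Y), IsGrayCell x y z → IsGrayCell x' y' z → x = x' ∧ y = y') ∧
    IsDiagrammaticComplex (gray X Y) (grayGen genX genY) := by
  refine ⟨fun x y => ?_, fun k l k' l' x hx y hy x' hx' y' hy' z hz hz' => ?_, ?_⟩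
  · obtain ⟨z, hz⟩ := exists_isGrayCell x y
    exact ⟨z, hz, fun z' hz' => hz'.eq hz⟩
  · obtain ⟨e, -, het, hze⟩ := hz.exists_grayMk
    obtain ⟨e', -, het', hze'⟩ := hz'.exists_grayMk
    have key := grayMk_injective hX.hasNormalForms hY.hasNormalForms hx hx' hy hy' het het'
      (hze.symm.trans hze')
    obtain rfl : x = x' := congrArg Sigma.fst key
    exact ⟨rfl, congrArg Sigma.fst (eq_of_heq (Sigma.mk.inj key).2)⟩
  · refine (hX.hasNormalForms.gray hY.hasNormalForms).isDiagrammaticComplex ?_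
    rintro n z ⟨k, l, rfl, x, hx, y, hy, hz⟩
    rw [hz.dim_eq, hX.dim_eq k x hx, hY.dim_eq l y hy]
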